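/- **Setting.** Let $F$ be a field of characteristic $\neq 2$ and $V$ a two-dimensional $F$-vector space with a nonzero alternating bilinear form $\langle\cdot|\cdot\rangle$. Put $\gamma_{a,b}=\langle a|\cdot\rangle b+\langle b|\cdot\rangle a$ and let $\mathfrak{sp}(V)=\operatorname{span}\{\gamma_{a,b}\}$ be the Lie algebra of endomorphisms $s$ with $\langle s(x)|y\rangle+\langle x|s(y)\rangle=0$. For a quadratic form $q$ write $q(x,y)=q(x+y)-q(x)-q(y)$. *Symmetric compositions.* Let $S_8=(V\otimes V)\oplus(V\otimes V)$ with product $$(a\otimes b,\,c\otimes d)*(a'\otimes b',\,c'\otimes d')=\bigl(\langle b|a'\rangle\, b'\otimes a-\langle d|d'\rangle\, c\otimes c',\ -\langle a|c'\rangle\, b\otimes d'-\langle c|b'\rangle\, a'\otimes d\bigr)$$ and norm determined by $q\bigl((a\otimes b,c\otimes d),(a'\otimes b',c'\otimes d')\bigr)=\langle a|a'\rangle\langle b|b'\rangle+\langle c|c'\rangle\langle d|d'\rangle$, and let $S_4=V\otimes V\subset S_8$ be the first summand. These are symmetric composition algebras: $q$ is regular, $q(x*y)=q(x)q(y)$ and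 $q(x*y,z)=q(x,y*z)$. *The algebras $\mathfrak g(S,S')$.* For a symmetric composition algebra $(S,*,q)$ let $\mathfrak{tri}(S)$ be the Lie algebra of triples $(d_0,d_1,d_2)\in\mathfrak o(S,q)^3$ with $d_0(x*y)=d_1(x)*y+x*d_2(y)$ for all $x,y$; let $\theta(d_0,d_1,d_2)=(d_2,d_0,d_1)$ and $$t_{x,y}=\bigl(q(x,\cdot)y-q(y,\cdot)x,\ \tfrac12q(x,y)\mathrm{id}-r_xl_y,\ \tfrac12q(x,y)\mathrm{id}-l_xr_y\bigr)\in\mathfrak{tri}(S),\qquad l_x(z)=x*z,\ r_x(z)=z*x .$$ For two such algebras $S,S'$ let $$\mathfrak g(S,S')=\bigl(\mathfrak{tri}(S)\oplus\mathfrak{tri}(S')\bigr)\oplus\bigoplus_{i=0}^{2}\iota_i(S\otimes S')$$ with the anticommutative product for which $\mathfrak{tri}(S)\oplus\mathfrak{tri}(S')$ is a Lie subalgebra, $[(d,d'),\iota_i(a\otimes x)]=\iota_i\bigl(d_i(a)\otimes x+a\otimes d'_i(x)\bigr)$, $[\iota_i(a\otimes x),\iota_{i+1}(b\otimes y)]=\iota_{i+2}\bigl((a*b)\otimes(x*y)\bigr)$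 (indices mod $3$), and $[\iota_i(a\otimes x),\iota_i(b\otimes y)]=q'(x,y)\theta^i(t_{a,b})+q(a,b)\theta'^i(t'_{x,y})$. Put $\mathfrak e_7=\mathfrak g(S_8,S_4)$ and $\mathfrak d_6=\mathfrak g(S_4,S_4)$. *The modules $V(\sigma)$ and the maps $\varphi_{\sigma,\tau}$.* Let $N$ be a finite set of indices, $V_i=V$ for $i\in N$. For $\emptyset\ne\sigma\subseteq N$ let $V(\sigma)=\bigotimes_{i\in\sigma}V_i$, and let $V(\emptyset)=\mathfrak{sp}(V)^N$; write $\nu_i:\mathfrak{sp}(V)\to\mathfrak{sp}(V)^N$ for the inclusion of the $i$-th component. Let $\sigma+\tau$ be the symmetric difference. The bilinear maps $\varphi_{\sigma,\tau}:V(\sigma)\times V(\tau)\to V(\sigma+\tau)$ are: * $\varphi_{\emptyset,\emptyset}$ is the bracket of $\mathfrak{sp}(V)^N$; for $\tau\neq\emptyset$, $\varphi_{\emptyset,\tau}(s,u)=s.u$ is the natural action of $\mathfrak{sp}(V)^N$ on $V(\tau)$, and $\varphi_{\tau,\emptyset}(u,s)=-s.u$; * for $\sigma\ne\tau$ both nonempty,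 $\varphi_{\sigma,\tau}\bigl(\bigotimes_{i\in\sigma} v_i,\bigotimes_{i\in\tau} w_i\bigr)=\prod_{i\in\sigma\cap\tau}\langle v_i|w_i\rangle\ \bigotimes_{j\in\sigma+\tau}u_j$, where $u_j=v_j$ if $j\in\sigma$ and $u_j=w_j$ if $j\in\tau$; * for $\sigma\ne\emptyset$, $\varphi_{\sigma,\sigma}\bigl(\bigotimes v_i,\bigotimes w_i\bigr)=-\tfrac12\sum_{i\in\sigma}\Bigl(\prod_{k\in\sigma,\,k\ne i}\langle v_k|w_k\rangle\Bigr)\nu_i(\gamma_{v_i,w_i})$. *Index sets and signs.* Let $N_7=\{1,\dots,7\}$, $N_6=\{1,2,3,5,6,7\}$. Write $1256$ for $\{1,2,5,6\}$, etc. Put $$\mathcal S_{\mathfrak e_7}=\{\emptyset,1256,2367,1357,1234,3456,1467,2457\},\qquad \mathcal S_{\mathfrak d_6}=\{\emptyset,1256,2367,1357\},$$ and let $\varepsilon_{\mathfrak e_7}(\sigma,\tau)$ be the entry in row $\sigma$ and column $\tau$ of the following matrix, whose rows and columns are indexed by $\mathcal S_{\mathfrak e_7}$ in the order just listed: $$\begin{pmatrix}1&1&1&1&1&1&1&1\\1&-1&1&-1&1&-1&-1&1\\1&-1&-1&1&1&1&-1&-1\\1&1&-1&-1&1&-1&1&-1\\1&-1&-1&-1&-1&1&1&1\\1&1&-1&1&-1&-1&-1&1\\1&1&1&-1&-1&1&-1&-1\\1&-1&1&1&-1&-1&1&-1\end{pmatrix}$$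 Let $\varepsilon_{\mathfrak d_6}$ be the restriction of $\varepsilon_{\mathfrak e_7}$ to $\mathcal S_{\mathfrak d_6}\times\mathcal S_{\mathfrak d_6}$ (the upper left $4\times4$ corner). Identify $2^{N_7}=\mathbb Z_2^7$ and $2^{N_6}=\mathbb Z_2^6$ (coordinates in increasing order of the index), and let $$\chi_3:\mathbb Z_2^3\to\mathbb Z_2^7,\quad (x_1,x_2,x_3)\mapsto(x_1+x_3,\,x_1+x_2+x_3,\,x_2+x_3,\,x_3,\,x_1,\,x_1+x_2,\,x_2),$$ $$\chi_2:\mathbb Z_2^2\to\mathbb Z_2^6,\quad (x_1,x_2)\mapsto(x_1,\,x_1+x_2,\,x_2,\,x_1,\,x_1+x_2,\,x_2),$$ $$f(x,y)=\sum_{i\ge j}x_iy_j+x_1y_2y_3+x_2y_1y_3+x_3y_1y_2\quad(x,y\in\mathbb Z_2^3),\qquad f'(x,y)=x_1y_1+x_2(y_1+y_2)\quad(x,y\in\mathbb Z_2^2).$$ Let $\mathbb O$ be the real octonion algebra, the double $\mathbb H\oplus\mathbb H l$ of the quaternions, where a pair $(a,b)$ stands for $a+bl$ and the product is $(a,b)(c,d)=(ac-\bar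 d b,\,da+b\bar c)$; let $e^x=(i^{x_1}j^{x_2})l^{x_3}$ for $x\in\mathbb Z_2^3$ (exponents read as $0,1$), so that the $e^x$ are $1,i,j,k=ij,l,il,jl,kl$. **Theorem.** 1. $\chi_3$ is a bijection of $\mathbb Z_2^3$ onto $\mathcal S_{\mathfrak e_7}$. Number the seven points of the Fano plane (the nonzero vectors of $\mathbb Z_2^3$) by $1\leftrightarrow(1,0,1)$, $2\leftrightarrow(1,1,1)$, $3\leftrightarrow(0,1,1)$, $4\leftrightarrow(0,0,1)$, $5\leftrightarrow(1,0,0)$, $6\leftrightarrow(1,1,0)$, $7\leftrightarrow(0,1,0)$; then the nonempty elements of $\mathcal S_{\mathfrak e_7}$ are exactly the complements of the seven lines. 2. For all $\sigma,\tau\in\mathcal S_{\mathfrak e_7}$, $$\varepsilon_{\mathfrak e_7}(\sigma,\tau)=(-1)^{f(\chi_3^{-1}(\sigma),\chi_3^{-1}(\tau))},$$ and these are the signs of the octonion multiplication: $(e^x)_{x\in\mathbb Z_2^3}$ is a basis of $\mathbb O$ and $e^xe^y=\varepsilon_{\mathfrak e_7}(\chi_3(x),\chi_3(y))\,e^{x+y}$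 for all $x,y$. 3. $\chi_2$ is a bijection of $\mathbb Z_2^2$ onto $\mathcal S_{\mathfrak d_6}$, and $\varepsilon_{\mathfrak d_6}(\sigma,\tau)=(-1)^{f'(\chi_2^{-1}(\sigma),\chi_2^{-1}(\tau))}$ for all $\sigma,\tau\in\mathcal S_{\mathfrak d_6}$. 4. $\mathfrak e_7$ and $\mathfrak d_6$ are Lie algebras. There is a linear isomorphism $$\Phi_7:\ \bigoplus_{\sigma\in\mathcal S_{\mathfrak e_7}}V(\sigma)\ \longrightarrow\ \mathfrak e_7=\mathfrak g(S_8,S_4)\qquad(V(\emptyset)=\mathfrak{sp}(V)^7),$$ such that, writing $v_{ij}=v_i\otimes v_j$, * $\bigotimes v_i$ in $V(1256)$, $V(3456)$, $V(2367)$, $V(1467)$, $V(1357)$, $V(2457)$ is sent, respectively, to $\iota_0((v_{12},0)\otimes v_{56})$, $\iota_0((0,v_{34})\otimes v_{56})$, $\iota_1((v_{23},0)\otimes v_{67})$, $\iota_1((0,v_{14})\otimes v_{67})$, $\iota_2((v_{31},0)\otimes v_{75})$, $\iota_2((0,v_{24})\otimes v_{75})$; * $s=(s_1,\dots,s_7)\in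 V(\emptyset)$ is sent to $(d,d')\in\mathfrak{tri}(S_8)\oplus\mathfrak{tri}(S_4)$, where $d_0,d_1,d_2$ are the actions of $(s_1,s_2,s_3,s_4)$, $(s_2,s_3,s_1,s_4)$, $(s_3,s_1,s_2,s_4)$ on $V\otimes V\oplus V\otimes V$, and $d'_0,d'_1,d'_2$ the actions of $(s_5,s_6)$, $(s_6,s_7)$, $(s_7,s_5)$ on $V\otimes V$; * $v_1\otimes v_2\otimes v_3\otimes v_4\in V(1234)$ is sent to $(d,0)$ with $d_0=\rho(v_1,v_2,v_3,v_4)$, $d_1=\rho(v_2,v_3,v_1,v_4)$, $d_2=\rho(v_3,v_1,v_2,v_4)$, where $\rho(a,b,c,d)$ maps $(w_1\otimes w_2,w_3\otimes w_4)$ to $\bigl(\langle c|w_3\rangle\langle d|w_4\rangle\,a\otimes b,\,-\langle a|w_1\rangle\langle b|w_2\rangle\,c\otimes d\bigr)$. With $\mathfrak e_7$ identified with $\bigoplus_\sigma V(\sigma)$ through $\Phi_7$, for all $\sigma,\tau\in\mathcal S_{\mathfrak e_7}$ one has $\sigma+\tau\in\mathcal S_{\mathfrak e_7}$ and $$[x_\sigma,y_\tau]=\varepsilon_{\mathfrak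 e_7}(\sigma,\tau)\,\varphi_{\sigma,\tau}(x_\sigma,y_\tau)\qquad(x_\sigma\in V(\sigma),\ y_\tau\in V(\tau)).$$ 5. Likewise there is a linear isomorphism $\Phi_6:\bigoplus_{\sigma\in\mathcal S_{\mathfrak d_6}}V(\sigma)\to\mathfrak d_6=\mathfrak g(S_4,S_4)$, with $V(\emptyset)=\mathfrak{sp}(V)^6$, sending $\bigotimes v_i$ in $V(1256)$, $V(2367)$, $V(1357)$ to $\iota_0(v_{12}\otimes v_{56})$, $\iota_1(v_{23}\otimes v_{67})$, $\iota_2(v_{31}\otimes v_{75})$ and $s\in V(\emptyset)$ to $(d,d')\in\mathfrak{tri}(S_4)\oplus\mathfrak{tri}(S_4)$, where $d_0,d_1,d_2$ are the actions of $(s_1,s_2)$, $(s_2,s_3)$, $(s_3,s_1)$ on $V\otimes V$ and $d'_0,d'_1,d'_2$ those of $(s_5,s_6)$, $(s_6,s_7)$, $(s_7,s_5)$; under it, $\sigma+\tau\in\mathcal S_{\mathfrak d_6}$ and $$[x_\sigma,y_\tau]=\varepsilon_{\mathfrak d_6}(\sigma,\tau)\,\varphi_{\sigma,\tau}(x_\sigma,y_\tau)\qquad(\sigma,\tau\in\mathcal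 S_{\mathfrak d_6}).$$ This model is the restriction of that of $\mathfrak e_7$: there is an injective Lie algebra homomorphism $\psi:\mathfrak d_6\to\mathfrak e_7$ which on each $\iota_i(S_4\otimes S_4)$ is induced by the inclusion $S_4\subset S_8$, and through $\Phi_6,\Phi_7$ it is the identity $V(\sigma)\to V(\sigma)$ for $\emptyset\ne\sigma\in\mathcal S_{\mathfrak d_6}$ and the inclusion $\mathfrak{sp}(V)^6\subset\mathfrak{sp}(V)^7$ (zero in the component $4$) for $\sigma=\emptyset$. -/

import Mathlib

open scoped TensorProduct DirectSum

/-- A symmetric composition algebra `(S, *, q)` over `F`: a regular multiplicative quadratic form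
`q` whose polar form is associative, `q(x * y, z) = q(x, y * z)`. -/
structure SymmetricComposition (F S : Type*) [Field F] [AddCommGroup S] [Module F S] where
  /-- the (nonassociative) product -/
  mul : S →ₗ[F] S →ₗ[F] S
  /-- the norm -/
  q : QuadraticForm F S
  regular : q.polarBilin.Nondegenerate
  comp : ∀ x y, q (mul x y) = q x * q y
  assoc : ∀ x y z, q.polarBilin (mul x y) z = q.polarBilin x (mul y z)

namespace SymmetricComposition

variable {F S S' : Type*} [Field F] [AddCommGroup S] [Module F S] [AddCommGroup S'] [Module F S']

/-- The polar form `q(x, y) = q(x + y) - q(x) - q(y)`. -/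
noncomputable abbrev pol (A : SymmetricComposition F S) : S →ₗ[F] S →ₗ[F] F := A.q.polarBilin

theorem pol_comm (A : SymmetricComposition F S) (x y : S) : A.pol x y = A.pol y x := by
  simp [pol, QuadraticMap.polar_comm]

theorem eq_of_pol (A : SymmetricComposition F S) {x y : S} (h : ∀ z, A.pol x z = A.pol y z) :
    x = y := by
  rw [← sub_eq_zero]
  refine A.regular.1 _ fun z => ?_
  have := h z
  simp only [pol] at this
  rw [map_sub, LinearMap.sub_apply, this, sub_self]

theorem pol_mul_left (A : SymmetricComposition F S) (x y z : S) :
    A.pol (A.mul x y) (A.mul x z) = A.q x * A.pol y z := by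
  simp only [pol, QuadraticMap.polarBilin_apply_apply, QuadraticMap.polar, ← map_add, A.comp]
  ring

theorem pol_mul_right (A : SymmetricComposition F S) (x y z : S) :
    A.pol (A.mul y x) (A.mul z x) = A.q x * A.pol y z := by
  simp only [pol, QuadraticMap.polarBilin_apply_apply, QuadraticMap.polar]
  rw [← LinearMap.add_apply, ← map_add, A.comp, A.comp, A.comp]
  ring

theorem mul_mul_self (A : SymmetricComposition F S) (x y : S) :
    A.mul (A.mul x y) x = A.q x • y := by
  refine A.eq_of_pol fun z => ?_
  rw [A.assoc, A.pol_mul_left, map_smul, LinearMap.smul_apply, smul_eq_mul]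

theorem self_mul_mul (A : SymmetricComposition F S) (x y : S) :
    A.mul x (A.mul y x) = A.q x • y := by
  refine A.eq_of_pol fun z => ?_
  rw [A.pol_comm, ← A.assoc, A.pol_mul_right, map_smul, LinearMap.smul_apply, smul_eq_mul,
    A.pol_comm]

theorem q_add (A : SymmetricComposition F S) (x y : S) :
    A.q (x + y) = A.q x + A.q y + A.pol x y := by
  simp only [pol, QuadraticMap.polarBilin_apply_apply, QuadraticMap.polar]
  ring

theorem lin_left (A : SymmetricComposition F S) (x y z : S) :
    A.mul (A.mul x y) z = A.pol x z • y - A.mul (A.mul z y) x := by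
  have h := A.mul_mul_self (x + z) y
  simp only [map_add, LinearMap.add_apply, A.mul_mul_self, A.q_add, add_smul] at h
  rw [eq_sub_iff_add_eq]
  linear_combination (norm := module) (1 : F) • h

theorem lin_right (A : SymmetricComposition F S) (x y z : S) :
    A.mul x (A.mul y z) = A.pol x z • y - A.mul z (A.mul y x) := by
  have h := A.self_mul_mul (x + z) y
  simp only [map_add, LinearMap.add_apply, A.self_mul_mul, A.q_add, add_smul] at h
  rw [eq_sub_iff_add_eq]
  linear_combination (norm := module) (1 : F) • h

/-- The triality Lie algebra `tri(S, *, q)`: the triples `(d₀, d₁, d₂)` of elements of the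
orthogonal Lie algebra `o(S, q)` with `d₀(x * y) = d₁(x) * y + x * d₂(y)`. -/
def tri (A : SymmetricComposition F S) : Submodule F (Fin 3 → Module.End F S) where
  carrier := {d | (∀ i x y, A.pol (d i x) y + A.pol x (d i y) = 0) ∧
    ∀ x y, d 0 (A.mul x y) = A.mul (d 1 x) y + A.mul x (d 2 y)}
  zero_mem' := by simp
  add_mem' := by
    rintro d e ⟨h1, h2⟩ ⟨h3, h4⟩
    refine ⟨fun i x y => ?_, fun x y => ?_⟩
    · have := h1 i x y
      have := h3 i x y
      simp only [Pi.add_apply, LinearMap.add_apply, map_add] at *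
      linear_combination h1 i x y + h3 i x y
    · simp only [Pi.add_apply, LinearMap.add_apply, map_add, h2, h4]
      abel
  smul_mem' := by
    rintro c d ⟨h1, h2⟩
    refine ⟨fun i x y => ?_, fun x y => ?_⟩
    · simp only [Pi.smul_apply, LinearMap.smul_apply, map_smul, smul_eq_mul]
      linear_combination c * h1 i x y
    · simp only [Pi.smul_apply, LinearMap.smul_apply, map_smul, h2, smul_add]

theorem lie_mem_tri (A : SymmetricComposition F S) {d e : Fin 3 → Module.End F S}
    (hd : d ∈ A.tri) (he : e ∈ A.tri) : d * e - e * d ∈ A.tri := by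
  obtain ⟨h1, h2⟩ := hd
  obtain ⟨h3, h4⟩ := he
  refine ⟨fun i x y => ?_, fun x y => ?_⟩
  · simp only [Pi.sub_apply, Pi.mul_apply, LinearMap.sub_apply, Module.End.mul_apply, map_sub]
    linear_combination h1 i (e i x) y - h3 i x (d i y) - h3 i (d i x) y + h1 i x (e i y)
  · simp only [Pi.sub_apply, Pi.mul_apply, LinearMap.sub_apply, Module.End.mul_apply, map_sub,
      h2, h4, map_add]
    abel

/-- The Lie bracket of `tri(S, *, q)`, the componentwise commutator. -/
def triLie (A : SymmetricComposition F S) : A.tri →ₗ[F] A.tri →ₗ[F] A.tri :=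
  LinearMap.mk₂ F (fun d e => ⟨d.1 * e.1 - e.1 * d.1, A.lie_mem_tri d.2 e.2⟩)
    (fun d d' e => Subtype.ext (by simp only [Submodule.coe_add]; noncomm_ring))
    (fun c d e => Subtype.ext (by simp only [Submodule.coe_smul, smul_mul_assoc, mul_smul_comm, smul_sub]))
    (fun d e e' => Subtype.ext (by simp only [Submodule.coe_add]; noncomm_ring))
    (fun c d e => Subtype.ext (by simp only [Submodule.coe_smul, smul_mul_assoc, mul_smul_comm, smul_sub]))

theorem rot_mem_tri (A : SymmetricComposition F S) {d : Fin 3 → Module.End F S}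
    (hd : d ∈ A.tri) : ![d 2, d 0, d 1] ∈ A.tri := by
  obtain ⟨h1, h2⟩ := hd
  refine ⟨fun i x y => ?_, fun x y => ?_⟩
  · fin_cases i
    exacts [h1 2 x y, h1 0 x y, h1 1 x y]
  · refine A.eq_of_pol fun z => ?_
    change A.pol (d 2 (A.mul x y)) z = A.pol (A.mul (d 0 x) y + A.mul x (d 1 y)) z
    rw [map_add, LinearMap.add_apply]
    have e1 := h1 2 (A.mul x y) z
    have e2 := h1 0 x (A.mul y z)
    have e3 : A.pol (A.mul x y) (d 2 z) = A.pol x (A.mul y (d 2 z)) := A.assoc _ _ _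
    have e4 : A.pol (A.mul (d 0 x) y) z = A.pol (d 0 x) (A.mul y z) := A.assoc _ _ _
    have e5 : A.pol (A.mul x (d 1 y)) z = A.pol x (A.mul (d 1 y) z) := A.assoc _ _ _
    rw [h2, map_add] at e2
    linear_combination e1 - e2 - e3 - e4 - e5

/-- The triality automorphism `θ(d₀, d₁, d₂) = (d₂, d₀, d₁)`. -/
def theta (A : SymmetricComposition F S) : Module.End F A.tri where
  toFun d := ⟨![d.1 2, d.1 0, d.1 1], A.rot_mem_tri d.2⟩
  map_add' d e := Subtype.ext (by ext i; fin_cases i <;> rfl)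
  map_smul' c d := Subtype.ext (by ext i; fin_cases i <;> rfl)

/-- `t_{x,y} = (σ_{x,y}, ½ q(x,y) id - r_x l_y, ½ q(x,y) id - l_x r_y)`, where
`σ_{x,y}(z) = q(x,z) y - q(y,z) x`, `r_x(z) = z * x` and `l_x(z) = x * z`. -/
noncomputable def tFun (A : SymmetricComposition F S) (x y : S) : Fin 3 → Module.End F S :=
  ![(A.pol x).smulRight y - (A.pol y).smulRight x,
    (2⁻¹ * A.pol x y) • LinearMap.id - A.mul.flip x ∘ₗ A.mul y,
    (2⁻¹ * A.pol x y) • LinearMap.id - A.mul x ∘ₗ A.mul.flip y]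

theorem tFun_mem [NeZero (2 : F)] (A : SymmetricComposition F S) (x y : S) :
    A.tFun x y ∈ A.tri := by
  have h2 : (2 : F)⁻¹ + 2⁻¹ = 1 := by
    have := NeZero.ne (2 : F)
    field_simp
    norm_num
  refine ⟨fun i u v => ?_, fun u v => ?_⟩
  · fin_cases i
    · change A.pol (A.pol x u • y - A.pol y u • x) v + A.pol u (A.pol x v • y - A.pol y v • x) = 0
      simp only [map_sub, map_smul, LinearMap.sub_apply, LinearMap.smul_apply, smul_eq_mul,
        A.pol_comm u]
      ring
    · change A.pol ((2⁻¹ * A.pol x y) • u - A.mul (A.mul y u) x) v +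
        A.pol u ((2⁻¹ * A.pol x y) • v - A.mul (A.mul y v) x) = 0
      have e1 : A.pol (A.mul (A.mul y u) x) v = A.pol y (A.mul u (A.mul x v)) := by
        simp only [pol, A.assoc]
      have e2 : A.pol u (A.mul (A.mul y v) x) = A.pol y (A.mul v (A.mul x u)) := by
        rw [A.pol_comm]
        simp only [pol, A.assoc]
      have e3 := congrArg (A.pol y) (A.lin_right u x v)
      simp only [map_sub, map_smul, LinearMap.sub_apply, LinearMap.smul_apply, smul_eq_mul] at *
      rw [A.pol_comm y x] at e3
      linear_combination -e1 - e2 - e3 + A.pol x y * A.pol u v * h2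
    · change A.pol ((2⁻¹ * A.pol x y) • u - A.mul x (A.mul u y)) v +
        A.pol u ((2⁻¹ * A.pol x y) • v - A.mul x (A.mul v y)) = 0
      have e1 : A.pol (A.mul x (A.mul u y)) v = A.pol x (A.mul (A.mul u y) v) := by
        simp only [pol, A.assoc]
      have e2 : A.pol u (A.mul x (A.mul v y)) = A.pol x (A.mul (A.mul v y) u) := by
        rw [A.pol_comm]
        simp only [pol, A.assoc]
      have e3 := congrArg (A.pol x) (A.lin_left u y v)
      simp only [map_sub, map_smul, LinearMap.sub_apply, LinearMap.smul_apply, smul_eq_mul] at *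
      linear_combination -e1 - e2 - e3 + A.pol x y * A.pol u v * h2
  · change A.pol x (A.mul u v) • y - A.pol y (A.mul u v) • x =
      A.mul ((2⁻¹ * A.pol x y) • u - A.mul (A.mul y u) x) v +
        A.mul u ((2⁻¹ * A.pol x y) • v - A.mul x (A.mul v y))
    have e1 := A.lin_left (A.mul y u) x v
    have e2 := A.lin_right (A.mul v x) y u
    have e3 := congrArg (A.mul u) (A.lin_right x v y)
    have e4 : A.pol (A.mul y u) v = A.pol y (A.mul u v) := A.assoc _ _ _
    have e5 : A.pol (A.mul v x) u = A.pol x (A.mul u v) := by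
      rw [A.pol_comm, A.pol_comm x]
      exact (A.assoc _ _ _).symm
    rw [e4] at e1
    rw [e5] at e2
    simp only [map_sub, map_smul, LinearMap.sub_apply, LinearMap.smul_apply] at *
    have h3 : A.pol x y • A.mul u v = (2⁻¹ * A.pol x y) • A.mul u v +
        (2⁻¹ * A.pol x y) • A.mul u v := by
      rw [← add_smul, ← add_mul, h2, one_mul]
    linear_combination (norm := module) (1 : F) • e1 + (-1 : F) • e2 + (1 : F) • e3 + (1 : F) • h3

/-- The bilinear map `(x, y) ↦ t_{x,y}` into `tri(S, *, q)`. -/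
noncomputable def t [NeZero (2 : F)] (A : SymmetricComposition F S) : S →ₗ[F] S →ₗ[F] A.tri :=
  LinearMap.mk₂ F (fun x y => ⟨A.tFun x y, A.tFun_mem x y⟩)
    (fun x x' y => Subtype.ext (by
      ext i z; fin_cases i <;>
      simp [tFun, -QuadraticMap.polarBilin_apply_apply, mul_add, add_smul] <;> abel))
    (fun c x y => Subtype.ext (by
      ext i z; fin_cases i <;>
      simp [tFun, -QuadraticMap.polarBilin_apply_apply, smul_sub, smul_smul, mul_left_comm, mul_comm]))
    (fun x y y' => Subtype.ext (by
      ext i z; fin_cases i <;>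
      simp [tFun, -QuadraticMap.polarBilin_apply_apply, mul_add, add_smul] <;> abel))
    (fun c x y => Subtype.ext (by
      ext i z; fin_cases i <;>
      simp [tFun, -QuadraticMap.polarBilin_apply_apply, smul_sub, smul_smul, mul_left_comm, mul_comm]))

end SymmetricComposition

section MagicSquareAlgebra

variable {F S S' : Type*} [Field F] [AddCommGroup S] [Module F S] [AddCommGroup S'] [Module F S']

/-- The vector space `g(S, S') = (tri(S) ⊕ tri(S')) ⊕ ι₀(S ⊗ S') ⊕ ι₁(S ⊗ S') ⊕ ι₂(S ⊗ S')`. -/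
abbrev MagicAlg (A : SymmetricComposition F S) (A' : SymmetricComposition F S') : Type _ :=
  (A.tri × A'.tri) × (Fin 3 → S ⊗[F] S')

namespace MagicAlg

variable (A : SymmetricComposition F S) (A' : SymmetricComposition F S')

/-- The inclusion of `tri(S) ⊕ tri(S')`, the degree `(0, 0)` part. -/
noncomputable def triIncl : (A.tri × A'.tri) →ₗ[F] MagicAlg A A' :=
  LinearMap.inl F (A.tri × A'.tri) (Fin 3 → S ⊗[F] S')

/-- The inclusion `ι_i` of the `i`-th copy of `S ⊗ S'`. -/
noncomputable def iota (i : Fin 3) : S ⊗[F] S' →ₗ[F] MagicAlg A A' :=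
  LinearMap.inr F (A.tri × A'.tri) (Fin 3 → S ⊗[F] S') ∘ₗ LinearMap.single F (fun _ => S ⊗[F] S') i

/-- The bilinear map `(a ⊗ x, b ⊗ y) ↦ q'(x, y) θ^i(t_{a,b})`. -/
noncomputable def thetaT [NeZero (2 : F)] (i : Fin 3) :
    S ⊗[F] S' →ₗ[F] S ⊗[F] S' →ₗ[F] A.tri :=
  (TensorProduct.map₂ (A.t.compr₂ (A.theta ^ (i : ℕ))) A'.pol).compr₂
    (TensorProduct.rid F A.tri).toLinearMap

/-- The bilinear map `(a ⊗ x, b ⊗ y) ↦ q(a, b) θ'^i(t'_{x,y})`. -/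
noncomputable def thetaT' [NeZero (2 : F)] (i : Fin 3) :
    S ⊗[F] S' →ₗ[F] S ⊗[F] S' →ₗ[F] A'.tri :=
  (TensorProduct.map₂ A.pol (A'.t.compr₂ (A'.theta ^ (i : ℕ)))).compr₂
    (TensorProduct.lid F A'.tri).toLinearMap

/-- The bilinear map `(a ⊗ x, b ⊗ y) ↦ (a * b) ⊗ (x * y)`. -/
noncomputable def tmulMul : S ⊗[F] S' →ₗ[F] S ⊗[F] S' →ₗ[F] S ⊗[F] S' :=
  TensorProduct.map₂ A.mul A'.mul

/-- The action of `tri(S) ⊕ tri(S')` on the `i`-th copy of `S ⊗ S'`: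
`(d, d') . (a ⊗ x) = d_i(a) ⊗ x + a ⊗ d'_i(x)`. -/
noncomputable def triAct (i : Fin 3) : (A.tri × A'.tri) →ₗ[F] Module.End F (S ⊗[F] S') :=
  LinearMap.coprod
    (LinearMap.rTensorHom S' ∘ₗ LinearMap.proj i ∘ₗ A.tri.subtype)
    (LinearMap.lTensorHom S ∘ₗ LinearMap.proj i ∘ₗ A'.tri.subtype)

/-- The anticommutative multiplication of `g(S, S')`, given on
`X = ((d, d'), u)` and `Y = ((e, e'), v)`. -/
noncomputable def bracket [NeZero (2 : F)] :
    MagicAlg A A' →ₗ[F] MagicAlg A A' →ₗ[F] MagicAlg A A' :=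
  LinearMap.mk₂ F
    (fun X Y =>
      ((A.triLie X.1.1 Y.1.1 + ∑ i, thetaT A A' i (X.2 i) (Y.2 i),
        A'.triLie X.1.2 Y.1.2 + ∑ i, thetaT' A A' i (X.2 i) (Y.2 i)),
       fun k => triAct A A' k X.1 (Y.2 k) - triAct A A' k Y.1 (X.2 k)
        + tmulMul A A' (X.2 (k + 1)) (Y.2 (k + 2)) - tmulMul A A' (Y.2 (k + 1)) (X.2 (k + 2))))
    (fun X X' Y => by
      ext1
      · ext1 <;> simp only [Prod.fst_add, Prod.snd_add, Pi.add_apply, map_add,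
          LinearMap.add_apply, Finset.sum_add_distrib] <;> exact add_add_add_comm _ _ _ _
      · ext1 k
        simp only [Prod.fst_add, Prod.snd_add, Pi.add_apply, map_add, LinearMap.add_apply]
        abel)
    (fun c X Y => by
      ext1
      · ext1 <;> simp only [Prod.smul_fst, Prod.smul_snd, Pi.smul_apply, map_smul,
          LinearMap.smul_apply, Finset.smul_sum, smul_add]
      · ext1 k
        simp only [Prod.smul_fst, Prod.smul_snd, Pi.smul_apply, map_smul, LinearMap.smul_apply,
          smul_add, smul_sub])
    (fun X Y Y' => by
      ext1
      · ext1 <;> simp only [Prod.fst_add, Prod.snd_add, Pi.add_apply, map_add,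
          LinearMap.add_apply, Finset.sum_add_distrib] <;> exact add_add_add_comm _ _ _ _
      · ext1 k
        simp only [Prod.fst_add, Prod.snd_add, Pi.add_apply, map_add, LinearMap.add_apply]
        abel)
    (fun c X Y => by
      ext1
      · ext1 <;> simp only [Prod.smul_fst, Prod.smul_snd, Pi.smul_apply, map_smul,
          LinearMap.smul_apply, Finset.smul_sum, smul_add]
      · ext1 k
        simp only [Prod.smul_fst, Prod.smul_snd, Pi.smul_apply, map_smul, LinearMap.smul_apply,
          smul_add, smul_sub])

@[simp] theorem thetaT_tmul [NeZero (2 : F)] (i : Fin 3) (a b : S) (x y : S') :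
    thetaT A A' i (a ⊗ₜ x) (b ⊗ₜ y) = A'.pol x y • (A.theta ^ (i : ℕ)) (A.t a b) := rfl

@[simp] theorem thetaT'_tmul [NeZero (2 : F)] (i : Fin 3) (a b : S) (x y : S') :
    thetaT' A A' i (a ⊗ₜ x) (b ⊗ₜ y) = A.pol a b • (A'.theta ^ (i : ℕ)) (A'.t x y) := rfl

@[simp] theorem tmulMul_tmul (a b : S) (x y : S') :
    tmulMul A A' (a ⊗ₜ x) (b ⊗ₜ y) = A.mul a b ⊗ₜ A'.mul x y := rfl

@[simp] theorem triAct_tmul (i : Fin 3) (d : A.tri × A'.tri) (a : S) (x : S') :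
    triAct A A' i d (a ⊗ₜ x) = d.1.1 i a ⊗ₜ x + a ⊗ₜ d.2.1 i x := rfl

theorem bracket_apply [NeZero (2 : F)] (X Y : MagicAlg A A') : bracket A A' X Y =
    ((A.triLie X.1.1 Y.1.1 + ∑ i, thetaT A A' i (X.2 i) (Y.2 i),
      A'.triLie X.1.2 Y.1.2 + ∑ i, thetaT' A A' i (X.2 i) (Y.2 i)),
     fun k => triAct A A' k X.1 (Y.2 k) - triAct A A' k Y.1 (X.2 k)
      + tmulMul A A' (X.2 (k + 1)) (Y.2 (k + 2)) - tmulMul A A' (Y.2 (k + 1)) (X.2 (k + 2))) := rfl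

theorem iota_apply (i : Fin 3) (u : S ⊗[F] S') : iota A A' i u = (0, Pi.single i u) := rfl

theorem triIncl_apply (d : A.tri × A'.tri) : triIncl A A' d = (d, 0) := rfl

theorem bracket_tri_tri [NeZero (2 : F)] (d e : A.tri × A'.tri) :
    bracket A A' (triIncl A A' d) (triIncl A A' e) =
      triIncl A A' (A.triLie d.1 e.1, A'.triLie d.2 e.2) := by
  rw [bracket_apply]
  simp [triIncl_apply]
  rfl

theorem bracket_tri_iota [NeZero (2 : F)] (i : Fin 3) (d : A.tri × A'.tri) (v : S ⊗[F] S') :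
    bracket A A' (triIncl A A' d) (iota A A' i v) = iota A A' i (triAct A A' i d v) := by
  rw [bracket_apply]
  fin_cases i <;> refine Prod.ext ?_ (funext fun k => ?_)
  all_goals simp [iota_apply, triIncl_apply, Pi.single_apply]
  all_goals fin_cases k <;> simp

theorem bracket_iota_iota_succ [NeZero (2 : F)] (i : Fin 3) (u v : S ⊗[F] S') :
    bracket A A' (iota A A' i u) (iota A A' (i + 1) v) =
      iota A A' (i + 2) (tmulMul A A' u v) := by
  rw [bracket_apply]
  fin_cases i <;> refine Prod.ext ?_ (funext fun k => ?_)
  all_goals simp [iota_apply, Fin.sum_univ_three, Pi.single_apply]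
  all_goals fin_cases k <;> simp

theorem bracket_iota_iota_self [NeZero (2 : F)] (i : Fin 3) (u v : S ⊗[F] S') :
    bracket A A' (iota A A' i u) (iota A A' i v) =
      triIncl A A' (thetaT A A' i u v, thetaT' A A' i u v) := by
  rw [bracket_apply]
  fin_cases i <;> refine Prod.ext ?_ (funext fun k => ?_)
  all_goals simp [iota_apply, triIncl_apply, Fin.sum_univ_three, Pi.single_apply]
  all_goals fin_cases k <;> simp

end MagicAlg
end MagicSquareAlgebra

/-- A two-dimensional vector space `V` with a nonzero alternating bilinear form `⟨. | .⟩`. -/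
structure SymplecticPlane (F V : Type*) [Field F] [AddCommGroup V] [Module F V] where
  /-- the form `⟨. | .⟩` -/
  form : LinearMap.BilinForm F V
  finrank_eq_two : Module.finrank F V = 2
  alt : form.IsAlt
  ne_zero : form ≠ 0

namespace SymplecticPlane

variable {F V : Type*} [Field F] [AddCommGroup V] [Module F V] (P : SymplecticPlane F V)

theorem form_swap (a b : V) : P.form a b = -P.form b a := by
  rw [LinearMap.BilinForm.IsAlt.neg_eq P.alt]

theorem cyclic (a b c : V) :
    P.form a b • c + P.form b c • a + P.form c a • b = 0 := by
  have : Module.Finite F V := Module.finite_of_finrank_eq_succ P.finrank_eq_two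
  let e := Module.finBasisOfFinrankEq F V P.finrank_eq_two
  have h (x : V) : x = e.repr x 0 • e 0 + e.repr x 1 • e 1 := by
    conv_lhs => rw [← e.sum_repr x]
    rw [Fin.sum_univ_two]
  have h0 := P.alt (e 0)
  have h1 := P.alt (e 1)
  have h2 := P.form_swap (e 1) (e 0)
  rw [h a, h b, h c]
  simp only [map_add, map_smul, LinearMap.add_apply, LinearMap.smul_apply, h0, h1, h2, smul_eq_mul]
  module

theorem exists_form_ne_zero : ∃ a b : V, P.form a b ≠ 0 := by
  by_contra! h
  exact P.ne_zero (LinearMap.ext₂ h)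

/-- The symplectic Lie algebra `sp(V)`. -/
def sp : Submodule F (Module.End F V) where
  carrier := {s | ∀ x y, P.form (s x) y + P.form x (s y) = 0}
  zero_mem' := by simp
  add_mem' := by
    intro s t hs ht x y
    simp only [LinearMap.add_apply, map_add]
    linear_combination hs x y + ht x y
  smul_mem' := by
    intro c s hs x y
    simp only [LinearMap.smul_apply, map_smul, smul_eq_mul]
    linear_combination c * hs x y

theorem lie_mem_sp {s t : Module.End F V} (hs : s ∈ P.sp) (ht : t ∈ P.sp) :
    s * t - t * s ∈ P.sp := by
  intro x y
  simp only [LinearMap.sub_apply, Module.End.mul_apply, map_sub]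
  linear_combination hs (t x) y - ht x (s y) - ht (s x) y + hs x (t y)

/-- The Lie bracket of `sp(V)`, the commutator. -/
def spLie : P.sp →ₗ[F] P.sp →ₗ[F] P.sp :=
  LinearMap.mk₂ F (fun s t => ⟨s.1 * t.1 - t.1 * s.1, P.lie_mem_sp s.2 t.2⟩)
    (fun s s' t => Subtype.ext (by simp only [Submodule.coe_add]; noncomm_ring))
    (fun c s t => Subtype.ext (by
      simp only [Submodule.coe_smul, smul_mul_assoc, mul_smul_comm, smul_sub]))
    (fun s t t' => Subtype.ext (by simp only [Submodule.coe_add]; noncomm_ring))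
    (fun c s t => Subtype.ext (by
      simp only [Submodule.coe_smul, smul_mul_assoc, mul_smul_comm, smul_sub]))

/-- `γ_{a,b} = ⟨a | .⟩ b + ⟨b | .⟩ a` as an endomorphism of `V`. -/
noncomputable def gammaEnd (a b : V) : Module.End F V :=
  (P.form a).smulRight b + (P.form b).smulRight a

theorem gammaEnd_apply (a b z : V) : P.gammaEnd a b z = P.form a z • b + P.form b z • a := rfl

theorem gammaEnd_mem (a b : V) : P.gammaEnd a b ∈ P.sp := by
  intro x y
  simp only [gammaEnd_apply, map_add, map_smul, LinearMap.add_apply, LinearMap.smul_apply,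
    smul_eq_mul]
  rw [P.form_swap x a, P.form_swap x b]
  ring

/-- The bilinear map `(a, b) ↦ γ_{a,b} ∈ sp(V)`. -/
noncomputable def gamma : V →ₗ[F] V →ₗ[F] P.sp :=
  LinearMap.mk₂ F (fun a b => ⟨P.gammaEnd a b, P.gammaEnd_mem a b⟩)
    (fun a a' b => Subtype.ext (LinearMap.ext fun z => by
      simp only [Submodule.coe_add, LinearMap.add_apply, gammaEnd_apply, map_add]; module))
    (fun c a b => Subtype.ext (LinearMap.ext fun z => by
      simp only [Submodule.coe_smul, LinearMap.smul_apply, gammaEnd_apply, map_smul, smul_eq_mul]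
      module))
    (fun a b b' => Subtype.ext (LinearMap.ext fun z => by
      simp only [Submodule.coe_add, LinearMap.add_apply, gammaEnd_apply, map_add]; module))
    (fun c a b => Subtype.ext (LinearMap.ext fun z => by
      simp only [Submodule.coe_smul, LinearMap.smul_apply, gammaEnd_apply, map_smul, smul_eq_mul]
      module))

/-- `sp(V)` is the span of the `γ_{a,b}`. -/
theorem sp_eq_span [NeZero (2 : F)] :
    P.sp = Submodule.span F {s | ∃ a b, s = P.gammaEnd a b} := by
  refine le_antisymm (fun s hs => ?_) (Submodule.span_le.2 ?_)
  · obtain ⟨a, b, hab⟩ := P.exists_form_ne_zero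
    have h2 := NeZero.ne (2 : F)
    have key : s = (2 * P.form a b)⁻¹ • (P.gammaEnd a (s b) - P.gammaEnd b (s a)) := by
      rw [eq_inv_smul_iff₀ (mul_ne_zero h2 hab)]
      refine LinearMap.ext fun z => ?_
      have c1 := congrArg s (P.cyclic a b z)
      have c2 := P.cyclic a b (s z)
      have e1 : P.form (s b) z = -P.form b (s z) := eq_neg_of_add_eq_zero_left (hs b z)
      have e2 : P.form (s a) z = -P.form a (s z) := eq_neg_of_add_eq_zero_left (hs a z)
      simp only [map_add, map_smul, map_zero] at c1
      simp only [LinearMap.smul_apply, LinearMap.sub_apply, gammaEnd_apply, e1, e2]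
      rw [P.form_swap z a] at c1
      rw [P.form_swap (s z) a] at c2
      linear_combination (norm := module) (1 : F) • c1 + (1 : F) • c2
    rw [key]
    exact Submodule.smul_mem _ _ (Submodule.sub_mem _ (Submodule.subset_span ⟨_, _, rfl⟩)
      (Submodule.subset_span ⟨_, _, rfl⟩))
  · rintro _ ⟨a, b, rfl⟩
    exact P.gammaEnd_mem a b

/-- The polar form of the norm of `V ⊗ V`:
`q(a ⊗ b, c ⊗ d) = ⟨a | c⟩⟨b | d⟩`. -/
noncomputable def tform : LinearMap.BilinForm F (V ⊗[F] V) :=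
  LinearMap.BilinForm.tmul P.form P.form

@[simp] theorem tform_tmul (a b c d : V) :
    P.tform (a ⊗ₜ b) (c ⊗ₜ d) = P.form a c * P.form b d := by
  simp [tform, mul_comm]

theorem tform_comm (x y : V ⊗[F] V) : P.tform x y = P.tform y x := by
  have : P.tform = P.tform.flip := by
    ext a b c d
    simp only [TensorProduct.AlgebraTensorModule.curry_apply, TensorProduct.curry_apply,
      LinearMap.coe_restrictScalars, tform_tmul, P.form_swap a c, P.form_swap b d]
    simp
  exact LinearMap.congr_fun₂ this x y

theorem tform_sep {x : V ⊗[F] V} (h : ∀ y, P.tform x y = 0) : x = 0 := by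
  obtain ⟨a, b, hab⟩ := P.exists_form_ne_zero
  -- a nonzero multiple of `x` is recovered from the values `q(x, y)`
  have hv (v : V) : v = (P.form a b)⁻¹ • (P.form v b • a - P.form v a • b) := by
    rw [eq_inv_smul_iff₀ hab]
    have := P.cyclic a b v
    rw [P.form_swap b v] at this
    linear_combination (norm := module) (1 : F) • this
  have key : ∀ x : V ⊗[F] V, x = ((P.form a b)⁻¹ * (P.form a b)⁻¹) •
      (P.tform x (b ⊗ₜ b) • a ⊗ₜ[F] a - P.tform x (b ⊗ₜ a) • a ⊗ₜ[F] b
        - P.tform x (a ⊗ₜ b) • b ⊗ₜ[F] a + P.tform x (a ⊗ₜ a) • b ⊗ₜ[F] b) := by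
    intro x
    induction x using TensorProduct.induction_on with
    | zero => simp
    | tmul v w =>
      conv_lhs => rw [hv v, hv w]
      simp only [tform_tmul, TensorProduct.tmul_smul, TensorProduct.sub_tmul,
        TensorProduct.tmul_sub, ← TensorProduct.smul_tmul']
      module
    | add x y hx hy =>
      conv_lhs => rw [hx, hy]
      simp only [map_add, LinearMap.add_apply]
      module
  rw [key x]
  simp [h]

/-- The product `(a ⊗ b) • (c ⊗ d) = ⟨b | c⟩ d ⊗ a` of the split para-quaternions. -/
noncomputable def mul4 : V ⊗[F] V →ₗ[F] V ⊗[F] V →ₗ[F] V ⊗[F] V :=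
  TensorProduct.lift (LinearMap.mk₂ F
    (fun a b => (TensorProduct.mk F V V).flip a ∘ₗ
      (TensorProduct.lid F V).toLinearMap ∘ₗ (LinearMap.rTensor V (P.form b)))
    (fun a a' b => by ext c d; simp)
    (fun r a b => by ext c d; simp)
    (fun a b b' => by ext c d; simp)
    (fun r a b => by ext c d; simp [smul_smul, TensorProduct.smul_tmul']))

@[simp] theorem mul4_tmul (a b c d : V) :
    P.mul4 (a ⊗ₜ b) (c ⊗ₜ d) = P.form b c • d ⊗ₜ a := by
  simp [mul4, TensorProduct.smul_tmul']

/-- The flip `a ⊗ b ↦ b ⊗ a`. -/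
noncomputable abbrev flip : V ⊗[F] V →ₗ[F] V ⊗[F] V := (TensorProduct.comm F V V).toLinearMap


/-- The product of the split para-octonions `S₈ = (V ⊗ V) ⊕ (V ⊗ V)`. -/
noncomputable def mul8 : ((V ⊗[F] V) × (V ⊗[F] V)) →ₗ[F] ((V ⊗[F] V) × (V ⊗[F] V)) →ₗ[F]
    ((V ⊗[F] V) × (V ⊗[F] V)) :=
  LinearMap.mk₂ F (fun x y =>
    (P.mul4 x.1 y.1 - flip (P.mul4 x.2 (flip y.2)),
      -flip (P.mul4 (flip x.1) y.2) - P.mul4 (flip x.2) (flip y.1)))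
    (fun x x' y => by
      ext1 <;> simp only [Prod.fst_add, Prod.snd_add, map_add, LinearMap.add_apply] <;> abel)
    (fun c x y => by
      ext1 <;> simp only [Prod.smul_fst, Prod.smul_snd, map_smul, LinearMap.smul_apply] <;> module)
    (fun x y y' => by
      ext1 <;> simp only [Prod.fst_add, Prod.snd_add, map_add, LinearMap.add_apply] <;> abel)
    (fun c x y => by
      ext1 <;> simp only [Prod.smul_fst, Prod.smul_snd, map_smul, LinearMap.smul_apply] <;> module)

theorem mul8_tmul (a b c d a' b' c' d' : V) :
    P.mul8 (a ⊗ₜ b, c ⊗ₜ d) (a' ⊗ₜ b', c' ⊗ₜ d') =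
      (P.form b a' • b' ⊗ₜ a - P.form d d' • c ⊗ₜ c',
        -(P.form a c' • b ⊗ₜ d') - P.form c b' • a' ⊗ₜ d) := by
  simp [mul8, flip]

/-- The norm of `S₄`, `q(x) = ½ q(x, x)`. -/
noncomputable def norm4 : QuadraticForm F (V ⊗[F] V) :=
  (2⁻¹ : F) • P.tform.toQuadraticMap

theorem norm4_apply (x : V ⊗[F] V) : P.norm4 x = 2⁻¹ * P.tform x x := by
  simp [norm4]

theorem polar_norm4 [NeZero (2 : F)] (x y : V ⊗[F] V) :
    P.norm4.polarBilin x y = P.tform x y := by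
  have h2 := NeZero.ne (2 : F)
  simp only [QuadraticMap.polarBilin_apply_apply, QuadraticMap.polar, norm4_apply, map_add,
    LinearMap.add_apply]
  rw [P.tform_comm y x]
  field_simp
  ring

theorem mul4_assoc (x y z : V ⊗[F] V) :
    P.tform (P.mul4 x y) z = P.tform x (P.mul4 y z) := by
  induction x using TensorProduct.induction_on with
  | zero => simp
  | add x x' hx hx' => simp only [map_add, LinearMap.add_apply, hx, hx']
  | tmul a b =>
  induction y using TensorProduct.induction_on with
  | zero => simp
  | add y y' hy hy' => simp only [map_add, LinearMap.add_apply, hy, hy']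
  | tmul c d =>
  induction z using TensorProduct.induction_on with
  | zero => simp
  | add z z' hz hz' => simp only [map_add, hz, hz']
  | tmul e f =>
    simp only [mul4_tmul, map_smul, LinearMap.smul_apply, tform_tmul, smul_eq_mul]
    ring

theorem tform_flip_left (x y : V ⊗[F] V) : P.tform (flip x) y = P.tform x (flip y) := by
  induction x using TensorProduct.induction_on with
  | zero => simp
  | add x x' hx hx' => simp only [map_add, LinearMap.add_apply, hx, hx']
  | tmul a b =>
  induction y using TensorProduct.induction_on with
  | zero => simp
  | add y y' hy hy' => simp only [map_add, hy, hy']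
  | tmul c d => simp [mul_comm]

theorem flip_flip (x : V ⊗[F] V) : flip (flip x) = x := by
  simp [flip]

theorem flip_mul4 (x y : V ⊗[F] V) : flip (P.mul4 x y) = -P.mul4 (flip y) (flip x) := by
  induction x using TensorProduct.induction_on with
  | zero => simp
  | add x x' hx hx' => simp only [map_add, LinearMap.add_apply, hx, hx']; abel
  | tmul a b =>
  induction y using TensorProduct.induction_on with
  | zero => simp
  | add y y' hy hy' => simp only [map_add, LinearMap.add_apply, hy, hy']; abel
  | tmul c d => simp [P.form_swap c b]

theorem mul4_lin_left (x y z : V ⊗[F] V) :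
    P.mul4 (P.mul4 x y) z + P.mul4 (P.mul4 z y) x = P.tform x z • y := by
  induction x using TensorProduct.induction_on with
  | zero => simp
  | add x x' hx hx' =>
    simp only [map_add, LinearMap.add_apply, add_smul, ← hx, ← hx']
    abel
  | tmul a b =>
  induction y using TensorProduct.induction_on with
  | zero => simp
  | add y y' hy hy' =>
    simp only [map_add, LinearMap.add_apply, smul_add, ← hy, ← hy']
    abel
  | tmul c d =>
  induction z using TensorProduct.induction_on with
  | zero => simp
  | add z z' hz hz' =>
    simp only [map_add, LinearMap.add_apply, add_smul, ← hz, ← hz']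
    abel
  | tmul e f =>
    have h : P.form b f • c = P.form b c • f - P.form f c • b := by
      have := P.cyclic b c f
      rw [P.form_swap c f, P.form_swap f b] at this
      linear_combination (norm := module) (-1 : F) • this
    simp only [mul4_tmul, map_smul, LinearMap.smul_apply, tform_tmul]
    have h' := congrArg (fun u => u ⊗ₜ[F] d) h
    simp only [TensorProduct.sub_tmul, ← TensorProduct.smul_tmul'] at h' ⊢
    rw [mul_smul, h', P.form_swap e a]
    module

theorem mul4_mul_self [NeZero (2 : F)] (x y : V ⊗[F] V) :
    P.mul4 (P.mul4 x y) x = (2⁻¹ * P.tform x x) • y := by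
  have h2 := NeZero.ne (2 : F)
  have h := P.mul4_lin_left x y x
  rw [mul_smul, ← h, ← two_smul F, smul_smul, inv_mul_cancel₀ h2, one_smul]

theorem mul4_self_mul [NeZero (2 : F)] (x y : V ⊗[F] V) :
    P.mul4 x (P.mul4 y x) = (2⁻¹ * P.tform x x) • y := by
  rw [← flip_flip (P.mul4 x (P.mul4 y x)), flip_mul4, flip_mul4, map_neg, map_neg,
    LinearMap.neg_apply, map_neg, neg_neg, mul4_mul_self, tform_flip_left, flip_flip, map_smul,
    flip_flip]

theorem mul4_cross (x y z : V ⊗[F] V) :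
    P.mul4 (P.mul4 y (flip x)) z = P.mul4 x (P.mul4 (flip z) y) := by
  induction x using TensorProduct.induction_on with
  | zero => simp
  | add x x' hx hx' => simp only [map_add, LinearMap.add_apply, hx, hx']
  | tmul c d =>
  induction y using TensorProduct.induction_on with
  | zero => simp
  | add y y' hy hy' => simp only [map_add, LinearMap.add_apply, hy, hy']
  | tmul a b =>
  induction z using TensorProduct.induction_on with
  | zero => simp
  | add z z' hz hz' => simp only [map_add, LinearMap.add_apply, hz, hz']
  | tmul e f =>
    simp [P.form_swap e a, P.form_swap d b, smul_smul, mul_comm]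

/-- The split para-quaternion algebra `S₄ = V ⊗ V`. -/
noncomputable def S4 [NeZero (2 : F)] : SymmetricComposition F (V ⊗[F] V) where
  mul := P.mul4
  q := P.norm4
  regular := by
    refine ⟨fun x hx => P.tform_sep fun y => ?_, fun y hy => P.tform_sep fun x => ?_⟩
    · rw [← P.polar_norm4, hx]
    · rw [P.tform_comm, ← P.polar_norm4, hy]
  comp x y := by
    simp only [norm4_apply]
    rw [← P.mul4_assoc, P.mul4_mul_self, map_smul, LinearMap.smul_apply, smul_eq_mul]
    ring
  assoc x y z := by
    rw [polar_norm4, polar_norm4, mul4_assoc]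

theorem norm8_apply (x : (V ⊗[F] V) × (V ⊗[F] V)) :
    P.norm4.prod P.norm4 x = 2⁻¹ * (P.tform x.1 x.1 + P.tform x.2 x.2) := by
  rw [QuadraticMap.prod_apply, norm4_apply, norm4_apply]
  ring

theorem polar_norm8 [NeZero (2 : F)] (x y : (V ⊗[F] V) × (V ⊗[F] V)) :
    (P.norm4.prod P.norm4).polarBilin x y = P.tform x.1 y.1 + P.tform x.2 y.2 := by
  rw [← polar_norm4, ← polar_norm4]
  simp

theorem mul8_assoc (x y z : (V ⊗[F] V) × (V ⊗[F] V)) :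
    P.tform (P.mul8 x y).1 z.1 + P.tform (P.mul8 x y).2 z.2 =
      P.tform x.1 (P.mul8 y z).1 + P.tform x.2 (P.mul8 y z).2 := by
  simp only [mul8, LinearMap.mk₂_apply, map_sub, map_neg, LinearMap.sub_apply,
    LinearMap.neg_apply, tform_flip_left, mul4_assoc]
  simp only [← tform_flip_left, mul4_assoc]
  ring

theorem mul8_mul_self [NeZero (2 : F)] (x y : (V ⊗[F] V) × (V ⊗[F] V)) :
    P.mul8 (P.mul8 x y) x = (2⁻¹ * (P.tform x.1 x.1 + P.tform x.2 x.2)) • y := by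
  obtain ⟨x1, x2⟩ := x
  obtain ⟨y1, y2⟩ := y
  have c1 := P.mul4_cross x2 y2 x1
  have c2 := P.mul4_cross (flip x2) y1 (flip x1)
  have e1 := P.mul4_mul_self x1 y1
  have e2 := P.mul4_self_mul x2 y1
  have e3 := P.mul4_self_mul (flip x2) y2
  have e4 := P.mul4_mul_self (flip x1) y2
  rw [tform_flip_left, flip_flip] at e3 e4
  rw [flip_flip, flip_flip] at c2
  ext1
  · simp only [mul8, LinearMap.mk₂_apply, map_sub, map_neg, LinearMap.sub_apply,
      LinearMap.neg_apply, flip_mul4, flip_flip, Prod.smul_fst]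
    simp only [mul_add, add_smul, ← e1, ← e2, c1]
    abel
  · simp only [mul8, LinearMap.mk₂_apply, map_sub, map_neg, LinearMap.sub_apply,
      LinearMap.neg_apply, flip_mul4, flip_flip, Prod.smul_snd]
    simp only [mul_add, add_smul, ← e3, ← e4, c2]
    abel

/-- The split para-octonion algebra `S₈ = (V ⊗ V) ⊕ (V ⊗ V)`. -/
noncomputable def S8 [NeZero (2 : F)] :
    SymmetricComposition F ((V ⊗[F] V) × (V ⊗[F] V)) where
  mul := P.mul8
  q := P.norm4.prod P.norm4
  regular := by
    have h (x : (V ⊗[F] V) × (V ⊗[F] V))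
        (hx : ∀ y, (P.norm4.prod P.norm4).polarBilin x y = 0) : x = 0 := by
      refine Prod.ext (P.tform_sep fun y => ?_) (P.tform_sep fun y => ?_)
      · have := hx (y, 0)
        rw [polar_norm8] at this
        simpa using this
      · have := hx (0, y)
        rw [polar_norm8] at this
        simpa using this
    refine ⟨h, fun y hy => h y fun x => ?_⟩
    rw [polar_norm8, P.tform_comm, P.tform_comm y.2, ← polar_norm8, hy]
  comp x y := by
    simp only [norm8_apply]
    rw [← P.mul8_assoc, P.mul8_mul_self]
    simp only [Prod.smul_fst, Prod.smul_snd, map_smul, LinearMap.smul_apply, smul_eq_mul]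
    ring
  assoc x y z := by
    rw [polar_norm8, polar_norm8, mul8_assoc]

end SymplecticPlane

namespace SymplecticPlane

variable {F V : Type*} [Field F] [AddCommGroup V] [Module F V]

section Pairing

variable {X : Type*} [AddCommGroup X] [Module F X]

/-- Extension by zero of a family indexed by a finite set of indices. -/
def extend {σ : Finset ℕ} (v : σ → V) : ℕ → V := fun i => if h : i ∈ σ then v ⟨i, h⟩ else 0

theorem extend_update {σ : Finset ℕ} [DecidableEq σ] (v : σ → V) (i : σ) (x : V) :
    extend (Function.update v i x) = Function.update (extend v) i x := by
  funext j
  by_cases hj : j = i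
  · subst hj
    simp [extend]
  · have : ∀ h : j ∈ σ, (⟨j, h⟩ : σ) ≠ i := fun h h' => hj (congrArg Subtype.val h')
    simp [extend, hj, Function.update_of_ne, this]

variable (F) in
/-- `f` is linear in each of the variables indexed by `σ`. -/
def IsLinearOn (σ : Finset ℕ) (f : (ℕ → V) → X) : Prop :=
  ∀ v, ∀ i ∈ σ, ∃ L : V →ₗ[F] X, ∀ x, f (Function.update v i x) = L x

/-- The bilinear map `⨂_σ V × ⨂_τ V → X` induced by a function `f (v, w)` that is linear in each
`v_i`, `i ∈ σ`, and each `w_j`, `j ∈ τ`. -/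
noncomputable def lift₂ (σ τ : Finset ℕ) (f : (ℕ → V) → (ℕ → V) → X)
    (h₁ : ∀ w, IsLinearOn F σ fun v => f v w) (h₂ : ∀ v, IsLinearOn F τ (f v)) :
    (⨂[F] _ : σ, V) →ₗ[F] (⨂[F] _ : τ, V) →ₗ[F] X :=
  PiTensorProduct.lift
    { toFun := fun v => PiTensorProduct.lift
        { toFun := fun w => f (extend v) (extend w)
          map_update_add' := by
            intro _ w i x y
            obtain ⟨L, hL⟩ := h₂ (extend v) (extend w) i i.2
            simp only [extend_update, hL, map_add]
          map_update_smul' := by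
            intro _ w i c x
            obtain ⟨L, hL⟩ := h₂ (extend v) (extend w) i i.2
            simp only [extend_update, hL, map_smul] }
      map_update_add' := by
        intro _ v i x y
        refine PiTensorProduct.ext (MultilinearMap.ext fun w => ?_)
        obtain ⟨L, hL⟩ := h₁ (extend w) (extend v) i i.2
        simp [extend_update, hL]
      map_update_smul' := by
        intro _ v i c x
        refine PiTensorProduct.ext (MultilinearMap.ext fun w => ?_)
        obtain ⟨L, hL⟩ := h₁ (extend w) (extend v) i i.2
        simp [extend_update, hL] }

theorem lift₂_tprod (σ τ : Finset ℕ) (f : (ℕ → V) → (ℕ → V) → X)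
    (h₁ : ∀ w, IsLinearOn F σ fun v => f v w) (h₂ : ∀ v, IsLinearOn F τ (f v))
    (v : σ → V) (w : τ → V) :
    lift₂ σ τ f h₁ h₂ (PiTensorProduct.tprod F v) (PiTensorProduct.tprod F w) =
      f (extend v) (extend w) := by
  simp [lift₂]

end Pairing

variable (P : SymplecticPlane F V)

theorem prod_update_left (s : Finset ℕ) (v w : ℕ → V) {i : ℕ} (hi : i ∈ s) (x : V) :
    ∏ k ∈ s, P.form (Function.update v i x k) (w k) =
      P.form x (w i) * ∏ k ∈ s.erase i, P.form (v k) (w k) := by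
  rw [← Finset.mul_prod_erase s _ hi, Function.update_self]
  congr 1
  refine Finset.prod_congr rfl fun k hk => ?_
  rw [Function.update_of_ne (Finset.ne_of_mem_erase hk)]

theorem prod_update_right (s : Finset ℕ) (v w : ℕ → V) {i : ℕ} (hi : i ∈ s) (x : V) :
    ∏ k ∈ s, P.form (v k) (Function.update w i x k) =
      P.form (v i) x * ∏ k ∈ s.erase i, P.form (v k) (w k) := by
  rw [← Finset.mul_prod_erase s _ hi, Function.update_self]
  congr 1
  refine Finset.prod_congr rfl fun k hk => ?_
  rw [Function.update_of_ne (Finset.ne_of_mem_erase hk)]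

theorem prod_update_of_notMem (s : Finset ℕ) (v w : ℕ → V) {i : ℕ} (hi : i ∉ s) (x : V) :
    ∏ k ∈ s, P.form (Function.update v i x k) (w k) = ∏ k ∈ s, P.form (v k) (w k) ∧
    ∏ k ∈ s, P.form (w k) (Function.update v i x k) = ∏ k ∈ s, P.form (w k) (v k) := by
  constructor <;> refine Finset.prod_congr rfl fun k hk => ?_ <;>
    rw [Function.update_of_ne (ne_of_mem_of_not_mem hk hi)]

/-- The contraction of `⊗_{i ∈ σ} v_i` and `⊗_{i ∈ τ} w_i` in the indices `i ∈ σ ∩ τ`. -/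
noncomputable def contrFun (σ τ : Finset ℕ) (v w : ℕ → V) : ⨂[F] _ : ↥(symmDiff σ τ), V :=
  (∏ i ∈ σ ∩ τ, P.form (v i) (w i)) •
    PiTensorProduct.tprod F fun j : ↥(symmDiff σ τ) => if (j : ℕ) ∈ σ then v j else w j

/-- The bilinear contraction map on tensors, for `σ ≠ τ` both nonempty. -/
noncomputable def contr (σ τ : Finset ℕ) :
    (⨂[F] _ : σ, V) →ₗ[F] (⨂[F] _ : τ, V) →ₗ[F] ⨂[F] _ : ↥(symmDiff σ τ), V :=
  lift₂ σ τ (P.contrFun σ τ)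
    (fun w v i hi => by
      by_cases hτ : i ∈ τ
      · have hm : i ∈ σ ∩ τ := Finset.mem_inter.2 ⟨hi, hτ⟩
        refine ⟨((∏ k ∈ (σ ∩ τ).erase i, P.form (v k) (w k)) • P.form.flip (w i)).smulRight
          (PiTensorProduct.tprod F fun j : ↥(symmDiff σ τ) => if (j : ℕ) ∈ σ then v j else w j),
          fun x => ?_⟩
        have e : (fun j : ↥(symmDiff σ τ) => if (j : ℕ) ∈ σ then Function.update v i x j else w j)
            = fun j : ↥(symmDiff σ τ) => if (j : ℕ) ∈ σ then v j else w j := by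
          funext j
          have hj : (j : ℕ) ≠ i := by
            intro h
            have := Finset.mem_symmDiff.1 j.2
            rw [h] at this
            tauto
          rw [Function.update_of_ne hj]
        simp only [contrFun]
        rw [e, P.prod_update_left _ _ _ hm]
        simp [mul_comm]
      · have hm : i ∉ σ ∩ τ := fun h => hτ (Finset.mem_inter.1 h).2
        have hs : i ∈ symmDiff σ τ := Finset.mem_symmDiff.2 (Or.inl ⟨hi, hτ⟩)
        refine ⟨(∏ k ∈ σ ∩ τ, P.form (v k) (w k)) • (PiTensorProduct.tprod F).toLinearMap
          (fun j : ↥(symmDiff σ τ) => if (j : ℕ) ∈ σ then v j else w j) ⟨i, hs⟩, fun x => ?_⟩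
        simp only [contrFun]
        rw [(P.prod_update_of_notMem _ _ _ hm x).1]
        rw [LinearMap.smul_apply, MultilinearMap.toLinearMap_apply]
        congr 2
        funext j
        by_cases hj : j = ⟨i, hs⟩
        · subst hj
          simp [hi]
        · have hj' : (j : ℕ) ≠ i := fun h => hj (Subtype.ext h)
          rw [Function.update_of_ne hj, Function.update_of_ne hj'])
    (fun v w i hi => by
      by_cases hσ : i ∈ σ
      · have hm : i ∈ σ ∩ τ := Finset.mem_inter.2 ⟨hσ, hi⟩
        refine ⟨((∏ k ∈ (σ ∩ τ).erase i, P.form (v k) (w k)) • P.form (v i)).smulRight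
          (PiTensorProduct.tprod F fun j : ↥(symmDiff σ τ) => if (j : ℕ) ∈ σ then v j else w j),
          fun x => ?_⟩
        have e : (fun j : ↥(symmDiff σ τ) => if (j : ℕ) ∈ σ then v j else Function.update w i x j)
            = fun j : ↥(symmDiff σ τ) => if (j : ℕ) ∈ σ then v j else w j := by
          funext j
          have hj : (j : ℕ) ≠ i := by
            intro h
            have := Finset.mem_symmDiff.1 j.2
            rw [h] at this
            tauto
          rw [Function.update_of_ne hj]
        simp only [contrFun]
        rw [e, P.prod_update_right _ _ _ hm]
        simp [mul_comm]
      · have hm : i ∉ σ ∩ τ := fun h => hσ (Finset.mem_inter.1 h).1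
        have hs : i ∈ symmDiff σ τ := Finset.mem_symmDiff.2 (Or.inr ⟨hi, hσ⟩)
        refine ⟨(∏ k ∈ σ ∩ τ, P.form (v k) (w k)) • (PiTensorProduct.tprod F).toLinearMap
          (fun j : ↥(symmDiff σ τ) => if (j : ℕ) ∈ σ then v j else w j) ⟨i, hs⟩, fun x => ?_⟩
        simp only [contrFun]
        rw [(P.prod_update_of_notMem _ _ _ hm x).2]
        rw [LinearMap.smul_apply, MultilinearMap.toLinearMap_apply]
        congr 2
        funext j
        by_cases hj : j = ⟨i, hs⟩
        · subst hj
          simp [hσ]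
        · have hj' : (j : ℕ) ≠ i := fun h => hj (Subtype.ext h)
          rw [Function.update_of_ne hj, Function.update_of_ne hj'])

/-- The inclusion `ν_i` of `sp(V)` as the `i`-th component of `sp(V)^N`, for a finite set `N` of
indices. -/
def nu (N : Finset ℕ) (i : ℕ) : P.sp →ₗ[F] (N → P.sp) :=
  LinearMap.pi fun j => if (j : ℕ) = i then LinearMap.id else 0

/-- `-½ ∑_{i ∈ σ} (∏_{k ∈ σ, k ≠ i} ⟨v_k | w_k⟩) ν_i(γ_{v_i, w_i})`. -/
noncomputable def selfFun (N σ : Finset ℕ) (v w : ℕ → V) : N → P.sp :=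
  -((2⁻¹ : F) • ∑ i ∈ σ, (∏ k ∈ σ.erase i, P.form (v k) (w k)) • P.nu N i (P.gamma (v i) (w i)))

/-- The bilinear map `φ_{σ,σ}` on tensors, `σ ≠ ∅`. -/
noncomputable def selfContr (N σ : Finset ℕ) :
    (⨂[F] _ : σ, V) →ₗ[F] (⨂[F] _ : σ, V) →ₗ[F] (N → P.sp) :=
  lift₂ σ σ (P.selfFun N σ)
    (fun w v i hi => by
      refine ⟨-((2⁻¹ : F) • ∑ j ∈ σ, if j = i then
        (∏ k ∈ σ.erase j, P.form (v k) (w k)) • P.nu N j ∘ₗ P.gamma.flip (w j)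
        else ((∏ k ∈ (σ.erase j).erase i, P.form (v k) (w k)) • P.form.flip (w i)).smulRight
          (P.nu N j (P.gamma (v j) (w j)))), fun _ => ?_⟩
      simp only [selfFun, LinearMap.neg_apply, LinearMap.smul_apply, LinearMap.sum_apply]
      congr 2
      refine Finset.sum_congr rfl fun j hj => ?_
      by_cases hji : j = i
      · subst hji
        rw [(P.prod_update_of_notMem _ _ _ (Finset.notMem_erase j σ) _).1]
        simp
      · rw [P.prod_update_left _ _ _ (Finset.mem_erase.2 ⟨Ne.symm hji, hi⟩),
          Function.update_of_ne hji]
        simp [hji, mul_comm])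
    (fun v w i hi => by
      refine ⟨-((2⁻¹ : F) • ∑ j ∈ σ, if j = i then
        (∏ k ∈ σ.erase j, P.form (v k) (w k)) • P.nu N j ∘ₗ P.gamma (v j)
        else ((∏ k ∈ (σ.erase j).erase i, P.form (v k) (w k)) • P.form (v i)).smulRight
          (P.nu N j (P.gamma (v j) (w j)))), fun _ => ?_⟩
      simp only [selfFun, LinearMap.neg_apply, LinearMap.smul_apply, LinearMap.sum_apply]
      congr 2
      refine Finset.sum_congr rfl fun j hj => ?_
      by_cases hji : j = i
      · subst hji
        rw [(P.prod_update_of_notMem _ _ _ (Finset.notMem_erase j σ) _).2]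
        simp
      · rw [P.prod_update_right _ _ _ (Finset.mem_erase.2 ⟨Ne.symm hji, hi⟩),
          Function.update_of_ne hji]
        simp [hji, mul_comm])

/-- The `i`-th component `s_i` of `s ∈ sp(V)^N` (zero if `i ∉ N`). -/
def spAt (N : Finset ℕ) (i : ℕ) : (N → P.sp) →ₗ[F] P.sp :=
  if h : i ∈ N then LinearMap.proj ⟨i, h⟩ else 0

/-- The action of `sp(V)^N` on `⨂_{i ∈ σ} V_i`:
`s . (⊗ v_i) = ∑_{i ∈ σ} v_{i_1} ⊗ ⋯ ⊗ s_i(v_i) ⊗ ⋯ ⊗ v_{i_r}`. -/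
noncomputable def act (N σ : Finset ℕ) : (N → P.sp) →ₗ[F] Module.End F (⨂[F] _ : σ, V) :=
  ∑ i : σ, (PiTensorProduct.mapMultilinear F (fun _ : σ => V) (fun _ => V)).toLinearMap
    (fun _ => LinearMap.id) i ∘ₗ P.sp.subtype ∘ₗ P.spAt N i

theorem act_tprod (N σ : Finset ℕ) (s : N → P.sp) (v : σ → V) :
    P.act N σ s (PiTensorProduct.tprod F v) =
      ∑ i : σ, PiTensorProduct.tprod F (Function.update v i ((P.spAt N i s).1 (v i))) := by
  simp only [act, LinearMap.sum_apply, LinearMap.comp_apply, MultilinearMap.toLinearMap_apply,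
    PiTensorProduct.mapMultilinear_apply, PiTensorProduct.map_tprod]
  refine Finset.sum_congr rfl fun i _ => ?_
  congr 1
  funext j
  by_cases hj : j = i
  · subst hj
    simp
  · simp [hj]

/-- The Lie bracket of `sp(V)^N`. -/
def spLiePi (N : Finset ℕ) : (N → P.sp) →ₗ[F] (N → P.sp) →ₗ[F] (N → P.sp) :=
  LinearMap.mk₂ F (fun s t i => P.spLie (s i) (t i))
    (fun s s' t => by ext1 i; simp) (fun c s t => by ext1 i; simp)
    (fun s t t' => by ext1 i; simp) (fun c s t => by ext1 i; simp)

/-- The `sp(V)^N`-module `V(σ)`: it is `sp(V)^N` if `σ = ∅` and `⨂_{i ∈ σ} V_i` otherwise. (Of the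
two factors, the functions on a proof of `σ = ∅` and those on a proof of `σ ≠ ∅`, exactly one is
nontrivial.) -/
def VMod (N σ : Finset ℕ) : Type _ :=
  (PLift (σ = ∅) → (N → P.sp)) × (PLift (σ ≠ ∅) → ⨂[F] _ : σ, V)

noncomputable instance (N σ : Finset ℕ) : AddCommGroup (P.VMod N σ) :=
  inferInstanceAs (AddCommGroup ((PLift (σ = ∅) → (N → P.sp)) × (PLift (σ ≠ ∅) → ⨂[F] _ : σ, V)))

noncomputable instance (N σ : Finset ℕ) : Module F (P.VMod N σ) :=
  inferInstanceAs (Module F ((PLift (σ = ∅) → (N → P.sp)) × (PLift (σ ≠ ∅) → ⨂[F] _ : σ, V)))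

/-- `V(∅) = sp(V)^N`. -/
noncomputable def spEquiv (N : Finset ℕ) {σ : Finset ℕ} (h : σ = ∅) : P.VMod N σ ≃ₗ[F] (N → P.sp) where
  toFun x := x.1 ⟨h⟩
  invFun s := (fun _ => s, fun h' => absurd h h'.down)
  map_add' _ _ := rfl
  map_smul' _ _ := rfl
  left_inv x := Prod.ext rfl (funext fun h' => absurd h h'.down)
  right_inv _ := rfl

/-- `V(σ) = ⨂_{i ∈ σ} V_i` if `σ ≠ ∅`. -/
noncomputable def tensorEquiv (N : Finset ℕ) {σ : Finset ℕ} (h : σ ≠ ∅) :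
    P.VMod N σ ≃ₗ[F] ⨂[F] _ : σ, V where
  toFun x := x.2 ⟨h⟩
  invFun u := (fun h' => absurd h'.down h, fun _ => u)
  map_add' _ _ := rfl
  map_smul' _ _ := rfl
  left_inv x := Prod.ext (funext fun h' => absurd h'.down h) rfl
  right_inv _ := rfl

/-- The identity map between `V(σ)` and `V(τ)` for `σ = τ`. -/
noncomputable def castV (N : Finset ℕ) {σ τ : Finset ℕ} (h : σ = τ) : P.VMod N σ ≃ₗ[F] P.VMod N τ := by
  subst h
  exact LinearEquiv.refl F _

/-- The maps `φ_{σ,τ} : V(σ) × V(τ) → V(σ + τ)`, where `σ + τ` is the symmetric difference. -/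
noncomputable def phi (N σ τ : Finset ℕ) :
    P.VMod N σ →ₗ[F] P.VMod N τ →ₗ[F] P.VMod N (symmDiff σ τ) :=
  if hσ : σ = ∅ then
    if hτ : τ = ∅ then
      ((P.spLiePi N).compl₁₂ (P.spEquiv N hσ).toLinearMap (P.spEquiv N hτ).toLinearMap).compr₂
        (P.spEquiv N (by subst hσ hτ; exact symmDiff_self _)).symm.toLinearMap
    else
      ((P.act N τ).compl₁₂ (P.spEquiv N hσ).toLinearMap (P.tensorEquiv N hτ).toLinearMap).compr₂
        ((P.tensorEquiv N hτ).symm.trans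
          (P.castV N (by subst hσ; exact (bot_symmDiff τ).symm))).toLinearMap
  else
    if hτ : τ = ∅ then
      (((-P.act N σ).compl₁₂ (P.spEquiv N hτ).toLinearMap (P.tensorEquiv N hσ).toLinearMap).compr₂
        ((P.tensorEquiv N hσ).symm.trans
          (P.castV N (by subst hτ; exact (symmDiff_bot σ).symm))).toLinearMap).flip
    else if h : σ = τ then
      ((P.selfContr N σ).compl₁₂ (P.tensorEquiv N hσ).toLinearMap
        ((P.castV N h.symm).trans (P.tensorEquiv N hσ)).toLinearMap).compr₂
          (P.spEquiv N (by subst h; exact symmDiff_self _)).symm.toLinearMap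
    else
      ((P.contr σ τ).compl₁₂ (P.tensorEquiv N hσ).toLinearMap
        (P.tensorEquiv N hτ).toLinearMap).compr₂
          (P.tensorEquiv N (fun h' => h (symmDiff_eq_bot.1 h'))).symm.toLinearMap

/-- The element `⊗_{i ∈ σ} v_i` of `V(σ)`, for nonempty `σ`. -/
noncomputable def pureTensor (N σ : Finset ℕ) (v : ℕ → V) : P.VMod N σ :=
  (0, fun _ => PiTensorProduct.tprod F fun i : σ => v i)

/-- The element `s` of `V(∅) = sp(V)^N`. -/
noncomputable def ofSp (N : Finset ℕ) (s : N → P.sp) : P.VMod N ∅ := (P.spEquiv N rfl).symm s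

theorem phi_sp_sp (N : Finset ℕ) (s t : N → P.sp) :
    P.phi N ∅ ∅ (P.ofSp N s) (P.ofSp N t) =
      P.castV N (symmDiff_self _).symm (P.ofSp N (P.spLiePi N s t)) := by
  have e : ∀ {σ : Finset ℕ} (h : σ = ∅) (u : N → P.sp), (P.spEquiv N h).symm u =
      P.castV N h.symm (P.ofSp N u) := by
    intro σ h u
    subst h
    rfl
  rw [phi, dif_pos rfl, dif_pos rfl]
  exact e (symmDiff_self _) _

theorem phi_sp_tensor (N : Finset ℕ) {τ : Finset ℕ} (hτ : τ ≠ ∅) (s : N → P.sp)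
    (u : ⨂[F] _ : τ, V) :
    P.phi N ∅ τ (P.ofSp N s) ((P.tensorEquiv N hτ).symm u) =
      P.castV N (bot_symmDiff τ).symm ((P.tensorEquiv N hτ).symm (P.act N τ s u)) := by
  rw [phi, dif_pos rfl, dif_neg hτ]
  rfl

theorem phi_tensor_sp (N : Finset ℕ) {σ : Finset ℕ} (hσ : σ ≠ ∅) (s : N → P.sp)
    (u : ⨂[F] _ : σ, V) :
    P.phi N σ ∅ ((P.tensorEquiv N hσ).symm u) (P.ofSp N s) =
      -P.castV N (symmDiff_bot σ).symm ((P.tensorEquiv N hσ).symm (P.act N σ s u)) := by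
  rw [phi, dif_neg hσ, dif_pos rfl, ← map_neg, ← map_neg]
  rfl

theorem tensorEquiv_symm_tprod (N : Finset ℕ) {σ : Finset ℕ} (hσ : σ ≠ ∅) (v : ℕ → V) :
    (P.tensorEquiv N hσ).symm (PiTensorProduct.tprod F fun i : σ => v i) = P.pureTensor N σ v :=
  Prod.ext (funext fun h => absurd h.down hσ) rfl

theorem phi_pure_self (N : Finset ℕ) {σ : Finset ℕ} (hσ : σ ≠ ∅) (v w : ℕ → V) :
    P.phi N σ σ (P.pureTensor N σ v) (P.pureTensor N σ w) =
      P.castV N (symmDiff_self _).symm (P.ofSp N (P.selfFun N σ v w)) := by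
  have e : ∀ {σ : Finset ℕ} (h : σ = ∅) (u : N → P.sp), (P.spEquiv N h).symm u =
      P.castV N h.symm (P.ofSp N u) := by
    intro σ h u
    subst h
    rfl
  rw [phi, dif_neg hσ, dif_neg hσ, dif_pos rfl, ← P.tensorEquiv_symm_tprod N hσ v,
    ← P.tensorEquiv_symm_tprod N hσ w]
  refine (e (symmDiff_self _) _).trans ?_
  congr 2
  have h0 : P.selfContr N σ (PiTensorProduct.tprod F fun i : σ => v i)
      (PiTensorProduct.tprod F fun i : σ => w i) = _ := lift₂_tprod σ σ (P.selfFun N σ) _ _ _ _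
  refine h0.trans ?_
  have h1 : ∀ (v : ℕ → V), ∀ i ∈ σ, extend (fun i : σ => v i) i = v i := by
    intro v i hi
    simp [extend, hi]
  simp only [selfFun]
  congr 2
  refine Finset.sum_congr rfl fun i hi => ?_
  rw [h1 v i hi, h1 w i hi]
  congr 1
  refine Finset.prod_congr rfl fun k hk => ?_
  rw [h1 v k (Finset.mem_of_mem_erase hk), h1 w k (Finset.mem_of_mem_erase hk)]

theorem phi_pure_pure (N : Finset ℕ) {σ τ : Finset ℕ} (hσ : σ ≠ ∅) (hτ : τ ≠ ∅) (h : σ ≠ τ)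
    (v w : ℕ → V) :
    P.phi N σ τ (P.pureTensor N σ v) (P.pureTensor N τ w) =
      (∏ i ∈ σ ∩ τ, P.form (v i) (w i)) •
        P.pureTensor N (symmDiff σ τ) (fun j => if j ∈ σ then v j else w j) := by
  have hs : symmDiff σ τ ≠ ∅ := fun h' => h (symmDiff_eq_bot.1 h')
  rw [phi, dif_neg hσ, dif_neg hτ, dif_neg h, ← P.tensorEquiv_symm_tprod N hσ v,
    ← P.tensorEquiv_symm_tprod N hτ w, ← P.tensorEquiv_symm_tprod N hs, ← map_smul]
  have h0 : P.contr σ τ (PiTensorProduct.tprod F fun i : σ => v i)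
      (PiTensorProduct.tprod F fun i : τ => w i) = _ := lift₂_tprod σ τ (P.contrFun σ τ) _ _ _ _
  refine congrArg (P.tensorEquiv N hs).symm (h0.trans ?_)
  have h1 : ∀ (ρ : Finset ℕ) (v : ℕ → V), ∀ i ∈ ρ, extend (fun i : ρ => v i) i = v i := by
    intro ρ v i hi
    simp [extend, hi]
  simp only [contrFun]
  congr 1
  · refine Finset.prod_congr rfl fun k hk => ?_
    rw [h1 σ v k (Finset.mem_inter.1 hk).1, h1 τ w k (Finset.mem_inter.1 hk).2]
  · congr 1
    funext j
    by_cases hj : (j : ℕ) ∈ σ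
    · simp [hj, extend]
    · have : (j : ℕ) ∈ τ := by
        have := Finset.mem_symmDiff.1 j.2
        tauto
      simp [hj, this, extend]

end SymplecticPlane

namespace MagicModels

/-- The indices `1, …, 7` of the copies of `V` used for `𝔢₇`. -/
def N7 : Finset ℕ := {1, 2, 3, 4, 5, 6, 7}

/-- The indices `1, 2, 3, 5, 6, 7` of the copies of `V` used for `𝔡₆`. -/
def N6 : Finset ℕ := {1, 2, 3, 5, 6, 7}

/-- The set `𝒮` of subsets of `{1, …, 7}` for `𝔢₇`. -/
def SE7 : Finset (Finset ℕ) :=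
  {∅, {1, 2, 5, 6}, {2, 3, 6, 7}, {1, 3, 5, 7}, {1, 2, 3, 4}, {3, 4, 5, 6}, {1, 4, 6, 7},
    {2, 4, 5, 7}}

/-- The set `𝒮` of subsets of `{1, 2, 3, 5, 6, 7}` for `𝔡₆`. -/
def SD6 : Finset (Finset ℕ) := {∅, {1, 2, 5, 6}, {2, 3, 6, 7}, {1, 3, 5, 7}}

/-- The position of `σ` in the row of headings of the table of signs. -/
def tableIndex (σ : Finset ℕ) : Fin 8 :=
  if σ = {1, 2, 5, 6} then 1
  else if σ = {2, 3, 6, 7} then 2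
  else if σ = {1, 3, 5, 7} then 3
  else if σ = {1, 2, 3, 4} then 4
  else if σ = {3, 4, 5, 6} then 5
  else if σ = {1, 4, 6, 7} then 6
  else if σ = {2, 4, 5, 7} then 7
  else 0

/-- The table of signs for `𝔢₇`; rows and columns are headed
`∅, {1,2,5,6}, {2,3,6,7}, {1,3,5,7}, {1,2,3,4}, {3,4,5,6}, {1,4,6,7}, {2,4,5,7}`. -/
def tableE7 : Matrix (Fin 8) (Fin 8) ℤ :=
  !![1,  1,  1,  1,  1,  1,  1,  1;
     1, -1,  1, -1,  1, -1, -1,  1;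
     1, -1, -1,  1,  1,  1, -1, -1;
     1,  1, -1, -1,  1, -1,  1, -1;
     1, -1, -1, -1, -1,  1,  1,  1;
     1,  1, -1,  1, -1, -1, -1,  1;
     1,  1,  1, -1, -1,  1, -1, -1;
     1, -1,  1,  1, -1, -1,  1, -1]

/-- The signs `ε(σ, τ)` for `𝔢₇`. -/
def epsE7 (σ τ : Finset ℕ) : ℤ := tableE7 (tableIndex σ) (tableIndex τ)

/-- The signs `ε(σ, τ)` for `𝔡₆`: the left top corner of the table for `𝔢₇`. -/
def epsD6 (σ τ : Finset ℕ) : ℤ := epsE7 σ τ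

/-- The subset of `{lab 0, …, lab (n - 1)}` identified with a vector in `ℤ₂ⁿ`. -/
def toSubset {n : ℕ} (lab : Fin n → ℕ) (y : Fin n → ZMod 2) : Finset ℕ :=
  (Finset.univ.filter fun i => y i = 1).image lab

/-- The labels `1, …, 7` of the coordinates of `ℤ₂⁷`. -/
def lab7 : Fin 7 → ℕ := ![1, 2, 3, 4, 5, 6, 7]

/-- The labels `1, 2, 3, 5, 6, 7` of the coordinates of `ℤ₂⁶`. -/
def lab6 : Fin 6 → ℕ := ![1, 2, 3, 5, 6, 7]

/-- The linear map `χ₃ : ℤ₂³ → ℤ₂⁷`. -/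
def chi3 : (Fin 3 → ZMod 2) →ₗ[ZMod 2] (Fin 7 → ZMod 2) where
  toFun x := ![x 0 + x 2, x 0 + x 1 + x 2, x 1 + x 2, x 2, x 0, x 0 + x 1, x 1]
  map_add' := by decide
  map_smul' := by decide

/-- The linear map `χ₂ : ℤ₂² → ℤ₂⁶`. -/
def chi2 : (Fin 2 → ZMod 2) →ₗ[ZMod 2] (Fin 6 → ZMod 2) where
  toFun x := ![x 0, x 0 + x 1, x 1, x 0, x 0 + x 1, x 1]
  map_add' := by decide
  map_smul' := by decide

/-- `f(x, y) = (∑_{i ≥ j} x_i y_j) + x₁y₂y₃ + x₂y₁y₃ + x₃y₁y₂`. -/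
def f (x y : Fin 3 → ZMod 2) : ZMod 2 :=
  (∑ i, ∑ j, if j ≤ i then x i * y j else 0)
    + x 0 * y 1 * y 2 + x 1 * y 0 * y 2 + x 2 * y 0 * y 1

/-- `f'((x₁, x₂), (y₁, y₂)) = x₁y₁ + x₂(y₁ + y₂)`. -/
def f' (x y : Fin 2 → ZMod 2) : ZMod 2 := x 0 * y 0 + x 1 * (y 0 + y 1)

/-- The sign `(-1)^c` for `c ∈ ℤ₂`. -/
def sgn (c : ZMod 2) : ℤ := (-1) ^ c.val

/-- The points of the Fano plane are the nonzero vectors of `ℤ₂³`; the point numbered `lab7 i`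
is `fanoPoint i`. -/
def fanoPoint : Fin 7 → (Fin 3 → ZMod 2) :=
  ![![1, 0, 1], ![1, 1, 1], ![0, 1, 1], ![0, 0, 1], ![1, 0, 0], ![1, 1, 0], ![0, 1, 0]]

/-- `σ` is the set of numbers of the points in the complement of a line of the Fano plane; the
lines are the sets of nonzero vectors of the two-dimensional subspaces of `ℤ₂³`. -/
def IsFanoQuadrilateral (σ : Finset ℕ) : Prop :=
  ∃ W : Submodule (ZMod 2) (Fin 3 → ZMod 2), Module.finrank (ZMod 2) W = 2 ∧
    (σ : Set ℕ) = lab7 '' {i | fanoPoint i ∉ W}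

open scoped Quaternion in
/-- The real algebra `𝕆` of octonions, the Cayley-Dickson double of the quaternions. -/
def Octonion : Type := ℍ[ℝ] × ℍ[ℝ]

namespace Octonion

open scoped Quaternion

noncomputable instance : AddCommGroup Octonion := inferInstanceAs (AddCommGroup (ℍ[ℝ] × ℍ[ℝ]))

noncomputable instance : Module ℝ Octonion := inferInstanceAs (Module ℝ (ℍ[ℝ] × ℍ[ℝ]))

/-- `(x, y)(x', y') = (x x' - ȳ' y, y' x + y x̄')`. -/
noncomputable instance : Mul Octonion :=
  ⟨fun a b => (a.1 * b.1 - star b.2 * a.2, b.2 * a.1 + a.2 * star b.1)⟩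

noncomputable instance : One Octonion := ⟨((1 : ℍ[ℝ]), (0 : ℍ[ℝ]))⟩

/-- The octonion unit `i`. -/
noncomputable def i : Octonion := ((⟨0, 1, 0, 0⟩ : ℍ[ℝ]), (0 : ℍ[ℝ]))

/-- The octonion unit `j`. -/
noncomputable def j : Octonion := ((⟨0, 0, 1, 0⟩ : ℍ[ℝ]), (0 : ℍ[ℝ]))

/-- The octonion unit `l`. -/
noncomputable def l : Octonion := ((0 : ℍ[ℝ]), (1 : ℍ[ℝ]))

/-- The usual basis `1, i, j, k = ij, l, il, jl, kl` of `𝕆`, indexed by `ℤ₂³`, with `i`, `j`, `l`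
at `(1,0,0)`, `(0,1,0)`, `(0,0,1)`. -/
noncomputable def unit (x : Fin 3 → ZMod 2) : Octonion :=
  (if x 0 = 1 then i else 1) * (if x 1 = 1 then j else 1) * (if x 2 = 1 then l else 1)

end Octonion

end MagicModels

namespace SymplecticPlane

open MagicModels

variable {F V : Type*} [Field F] [AddCommGroup V] [Module F V] (P : SymplecticPlane F V)

/-- The direct sum `⨁_{σ ∈ 𝒮} V(σ)`. -/
abbrev Model (N : Finset ℕ) (𝒮 : Finset (Finset ℕ)) : Type _ := ⨁ σ : 𝒮, P.VMod N σ

/-- The inclusion of `V(σ)` in `⨁_{σ ∈ 𝒮} V(σ)`, for `σ ∈ 𝒮`. -/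
noncomputable def inc (N : Finset ℕ) (𝒮 : Finset (Finset ℕ)) (σ : Finset ℕ) :
    P.VMod N σ →ₗ[F] P.Model N 𝒮 :=
  if h : σ ∈ 𝒮 then DirectSum.lof F 𝒮 (fun σ : 𝒮 => P.VMod N σ) ⟨σ, h⟩ else 0

/-- The natural map `V(σ) → V(σ)` from the module for `sp(V)^N` to the one for `sp(V)^M`, `N ⊆ M`:
extension by zero `sp(V)^N → sp(V)^M` for `σ = ∅`, and the identity of `⨂_{i ∈ σ} V_i` for
`σ ≠ ∅`. -/
noncomputable def extV (N M σ : Finset ℕ) : P.VMod N σ →ₗ[F] P.VMod M σ :=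
  if h : σ = ∅ then
    (P.spEquiv M h).symm.toLinearMap ∘ₗ LinearMap.pi (fun i : M => P.spAt N i) ∘ₗ
      (P.spEquiv N h).toLinearMap
  else (P.tensorEquiv M h).symm.toLinearMap ∘ₗ (P.tensorEquiv N h).toLinearMap

/-- The action of `sp(V)²` on `V ⊗ V`. -/
noncomputable def act2 (s t : P.sp) : Module.End F (V ⊗[F] V) :=
  LinearMap.rTensor V s.1 + LinearMap.lTensor V t.1

/-- `ρ(s₁, s₂, s₃, s₄)`: the action of `sp(V)⁴` on `S₈ = (V ⊗ V) ⊕ (V ⊗ V)`. -/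
noncomputable def rhoSp (s₁ s₂ s₃ s₄ : P.sp) : Module.End F ((V ⊗[F] V) × (V ⊗[F] V)) :=
  LinearMap.prodMap (P.act2 s₁ s₂) (P.act2 s₃ s₄)

/-- `ρ(v₁ ⊗ v₂ ⊗ v₃ ⊗ v₄)`: it sends `(w₁ ⊗ w₂, w₃ ⊗ w₄)` to
`(⟨v₃ | w₃⟩⟨v₄ | w₄⟩ v₁ ⊗ v₂, -⟨v₁ | w₁⟩⟨v₂ | w₂⟩ v₃ ⊗ v₄)`. -/
noncomputable def rhoTensor (v₁ v₂ v₃ v₄ : V) : Module.End F ((V ⊗[F] V) × (V ⊗[F] V)) :=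
  LinearMap.prod
    ((P.tform (v₃ ⊗ₜ v₄) ∘ₗ LinearMap.snd F _ _).smulRight (v₁ ⊗ₜ v₂))
    (-(P.tform (v₁ ⊗ₜ v₂) ∘ₗ LinearMap.fst F _ _).smulRight (v₃ ⊗ₜ v₄))

/-- `𝔢₇ = 𝔤(S₈, S₄)`. -/
abbrev E7 [NeZero (2 : F)] : Type _ := MagicAlg P.S8 P.S4

/-- `𝔡₆ = 𝔤(S₄, S₄)`. -/
abbrev D6 [NeZero (2 : F)] : Type _ := MagicAlg P.S4 P.S4

/-- `Φ : ⨁_{σ ∈ 𝒮} V(σ) → 𝔤(S₈, S₄)` is the natural identification: the indices `1, 2, 3, 4` are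
used for `S₈` and `5, 6, 7` for `S₄`, `sp(V)⁷ ⊕ V({1,2,3,4})` is identified with
`tri(S₈) ⊕ tri(S₄)` by means of the representations `ρ_i` of `𝔡₄ = sp(V)⁴ ⊕ V^{⊗4}` on `S₈` and
`ρ̃_i` of `sp(V)³` on `S₄`, and `ι_0(S₈ ⊗ S₄) = (V₁ ⊗ V₂ ⊕ V₃ ⊗ V₄) ⊗ (V₅ ⊗ V₆)`,
`ι_1(S₈ ⊗ S₄) = (V₂ ⊗ V₃ ⊕ V₁ ⊗ V₄) ⊗ (V₆ ⊗ V₇)`,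
`ι_2(S₈ ⊗ S₄) = (V₃ ⊗ V₁ ⊕ V₂ ⊗ V₄) ⊗ (V₇ ⊗ V₅)`. -/
structure IsE7Identification [NeZero (2 : F)] (Φ : P.Model N7 SE7 →ₗ[F] P.E7) : Prop where
  sp : ∀ s : N7 → P.sp, ∃ d : P.S8.tri × P.S4.tri,
    Φ (P.inc N7 SE7 ∅ (P.ofSp N7 s)) = MagicAlg.triIncl P.S8 P.S4 d ∧
    d.1.1 = ![P.rhoSp (P.spAt N7 1 s) (P.spAt N7 2 s) (P.spAt N7 3 s) (P.spAt N7 4 s),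
      P.rhoSp (P.spAt N7 2 s) (P.spAt N7 3 s) (P.spAt N7 1 s) (P.spAt N7 4 s),
      P.rhoSp (P.spAt N7 3 s) (P.spAt N7 1 s) (P.spAt N7 2 s) (P.spAt N7 4 s)] ∧
    d.2.1 = ![P.act2 (P.spAt N7 5 s) (P.spAt N7 6 s), P.act2 (P.spAt N7 6 s) (P.spAt N7 7 s),
      P.act2 (P.spAt N7 7 s) (P.spAt N7 5 s)]
  v1234 : ∀ v : ℕ → V, ∃ d : P.S8.tri,
    Φ (P.inc N7 SE7 {1, 2, 3, 4} (P.pureTensor N7 {1, 2, 3, 4} v)) =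
      MagicAlg.triIncl P.S8 P.S4 (d, 0) ∧
    d.1 = ![P.rhoTensor (v 1) (v 2) (v 3) (v 4), P.rhoTensor (v 2) (v 3) (v 1) (v 4),
      P.rhoTensor (v 3) (v 1) (v 2) (v 4)]
  v1256 : ∀ v : ℕ → V, Φ (P.inc N7 SE7 {1, 2, 5, 6} (P.pureTensor N7 {1, 2, 5, 6} v)) =
    MagicAlg.iota P.S8 P.S4 0 ((v 1 ⊗ₜ v 2, 0) ⊗ₜ (v 5 ⊗ₜ v 6))
  v3456 : ∀ v : ℕ → V, Φ (P.inc N7 SE7 {3, 4, 5, 6} (P.pureTensor N7 {3, 4, 5, 6} v)) =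
    MagicAlg.iota P.S8 P.S4 0 ((0, v 3 ⊗ₜ v 4) ⊗ₜ (v 5 ⊗ₜ v 6))
  v2367 : ∀ v : ℕ → V, Φ (P.inc N7 SE7 {2, 3, 6, 7} (P.pureTensor N7 {2, 3, 6, 7} v)) =
    MagicAlg.iota P.S8 P.S4 1 ((v 2 ⊗ₜ v 3, 0) ⊗ₜ (v 6 ⊗ₜ v 7))
  v1467 : ∀ v : ℕ → V, Φ (P.inc N7 SE7 {1, 4, 6, 7} (P.pureTensor N7 {1, 4, 6, 7} v)) =
    MagicAlg.iota P.S8 P.S4 1 ((0, v 1 ⊗ₜ v 4) ⊗ₜ (v 6 ⊗ₜ v 7))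
  v1357 : ∀ v : ℕ → V, Φ (P.inc N7 SE7 {1, 3, 5, 7} (P.pureTensor N7 {1, 3, 5, 7} v)) =
    MagicAlg.iota P.S8 P.S4 2 ((v 3 ⊗ₜ v 1, 0) ⊗ₜ (v 7 ⊗ₜ v 5))
  v2457 : ∀ v : ℕ → V, Φ (P.inc N7 SE7 {2, 4, 5, 7} (P.pureTensor N7 {2, 4, 5, 7} v)) =
    MagicAlg.iota P.S8 P.S4 2 ((0, v 2 ⊗ₜ v 4) ⊗ₜ (v 7 ⊗ₜ v 5))

/-- `Φ : ⨁_{σ ∈ 𝒮} V(σ) → 𝔤(S₄, S₄)` is the natural identification: the indices `1, 2, 3` are used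
for the first `S₄` and `5, 6, 7` for the second one, `sp(V)⁶` is identified with
`tri(S₄) ⊕ tri(S₄)` by means of `ρ̃_i`, and `ι_0(S₄ ⊗ S₄) = (V₁ ⊗ V₂) ⊗ (V₅ ⊗ V₆)`,
`ι_1(S₄ ⊗ S₄) = (V₂ ⊗ V₃) ⊗ (V₆ ⊗ V₇)`, `ι_2(S₄ ⊗ S₄) = (V₃ ⊗ V₁) ⊗ (V₇ ⊗ V₅)`. -/
structure IsD6Identification [NeZero (2 : F)] (Φ : P.Model N6 SD6 →ₗ[F] P.D6) : Prop where
  sp : ∀ s : N6 → P.sp, ∃ d : P.S4.tri × P.S4.tri,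
    Φ (P.inc N6 SD6 ∅ (P.ofSp N6 s)) = MagicAlg.triIncl P.S4 P.S4 d ∧
    d.1.1 = ![P.act2 (P.spAt N6 1 s) (P.spAt N6 2 s), P.act2 (P.spAt N6 2 s) (P.spAt N6 3 s),
      P.act2 (P.spAt N6 3 s) (P.spAt N6 1 s)] ∧
    d.2.1 = ![P.act2 (P.spAt N6 5 s) (P.spAt N6 6 s), P.act2 (P.spAt N6 6 s) (P.spAt N6 7 s),
      P.act2 (P.spAt N6 7 s) (P.spAt N6 5 s)]
  v1256 : ∀ v : ℕ → V, Φ (P.inc N6 SD6 {1, 2, 5, 6} (P.pureTensor N6 {1, 2, 5, 6} v)) =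
    MagicAlg.iota P.S4 P.S4 0 ((v 1 ⊗ₜ v 2) ⊗ₜ (v 5 ⊗ₜ v 6))
  v2367 : ∀ v : ℕ → V, Φ (P.inc N6 SD6 {2, 3, 6, 7} (P.pureTensor N6 {2, 3, 6, 7} v)) =
    MagicAlg.iota P.S4 P.S4 1 ((v 2 ⊗ₜ v 3) ⊗ₜ (v 6 ⊗ₜ v 7))
  v1357 : ∀ v : ℕ → V, Φ (P.inc N6 SD6 {1, 3, 5, 7} (P.pureTensor N6 {1, 3, 5, 7} v)) =
    MagicAlg.iota P.S4 P.S4 2 ((v 3 ⊗ₜ v 1) ⊗ₜ (v 7 ⊗ₜ v 5))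

end SymplecticPlane

/-- The multiplication of `𝔤(S, S')` makes it a Lie algebra. -/
def MagicAlg.IsLieAlgebra {F S S' : Type*} [Field F] [NeZero (2 : F)] [AddCommGroup S] [Module F S]
    [AddCommGroup S'] [Module F S'] (A : SymmetricComposition F S)
    (A' : SymmetricComposition F S') : Prop :=
  (∀ X, bracket A A' X X = 0) ∧
  ∀ X Y Z, bracket A A' X (bracket A A' Y Z) + bracket A A' Y (bracket A A' Z X) +
    bracket A A' Z (bracket A A' X Y) = 0

/-!
The combinatorial statements are finite verifications, except for the octonions: their basis
`e^x` consists of doubled quaternion units, whose products are read off from the doubling formula.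

`𝔤(S, S')` is a Lie algebra for every pair of symmetric composition algebras
(`MagicAlg.isLieAlgebra`). The Jacobian is alternating and trilinear, so that it has to vanish only on
elements of `tri(S) ⊕ tri(S')` and of the three copies of `S ⊗ S'`; its cyclic symmetry leaves a few
types of triples. An entry in `tri` acts by derivations because `[d, t_{x,y}] = t_{d₀x,y} + t_{x,d₀y}`
(`SymmetricComposition.triLie_theta_t`); the entries from three different copies are settled by
`t_{x*y,z} + θ(…) + θ²(…) = 0` (`SymmetricComposition.t_cyclic`), and those with a repeated copy by
the linearizations of `(x * y) * x = q(x) y = x * (y * x)`.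

The identification `Φ` rests on the triality algebras of `S₄` and `S₈`. An element of `o(V ⊗ V)` is
the action of a unique pair `(s, t) ∈ sp(V)²` (`SymplecticPlane.exists_act2_eq`), so a triple in
`tri(S₄)` amounts to six elements of `sp(V)`, and the triality relation forces them to be equal in
pairs: `tri(S₄) = sp(V)³` (`spTri4_bijective`). In `S₈ = S₄ ⊕ S₄` the off-diagonal part of
an orthogonal map is realized by the elements `t_{(0,r),(p,0)}`, and a triple in `tri(S₈)` is
determined by its first component (`tri8_ext`); hence `tri(S₈) = sp(V)⁴ ⊕ V^{⊗4}`
(`tri8_bijective`). Since the copies of `S₈ ⊗ S₄` are sums of two spaces `V(σ)`, the coordinates of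
an element of the model combine to an isomorphism (`equivE7`, `equivD6`).

The formula for the bracket is bilinear, so it has to be verified for pure tensors and for elements
of `sp(V)^N` only (`bracket_eq_of_generators`). There it is a computation with the products in `S₈`
and `S₄` and with the explicit elements `t_{x,y}`, for each pair `σ, τ`. The embedding of `𝔡₆` is
transported from the inclusion of the models; it is a homomorphism because the maps `φ_{σ,τ}` do not
depend on the ambient set of indices (`extV_phi`) and both tables of signs agree.
-/

/-! ### The Lie algebras `𝔤(S, S')` -/

namespace SymmetricComposition

variable {F S : Type*} [Field F] [AddCommGroup S] [Module F S] (A : SymmetricComposition F S)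

theorem rotate_mem_tri {d : Fin 3 → Module.End F S} (hd : d ∈ A.tri) (i : Fin 3) :
    (fun k => d (k + i)) ∈ A.tri := by
  have h1 : (fun k : Fin 3 => d (k + 2)) ∈ A.tri := by
    convert A.rot_mem_tri hd using 1
    ext k; fin_cases k <;> rfl
  have h2 : (fun k : Fin 3 => d (k + 1)) ∈ A.tri := by
    convert A.rot_mem_tri h1 using 1
    ext k; fin_cases k <;> rfl
  fin_cases i
  · simpa using hd
  · exact h2
  · exact h1

/-- The local triality condition holds for every cyclic rotation of the triple. -/
theorem tri_mul {d : Fin 3 → Module.End F S} (hd : d ∈ A.tri) (i : Fin 3) (x y : S) :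
    d i (A.mul x y) = A.mul (d (i + 1) x) y + A.mul x (d (i + 2) y) := by
  have := (A.rotate_mem_tri hd i).2 x y
  simpa [add_comm] using this

theorem theta_pow_apply (d : A.tri) (i k : Fin 3) : ((A.theta ^ (i : ℕ)) d).1 k = d.1 (k - i) := by
  fin_cases i <;> fin_cases k <;> rfl

theorem triLie_val (d e : A.tri) : (A.triLie d e).1 = d.1 * e.1 - e.1 * d.1 := rfl

theorem t_val [NeZero (2 : F)] (a b : S) : (A.t a b).1 = A.tFun a b := rfl

theorem tFun_zero (a b c : S) : A.tFun a b 0 c = A.pol a c • b - A.pol b c • a := rfl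

theorem tFun_one (a b c : S) :
    A.tFun a b 1 c = (2⁻¹ * A.pol a b) • c - A.mul (A.mul b c) a := rfl

theorem tFun_two (a b c : S) :
    A.tFun a b 2 c = (2⁻¹ * A.pol a b) • c - A.mul a (A.mul c b) := rfl

theorem two_inv_add [NeZero (2 : F)] : (2 : F)⁻¹ + 2⁻¹ = 1 := by
  have := NeZero.ne (2 : F)
  field_simp
  norm_num

theorem t_swap [NeZero (2 : F)] (a b : S) : A.t a b = -A.t b a := by
  refine Subtype.ext (funext fun k => LinearMap.ext fun c => ?_)
  have h : A.pol a b • c = (2⁻¹ * A.pol a b) • c + (2⁻¹ * A.pol a b) • c := by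
    rw [← add_smul, ← add_mul, two_inv_add, one_mul]
  fin_cases k
  · change A.tFun a b 0 c = -A.tFun b a 0 c
    simp only [tFun_zero]
    abel
  · change A.tFun a b 1 c = -A.tFun b a 1 c
    simp only [tFun_one, A.pol_comm b a]
    have := A.lin_left b c a
    rw [A.pol_comm b a] at this
    linear_combination (norm := module) (-1 : F) • this - (1 : F) • h
  · change A.tFun a b 2 c = -A.tFun b a 2 c
    simp only [tFun_two, A.pol_comm b a]
    have := A.lin_right a c b
    linear_combination (norm := module) (-1 : F) • this - (1 : F) • h

theorem neg_smul_t [NeZero (2 : F)] (c : F) (a b : S) : -(c • A.t a b) = c • A.t b a := by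
  rw [A.t_swap a b, smul_neg, neg_neg]

theorem lie_tFun {d : Fin 3 → Module.End F S} (hd : d ∈ A.tri) (a b : S) (k : Fin 3) :
    d k * A.tFun a b k - A.tFun a b k * d k = A.tFun (d 0 a) b k + A.tFun a (d 0 b) k := by
  refine LinearMap.ext fun c => ?_
  have ho := hd.1
  have h := ho 0 a b
  fin_cases k
  · change d 0 (A.tFun a b 0 c) - A.tFun a b 0 (d 0 c) =
      A.tFun (d 0 a) b 0 c + A.tFun a (d 0 b) 0 c
    simp only [tFun_zero, map_sub, map_smul]
    rw [eq_neg_of_add_eq_zero_left (ho 0 a c), eq_neg_of_add_eq_zero_left (ho 0 b c)]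
    module
  · change d 1 (A.tFun a b 1 c) - A.tFun a b 1 (d 1 c) =
      A.tFun (d 0 a) b 1 c + A.tFun a (d 0 b) 1 c
    have e1 := A.tri_mul hd 1 (A.mul b c) a
    have e2 := A.tri_mul hd 2 b c
    simp only [Fin.isValue, Fin.reduceAdd] at e1 e2
    simp only [tFun_one, map_sub, map_smul, e1, e2, map_add, LinearMap.add_apply]
    rw [eq_neg_of_add_eq_zero_left h]
    module
  · change d 2 (A.tFun a b 2 c) - A.tFun a b 2 (d 2 c) =
      A.tFun (d 0 a) b 2 c + A.tFun a (d 0 b) 2 c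
    have e1 := A.tri_mul hd 2 a (A.mul c b)
    have e2 := A.tri_mul hd 1 c b
    simp only [Fin.isValue, Fin.reduceAdd] at e1 e2
    simp only [tFun_two, map_sub, map_smul, e1, e2, map_add]
    rw [eq_neg_of_add_eq_zero_left h]
    module

/-- `tri(S)` acts on the elements `θ^i(t_{a,b})` by derivations, through its `i`-th component. -/
theorem triLie_theta_t [NeZero (2 : F)] (d : A.tri) (i : Fin 3) (a b : S) :
    A.triLie d ((A.theta ^ (i : ℕ)) (A.t a b)) =
      (A.theta ^ (i : ℕ)) (A.t (d.1 i a) b) + (A.theta ^ (i : ℕ)) (A.t a (d.1 i b)) := by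
  refine Subtype.ext (funext fun k => ?_)
  have := A.lie_tFun (A.rotate_mem_tri d.2 i) a b (k - i)
  simp only [sub_add_cancel, zero_add] at this
  simp only [triLie_val, Submodule.coe_add, Pi.sub_apply, Pi.mul_apply, Pi.add_apply,
    theta_pow_apply, t_val]
  exact this

theorem triLie_t [NeZero (2 : F)] (d : A.tri) (a b : S) :
    A.triLie d (A.t a b) = A.t (d.1 0 a) b + A.t a (d.1 0 b) :=
  A.triLie_theta_t d 0 a b

theorem pol_mul_cyclic (a b c : S) : A.pol (A.mul b c) a = A.pol (A.mul a b) c := by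
  rw [A.pol_comm]
  exact (A.assoc a b c).symm

/-- The three terms are permuted by `θ`, so that only first components have to be compared; there
the identity follows from the linearizations of `x * (y * x) = q(x) y` and the associativity of
`q`. -/
theorem t_cyclic [NeZero (2 : F)] (a b c : S) :
    A.t (A.mul b c) a + A.theta (A.t (A.mul c a) b) + A.theta (A.theta (A.t (A.mul a b) c)) = 0 := by
  have key : ∀ a b c z : S, A.tFun (A.mul b c) a 0 z + A.tFun (A.mul c a) b 2 z +
      A.tFun (A.mul a b) c 1 z = 0 := by
    intro a b c z
    have e1 := A.lin_right (A.mul c a) z b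
    have e2 := congrArg (A.mul b) (A.lin_right z c a)
    have e4 := A.lin_right b a (A.mul c z)
    have e5 : A.pol b (A.mul c z) = A.pol (A.mul b c) z := (A.assoc _ _ _).symm
    have e6 : A.pol (A.mul c a) b = A.pol (A.mul a b) c := (A.pol_mul_cyclic c a b).symm
    have h : A.pol (A.mul a b) c • z = (2⁻¹ * A.pol (A.mul a b) c) • z +
        (2⁻¹ * A.pol (A.mul a b) c) • z := by
      rw [← add_smul, ← add_mul, two_inv_add, one_mul]
    simp only [tFun_zero, tFun_one, tFun_two, map_sub, map_smul] at e2 ⊢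
    rw [e6] at e1 ⊢
    rw [A.pol_comm z a] at e2
    rw [e5] at e4
    linear_combination (norm := module) (-1 : F) • e1 + (1 : F) • e2 - (1 : F) • e4 - (1 : F) • h
  refine Subtype.ext (funext fun k => LinearMap.ext fun z => ?_)
  fin_cases k
  · exact key a b c z
  · change A.tFun (A.mul b c) a 1 z + A.tFun (A.mul c a) b 0 z + A.tFun (A.mul a b) c 2 z = 0
    linear_combination (norm := module) (1 : F) • key b c a z
  · change A.tFun (A.mul b c) a 2 z + A.tFun (A.mul c a) b 1 z + A.tFun (A.mul a b) c 0 z = 0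
    linear_combination (norm := module) (1 : F) • key c a b z

/-- The identity behind the Jacobi identity for elements of the three different copies of
`S ⊗ S'`, in a form that is invariant under cyclic rotation of the copies. -/
theorem theta_t_cyclic [NeZero (2 : F)] (i : Fin 3) (a b c : S) :
    (A.theta ^ (i : ℕ)) (A.t (A.mul b c) a) +
      (A.theta ^ ((i + 1 : Fin 3) : ℕ)) (A.t (A.mul c a) b) +
      (A.theta ^ ((i + 2 : Fin 3) : ℕ)) (A.t (A.mul a b) c) = 0 := by
  have h0 := A.t_cyclic a b c
  have h1 := A.t_cyclic b c a
  have h2 := A.t_cyclic c a b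
  fin_cases i
  · exact h0
  · change A.theta _ + A.theta (A.theta _) + A.t _ _ = 0
    rw [← h2]; abel
  · change A.theta (A.theta _) + A.t _ _ + A.theta _ = 0
    rw [← h1]; abel

theorem triLie_swap (d e : A.tri) : A.triLie d e = -A.triLie e d :=
  Subtype.ext (by simp [triLie_val])

theorem triLie_jacobi (d e f : A.tri) : A.triLie d (A.triLie e f) + A.triLie e (A.triLie f d) +
      A.triLie f (A.triLie d e) = 0 := by
  refine Subtype.ext ?_
  simp only [Submodule.coe_add, triLie_val, Submodule.coe_zero]
  noncomm_ring

end SymmetricComposition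

namespace MagicAlg

variable {F S S' : Type*} [Field F] [AddCommGroup S] [Module F S] [AddCommGroup S'] [Module F S']
variable (A : SymmetricComposition F S) (A' : SymmetricComposition F S')

theorem triAct_lie (i : Fin 3) (d e : A.tri × A'.tri) (u : S ⊗[F] S') :
    triAct A A' i (A.triLie d.1 e.1, A'.triLie d.2 e.2) u =
      triAct A A' i d (triAct A A' i e u) - triAct A A' i e (triAct A A' i d u) := by
  induction u using TensorProduct.induction_on with
  | zero => simp
  | add u v hu hv => simp only [map_add, hu, hv]; abel
  | tmul a x =>
    simp only [triAct_tmul, map_add, SymmetricComposition.triLie_val, Pi.sub_apply, Pi.mul_apply,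
      LinearMap.sub_apply, Module.End.mul_apply, TensorProduct.sub_tmul, TensorProduct.tmul_sub]
    abel

/-- A property of the elements of `𝔤(S, S')` that is stable under addition may be checked on
`tri(S) ⊕ tri(S')` and on the elements `ι_i(a ⊗ x)`. -/
theorem induction_gen {p : MagicAlg A A' → Prop} (hadd : ∀ X Y, p X → p Y → p (X + Y))
    (htri : ∀ d, p (triIncl A A' d)) (hiota : ∀ i a x, p (iota A A' i (a ⊗ₜ x)))
    (X : MagicAlg A A') : p X := by
  have h0 : p 0 := by simpa using htri 0
  have hi : ∀ i u, p (iota A A' i u) := by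
    intro i u
    induction u using TensorProduct.induction_on with
    | zero => simpa using h0
    | tmul a x => exact hiota i a x
    | add u v hu hv => rw [map_add]; exact hadd _ _ hu hv
  have : X = triIncl A A' X.1 + (iota A A' 0 (X.2 0) + iota A A' 1 (X.2 1) + iota A A' 2 (X.2 2)) := by
    refine Prod.ext ?_ (funext fun k => ?_)
    · simp [triIncl_apply, iota_apply]
    · fin_cases k <;> simp [triIncl_apply, iota_apply]
  rw [this]
  exact hadd _ _ (htri _) (hadd _ _ (hadd _ _ (hi _ _) (hi _ _)) (hi _ _))

variable [NeZero (2 : F)]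

theorem thetaT_swap (i : Fin 3) (u v : S ⊗[F] S') : thetaT A A' i u v = -thetaT A A' i v u := by
  induction u using TensorProduct.induction_on with
  | zero => simp
  | add u u' hu hu' => simp only [map_add, LinearMap.add_apply, hu, hu']; abel
  | tmul a x =>
  induction v using TensorProduct.induction_on with
  | zero => simp
  | add u u' hu hu' => simp only [map_add, LinearMap.add_apply, hu, hu']; abel
  | tmul b y => rw [thetaT_tmul, thetaT_tmul, A.t_swap, A'.pol_comm, map_neg, smul_neg]

theorem thetaT'_swap (i : Fin 3) (u v : S ⊗[F] S') :
    thetaT' A A' i u v = -thetaT' A A' i v u := by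
  induction u using TensorProduct.induction_on with
  | zero => simp
  | add u u' hu hu' => simp only [map_add, LinearMap.add_apply, hu, hu']; abel
  | tmul a x =>
  induction v using TensorProduct.induction_on with
  | zero => simp
  | add u u' hu hu' => simp only [map_add, LinearMap.add_apply, hu, hu']; abel
  | tmul b y => rw [thetaT'_tmul, thetaT'_tmul, A'.t_swap, A.pol_comm, map_neg, smul_neg]

theorem bracket_swap (X Y : MagicAlg A A') : bracket A A' X Y = -bracket A A' Y X := by
  rw [bracket_apply, bracket_apply]
  refine Prod.ext (Prod.ext ?_ ?_) (funext fun k => ?_)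
  · change _ + _ = -(_ + _)
    rw [A.triLie_swap, Finset.sum_congr rfl fun i _ => thetaT_swap A A' i _ _,
      Finset.sum_neg_distrib, neg_add]
  · change _ + _ = -(_ + _)
    rw [A'.triLie_swap, Finset.sum_congr rfl fun i _ => thetaT'_swap A A' i _ _,
      Finset.sum_neg_distrib, neg_add]
  · change _ - _ + _ - _ = -(_ - _ + _ - _)
    abel

theorem bracket_iota_tri (i : Fin 3) (d : A.tri × A'.tri) (v : S ⊗[F] S') :
    bracket A A' (iota A A' i v) (triIncl A A' d) = -iota A A' i (triAct A A' i d v) := by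
  rw [bracket_swap, bracket_tri_iota]

theorem bracket_iota_succ_iota (i : Fin 3) (u v : S ⊗[F] S') :
    bracket A A' (iota A A' (i + 1) u) (iota A A' i v) = -iota A A' (i + 2) (tmulMul A A' v u) := by
  rw [bracket_swap, bracket_iota_iota_succ]

theorem bracket_iota_iota_add_two (i : Fin 3) (u v : S ⊗[F] S') :
    bracket A A' (iota A A' i u) (iota A A' (i + 2) v) = -iota A A' (i + 1) (tmulMul A A' v u) := by
  have := bracket_iota_succ_iota A A' (i + 2) u v
  have e : i + 2 + 1 = i := by rw [add_assoc]; simp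
  have e' : i + 2 + 2 = i + 1 := by rw [add_assoc]; simp
  rwa [e, e'] at this

theorem bracket_iota_add_two_iota (i : Fin 3) (u v : S ⊗[F] S') :
    bracket A A' (iota A A' (i + 2) u) (iota A A' i v) = iota A A' (i + 1) (tmulMul A A' u v) := by
  rw [bracket_swap, bracket_iota_iota_add_two, neg_neg]

theorem bracket_iota_add_two_iota_succ (i : Fin 3) (u v : S ⊗[F] S') :
    bracket A A' (iota A A' (i + 2) u) (iota A A' (i + 1) v) =
      -iota A A' i (tmulMul A A' v u) := by
  have := bracket_iota_succ_iota A A' (i + 1) u v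
  have e : i + 1 + 1 = i + 2 := by rw [add_assoc]; simp
  have e' : i + 1 + 2 = i := by rw [add_assoc]; simp
  rwa [e, e'] at this

theorem bracket_iota_succ_iota_add_two (i : Fin 3) (u v : S ⊗[F] S') :
    bracket A A' (iota A A' (i + 1) u) (iota A A' (i + 2) v) =
      iota A A' i (tmulMul A A' u v) := by
  rw [bracket_swap, bracket_iota_add_two_iota_succ, neg_neg]

/-- The Jacobian of three elements of `𝔤(S, S')`. -/
noncomputable def jacobian (X Y Z : MagicAlg A A') : MagicAlg A A' :=
  bracket A A' X (bracket A A' Y Z) + bracket A A' Y (bracket A A' Z X) +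
    bracket A A' Z (bracket A A' X Y)

theorem jacobian_rotate (X Y Z : MagicAlg A A') :
    jacobian A A' X Y Z = jacobian A A' Y Z X := by
  simp only [jacobian]; abel

theorem jacobian_swap (X Y Z : MagicAlg A A') :
    jacobian A A' X Y Z = -jacobian A A' Y X Z := by
  simp only [jacobian]
  rw [bracket_swap A A' Y X, bracket_swap A A' Z X, bracket_swap A A' Y Z]
  simp only [map_neg]
  abel

theorem jacobian_add (X X' Y Z : MagicAlg A A') :
    jacobian A A' (X + X') Y Z = jacobian A A' X Y Z + jacobian A A' X' Y Z := by
  simp only [jacobian, map_add, LinearMap.add_apply]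
  abel

theorem jacobian_tri_tri_tri (d e f : A.tri × A'.tri) :
    jacobian A A' (triIncl A A' d) (triIncl A A' e) (triIncl A A' f) = 0 := by
  simp only [jacobian, bracket_tri_tri, ← map_add, Prod.mk_add_mk, SymmetricComposition.triLie_jacobi]
  exact map_zero _

theorem jacobian_tri_tri_iota (d e : A.tri × A'.tri) (i : Fin 3) (u : S ⊗[F] S') :
    jacobian A A' (triIncl A A' d) (triIncl A A' e) (iota A A' i u) = 0 := by
  simp only [jacobian, bracket_tri_tri, bracket_tri_iota, bracket_iota_tri, map_neg, triAct_lie,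
    map_sub]
  abel

theorem jacobian_tri_iota_self (d : A.tri × A'.tri) (i : Fin 3) (a b : S) (x y : S') :
    jacobian A A' (triIncl A A' d) (iota A A' i (a ⊗ₜ x)) (iota A A' i (b ⊗ₜ y)) = 0 := by
  have h1 := eq_neg_of_add_eq_zero_left (d.1.2.1 i a b)
  have h2 := eq_neg_of_add_eq_zero_left (d.2.2.1 i x y)
  simp only [jacobian, bracket_iota_iota_self, bracket_tri_tri, bracket_tri_iota,
    bracket_iota_tri, triAct_tmul, map_neg, map_add, thetaT_tmul, thetaT'_tmul, map_smul,
    SymmetricComposition.triLie_theta_t]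
  refine Prod.ext (Prod.ext ?_ ?_) ?_
  · simp only [triIncl_apply, Prod.fst_add, Prod.fst_neg, Prod.fst_zero]
    rw [A.t_swap b, A.t_swap b, A'.pol_comm y, A'.pol_comm y, h2]
    simp only [map_neg]
    module
  · simp only [triIncl_apply, Prod.snd_add, Prod.snd_neg, Prod.fst_add, Prod.fst_neg,
      Prod.fst_zero, Prod.snd_zero]
    rw [A'.t_swap y, A'.t_swap y, A.pol_comm b, A.pol_comm b, h1]
    simp only [map_neg]
    module
  · simp [triIncl_apply]

theorem jacobian_tri_iota_succ (d : A.tri × A'.tri) (i : Fin 3) (a b : S) (x y : S') :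
    jacobian A A' (triIncl A A' d) (iota A A' i (a ⊗ₜ x)) (iota A A' (i + 1) (b ⊗ₜ y)) = 0 := by
  have e1 : i + 2 + 1 = i := by rw [add_assoc]; simp
  have e2 : i + 2 + 2 = i + 1 := by rw [add_assoc]; simp
  have h1 := A.tri_mul d.1.2 (i + 2) a b
  have h2 := A'.tri_mul d.2.2 (i + 2) x y
  rw [e1, e2] at h1 h2
  simp only [jacobian, bracket_iota_iota_succ, bracket_tri_iota, bracket_iota_tri,
    bracket_iota_succ_iota, tmulMul_tmul, triAct_tmul, map_neg, map_add, h1, h2,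
    TensorProduct.add_tmul, TensorProduct.tmul_add]
  abel

theorem jacobian_iota_self_self (i : Fin 3) (a b c : S) (x y z : S') :
    jacobian A A' (iota A A' i (a ⊗ₜ x)) (iota A A' i (b ⊗ₜ y)) (iota A A' i (c ⊗ₜ z)) = 0 := by
  simp only [jacobian, bracket_iota_iota_self, bracket_iota_tri, triAct_tmul, thetaT_tmul,
    thetaT'_tmul, Submodule.coe_smul, Pi.smul_apply, LinearMap.smul_apply,
    SymmetricComposition.theta_pow_apply, sub_self, SymmetricComposition.t_val,
    SymmetricComposition.tFun_zero, ← TensorProduct.smul_tmul', TensorProduct.tmul_smul,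
    TensorProduct.sub_tmul, TensorProduct.tmul_sub, map_smul, map_sub, map_add]
  rw [A.pol_comm c a, A.pol_comm b a, A.pol_comm c b, A'.pol_comm z x, A'.pol_comm y x,
    A'.pol_comm z y]
  module

/-- For `c ∈ S`, `z ∈ S'` and decompositions `m c = p + p'`, `n z = r + r'`, such as
`q(a,b) c = (a * c) * b + (b * c) * a`, this cancels the factors `½` in the second and third
components of `t_{a,b}` and `t'_{x,y}`. -/
theorem half_tmul_identity {p p' c : S} {r r' z : S'} {m n : F} (hc : m • c = p + p')
    (hz : n • z = r + r') :
    (n • ((2⁻¹ * m) • c - p)) ⊗ₜ[F] z + c ⊗ₜ[F] (m • ((2⁻¹ * n) • z - r)) =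
      p' ⊗ₜ r' - p ⊗ₜ r := by
  have h2 : (2 : F) ≠ 0 := NeZero.ne 2
  rw [mul_smul, mul_smul, hc, hz, TensorProduct.smul_tmul, hz, ← TensorProduct.smul_tmul, hc]
  simp only [TensorProduct.add_tmul, TensorProduct.tmul_add, TensorProduct.sub_tmul,
    TensorProduct.tmul_sub, ← TensorProduct.smul_tmul', TensorProduct.tmul_smul, smul_add]
  match_scalars <;> field_simp <;> ring

theorem jacobian_iota_self_succ (i : Fin 3) (a b c : S) (x y z : S') :
    jacobian A A' (iota A A' i (a ⊗ₜ x)) (iota A A' i (b ⊗ₜ y)) (iota A A' (i + 1) (c ⊗ₜ z)) = 0 := by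
  have h : A.pol a b • c = A.mul (A.mul b c) a + A.mul (A.mul a c) b := by
    rw [A.lin_left b c a, A.pol_comm b a]; abel
  have h' : A'.pol x y • z = A'.mul (A'.mul y z) x + A'.mul (A'.mul x z) y := by
    rw [A'.lin_left y z x, A'.pol_comm y x]; abel
  simp only [jacobian, bracket_iota_iota_self, bracket_iota_iota_succ, bracket_iota_tri,
    bracket_iota_succ_iota, bracket_iota_iota_add_two, triAct_tmul, thetaT_tmul,
    thetaT'_tmul, Submodule.coe_smul, Pi.smul_apply, LinearMap.smul_apply, tmulMul_tmul,
    SymmetricComposition.theta_pow_apply, add_sub_cancel_left, SymmetricComposition.t_val,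
    SymmetricComposition.tFun_one, map_neg, half_tmul_identity h h', map_sub]
  abel

theorem jacobian_iota_self_add_two (i : Fin 3) (a b c : S) (x y z : S') :
    jacobian A A' (iota A A' i (a ⊗ₜ x)) (iota A A' i (b ⊗ₜ y)) (iota A A' (i + 2) (c ⊗ₜ z)) = 0 := by
  have h : A.pol a b • c = A.mul a (A.mul c b) + A.mul b (A.mul c a) := by
    rw [A.lin_right a c b]; abel
  have h' : A'.pol x y • z = A'.mul x (A'.mul z y) + A'.mul y (A'.mul z x) := by
    rw [A'.lin_right x z y]; abel
  simp only [jacobian, bracket_iota_iota_self, bracket_iota_iota_succ, bracket_iota_tri,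
    bracket_iota_add_two_iota, bracket_iota_iota_add_two, triAct_tmul, thetaT_tmul,
    thetaT'_tmul, Submodule.coe_smul, Pi.smul_apply, LinearMap.smul_apply, tmulMul_tmul,
    SymmetricComposition.theta_pow_apply, add_sub_cancel_left, SymmetricComposition.t_val,
    SymmetricComposition.tFun_two, map_neg, half_tmul_identity h h', map_sub]
  abel

theorem jacobian_iota_iota_iota (i : Fin 3) (a b c : S) (x y z : S') :
    jacobian A A' (iota A A' i (a ⊗ₜ x)) (iota A A' (i + 1) (b ⊗ₜ y))
      (iota A A' (i + 2) (c ⊗ₜ z)) = 0 := by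
  have h1 := congrArg (fun u => A'.pol (A'.mul x y) z • u) (A.theta_t_cyclic i a b c)
  have h2 := congrArg (fun u => A.pol (A.mul a b) c • u) (A'.theta_t_cyclic i x y z)
  simp only [smul_zero, smul_add] at h1 h2
  simp only [jacobian, bracket_iota_add_two_iota, bracket_iota_iota_succ,
    bracket_iota_succ_iota_add_two, bracket_iota_iota_self, tmulMul_tmul, thetaT_tmul,
    thetaT'_tmul]
  rw [A.pol_comm a, A'.pol_comm x, A.pol_comm b, A'.pol_comm y, A.pol_comm c, A'.pol_comm z,
    ← A.pol_mul_cyclic c a b, ← A'.pol_mul_cyclic z x y, A.pol_mul_cyclic a b c,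
    A'.pol_mul_cyclic x y z]
  rw [A.t_swap a, A'.t_swap x, A.t_swap b, A'.t_swap y, A.t_swap c, A'.t_swap z]
  refine Prod.ext (Prod.ext ?_ ?_) ?_
  · simp only [triIncl_apply, Prod.fst_add, Prod.fst_zero, map_neg, smul_neg]
    rw [← neg_add, ← neg_add, h1, neg_zero]
  · simp only [triIncl_apply, Prod.fst_add, Prod.snd_add, Prod.fst_zero, Prod.snd_zero, map_neg,
      smul_neg]
    rw [← neg_add, ← neg_add, h2, neg_zero]
  · simp [triIncl_apply]

theorem jacobian_iota (i j k : Fin 3) (a b c : S) (x y z : S') :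
    jacobian A A' (iota A A' i (a ⊗ₜ x)) (iota A A' j (b ⊗ₜ y)) (iota A A' k (c ⊗ₜ z)) = 0 := by
  have hself : ∀ (i k : Fin 3) (a b c : S) (x y z : S'), jacobian A A' (iota A A' i (a ⊗ₜ x))
      (iota A A' i (b ⊗ₜ y)) (iota A A' k (c ⊗ₜ z)) = 0 := by
    intro i k a b c x y z
    have : k = i ∨ k = i + 1 ∨ k = i + 2 := by revert i k; decide
    rcases this with rfl | rfl | rfl
    · exact jacobian_iota_self_self A A' _ a b c x y z
    · exact jacobian_iota_self_succ A A' _ a b c x y z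
    · exact jacobian_iota_self_add_two A A' _ a b c x y z
  have : i = j ∨ j = k ∨ k = i ∨ (j = i + 1 ∧ k = i + 2) ∨ (i = j + 1 ∧ k = j + 2) := by
    revert i j k; decide
  rcases this with rfl | rfl | rfl | ⟨rfl, rfl⟩ | ⟨rfl, rfl⟩
  · exact hself _ _ _ _ _ _ _ _
  · rw [jacobian_rotate]
    exact hself _ _ _ _ _ _ _ _
  · rw [jacobian_rotate, jacobian_rotate]
    exact hself _ _ _ _ _ _ _ _
  · exact jacobian_iota_iota_iota A A' _ a b c x y z
  · rw [jacobian_swap, jacobian_iota_iota_iota, neg_zero]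

theorem jacobian_tri_iota_iota (d : A.tri × A'.tri) (i j : Fin 3) (a b : S) (x y : S') :
    jacobian A A' (triIncl A A' d) (iota A A' i (a ⊗ₜ x)) (iota A A' j (b ⊗ₜ y)) = 0 := by
  have : i = j ∨ j = i + 1 ∨ i = j + 1 := by revert i j; decide
  rcases this with rfl | rfl | rfl
  · exact jacobian_tri_iota_self A A' d _ a b x y
  · exact jacobian_tri_iota_succ A A' d _ a b x y
  · rw [jacobian_rotate, jacobian_swap, ← jacobian_rotate, jacobian_tri_iota_succ, neg_zero]

/-- `𝔤(S, S')` is a Lie algebra for all symmetric composition algebras `S`, `S'`. -/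
theorem isLieAlgebra : IsLieAlgebra A A' := by
  refine ⟨fun X => ?_, fun X Y Z => ?_⟩
  · have h := bracket_swap A A' X X
    rw [eq_neg_iff_add_eq_zero, ← two_smul F] at h
    exact (smul_eq_zero.1 h).resolve_left (NeZero.ne 2)
  have rot := jacobian_rotate A A'
  have add₁ : ∀ X X' Y Z : MagicAlg A A', jacobian A A' X Y Z = 0 → jacobian A A' X' Y Z = 0 →
      jacobian A A' (X + X') Y Z = 0 := fun X X' Y Z h h' => by
    rw [jacobian_add, h, h', add_zero]
  have add₂ : ∀ X Y Y' Z : MagicAlg A A', jacobian A A' X Y Z = 0 → jacobian A A' X Y' Z = 0 →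
      jacobian A A' X (Y + Y') Z = 0 := fun X Y Y' Z h h' => by
    rw [rot] at h h' ⊢
    exact add₁ _ _ _ _ h h'
  have add₃ : ∀ X Y Z Z' : MagicAlg A A', jacobian A A' X Y Z = 0 → jacobian A A' X Y Z' = 0 →
      jacobian A A' X Y (Z + Z') = 0 := fun X Y Z Z' h h' => by
    rw [rot] at h h' ⊢
    exact add₂ _ _ _ _ h h'
  change jacobian A A' X Y Z = 0
  induction X using induction_gen with
  | hadd X X' h h' => exact add₁ _ _ _ _ h h'
  | htri d =>
    induction Y using induction_gen with
    | hadd Y Y' h h' => exact add₂ _ _ _ _ h h'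
    | htri e =>
      induction Z using induction_gen with
      | hadd Z Z' h h' => exact add₃ _ _ _ _ h h'
      | htri f => exact jacobian_tri_tri_tri A A' d e f
      | hiota k c z => exact jacobian_tri_tri_iota A A' d e k _
    | hiota j b y =>
      induction Z using induction_gen with
      | hadd Z Z' h h' => exact add₃ _ _ _ _ h h'
      | htri f => rw [rot, rot]; exact jacobian_tri_tri_iota A A' f d j _
      | hiota k c z => exact jacobian_tri_iota_iota A A' d j k b c y z
  | hiota i a x =>
    induction Y using induction_gen with
    | hadd Y Y' h h' => exact add₂ _ _ _ _ h h'
    | htri e =>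
      induction Z using induction_gen with
      | hadd Z Z' h h' => exact add₃ _ _ _ _ h h'
      | htri f => rw [rot]; exact jacobian_tri_tri_iota A A' e f i _
      | hiota k c z => rw [rot]; exact jacobian_tri_iota_iota A A' e k i c a z x
    | hiota j b y =>
      induction Z using induction_gen with
      | hadd Z Z' h h' => exact add₃ _ _ _ _ h h'
      | htri f => rw [rot, rot]; exact jacobian_tri_iota_iota A A' f i j a b x y
      | hiota k c z => exact jacobian_iota A A' i j k a b c x y z

end MagicAlg

/-! ### The combinatorics of the index sets -/

namespace MagicModels

theorem bijOn_chi3 : Set.BijOn (fun x => toSubset lab7 (chi3 x)) Set.univ SE7 := by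
  refine ⟨fun x _ => ?_, fun x _ y _ h => ?_, fun σ hσ => ?_⟩
  · exact Finset.mem_coe.2 ((by decide : ∀ x, toSubset lab7 (chi3 x) ∈ SE7) x)
  · exact (by decide : Function.Injective fun x => toSubset lab7 (chi3 x)) h
  · have : ∀ σ ∈ SE7, ∃ x, toSubset lab7 (chi3 x) = σ := by decide
    obtain ⟨x, hx⟩ := this σ hσ
    exact ⟨x, trivial, hx⟩

theorem bijOn_chi2 : Set.BijOn (fun x => toSubset lab6 (chi2 x)) Set.univ SD6 := by
  refine ⟨fun x _ => ?_, fun x _ y _ h => ?_, fun σ hσ => ?_⟩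
  · exact Finset.mem_coe.2 ((by decide : ∀ x, toSubset lab6 (chi2 x) ∈ SD6) x)
  · exact (by decide : Function.Injective fun x => toSubset lab6 (chi2 x)) h
  · have : ∀ σ ∈ SD6, ∃ x, toSubset lab6 (chi2 x) = σ := by decide
    obtain ⟨x, hx⟩ := this σ hσ
    exact ⟨x, trivial, hx⟩

theorem epsE7_chi3 (x y : Fin 3 → ZMod 2) :
    epsE7 (toSubset lab7 (chi3 x)) (toSubset lab7 (chi3 y)) = sgn (f x y) := by
  revert x y
  decide

theorem epsD6_chi2 (x y : Fin 2 → ZMod 2) :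
    epsD6 (toSubset lab6 (chi2 x)) (toSubset lab6 (chi2 y)) = sgn (f' x y) := by
  revert x y
  decide

theorem injective_fanoPoint : Function.Injective fanoPoint := by decide

theorem range_fanoPoint : Set.range fanoPoint = {0}ᶜ := by
  ext x
  simp only [Set.mem_range, Set.mem_compl_iff, Set.mem_singleton_iff]
  revert x
  decide

/-- The linear form `x ↦ a₁x₁ + a₂x₂ + a₃x₃` on `ℤ₂³`. -/
def dotForm (a : Fin 3 → ZMod 2) : (Fin 3 → ZMod 2) →ₗ[ZMod 2] ZMod 2 :=
  a 0 • LinearMap.proj 0 + a 1 • LinearMap.proj 1 + a 2 • LinearMap.proj 2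

theorem dotForm_apply (a x : Fin 3 → ZMod 2) :
    dotForm a x = a 0 * x 0 + a 1 * x 1 + a 2 * x 2 := rfl

theorem finrank_ker_dotForm {a : Fin 3 → ZMod 2} (ha : a ≠ 0) :
    Module.finrank (ZMod 2) (LinearMap.ker (dotForm a)) = 2 := by
  have h : ∀ a : Fin 3 → ZMod 2, a ≠ 0 → ∀ c : ZMod 2,
      ∃ x : Fin 3 → ZMod 2, a 0 * x 0 + a 1 * x 1 + a 2 * x 2 = c := by
    decide
  have h1 : LinearMap.range (dotForm a) = ⊤ := LinearMap.range_eq_top.2 (h a ha)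
  have h2 := LinearMap.finrank_range_add_finrank_ker (dotForm a)
  rw [h1, finrank_top] at h2
  simp at h2
  omega

/-- The lines of the Fano plane are the kernels of the nonzero linear forms on `ℤ₂³`. -/
theorem exists_eq_ker_dotForm (W : Submodule (ZMod 2) (Fin 3 → ZMod 2))
    (hW : Module.finrank (ZMod 2) W = 2) : ∃ a ≠ 0, W = LinearMap.ker (dotForm a) := by
  have hlt : W < ⊤ := by
    refine lt_top_iff_ne_top.2 fun h => ?_
    rw [h, finrank_top] at hW
    simp at hW
  obtain ⟨g, hg, hle⟩ := Submodule.exists_le_ker_of_lt_top W hlt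
  have e : g = dotForm fun i => g (Pi.single i 1) := by
    refine LinearMap.pi_ext' fun i => LinearMap.ext_ring ?_
    fin_cases i <;> simp [dotForm_apply]
  refine ⟨fun i => g (Pi.single i 1), fun h => hg ?_, ?_⟩
  · rw [e, h]
    ext; simp [dotForm_apply]
  · rw [← e]
    refine Submodule.eq_of_le_of_finrank_eq hle ?_
    rw [hW, e, finrank_ker_dotForm]
    intro h
    refine hg ?_
    rw [e, h]
    ext; simp [dotForm_apply]

theorem mem_SE7_iff_isFanoQuadrilateral (σ : Finset ℕ) :
    (σ ∈ SE7 ∧ σ ≠ ∅) ↔ IsFanoQuadrilateral σ := by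
  have hset : ∀ a : Fin 3 → ZMod 2, lab7 '' {i | fanoPoint i ∉ LinearMap.ker (dotForm a)} =
      ((Finset.univ.filter fun i : Fin 7 => ¬ (a 0 * fanoPoint i 0 + a 1 * fanoPoint i 1 +
        a 2 * fanoPoint i 2 = 0)).image lab7 : Finset ℕ) := by
    intro a
    simp [LinearMap.mem_ker, dotForm_apply]
  constructor
  · intro h
    have : ∀ σ ∈ SE7, σ ≠ ∅ → ∃ a : Fin 3 → ZMod 2, a ≠ 0 ∧ σ = (Finset.univ.filter
        fun i : Fin 7 => ¬ (a 0 * fanoPoint i 0 + a 1 * fanoPoint i 1 +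
          a 2 * fanoPoint i 2 = 0)).image lab7 := by decide
    obtain ⟨a, ha, e⟩ := this σ h.1 h.2
    exact ⟨_, finrank_ker_dotForm ha, by rw [hset, ← e]⟩
  · rintro ⟨W, hW, e⟩
    obtain ⟨a, ha, rfl⟩ := exists_eq_ker_dotForm W hW
    rw [hset, Finset.coe_inj] at e
    subst e
    clear hW
    revert a
    decide

namespace Octonion

open scoped Quaternion

/-- The octonion `p + q l`. -/
def mk (p q : ℍ[ℝ]) : Octonion := (p, q)

theorem mk_mul_mk (p q p' q' : ℍ[ℝ]) :
    mk p q * mk p' q' = mk (p * p' - star q' * q) (q' * p + q * star p') := rfl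

theorem neg_mk (p q : ℍ[ℝ]) : mk (-p) (-q) = -mk p q := rfl

theorem smul_mk (r : ℝ) (p q : ℍ[ℝ]) : r • mk p q = mk (r • p) (r • q) := rfl

theorem zmod_two_eq : ∀ c : ZMod 2, c = 0 ∨ c = 1 := by decide

/-- The quaternion `i^a j^b`, one of `1, i, j, k`, for `a, b ∈ ℤ₂`. -/
def quatUnit (a b : ZMod 2) : ℍ[ℝ] :=
  ⟨if a = 0 ∧ b = 0 then 1 else 0, if a = 1 ∧ b = 0 then 1 else 0,
    if a = 0 ∧ b = 1 then 1 else 0, if a = 1 ∧ b = 1 then 1 else 0⟩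

theorem re_quatUnit (a b : ZMod 2) : (quatUnit a b).re = if a = 0 ∧ b = 0 then 1 else 0 := rfl
theorem imI_quatUnit (a b : ZMod 2) : (quatUnit a b).imI = if a = 1 ∧ b = 0 then 1 else 0 := rfl
theorem imJ_quatUnit (a b : ZMod 2) : (quatUnit a b).imJ = if a = 0 ∧ b = 1 then 1 else 0 := rfl
theorem imK_quatUnit (a b : ZMod 2) : (quatUnit a b).imK = if a = 1 ∧ b = 1 then 1 else 0 := rfl

theorem quatUnit_mul (a b c d : ZMod 2) : quatUnit a b * quatUnit c d =
    ((sgn (a * c + b * (c + d)) : ℤ) : ℝ) • quatUnit (a + c) (b + d) := by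
  have h : (1 + 1 : ZMod 2) = 0 := rfl
  rcases zmod_two_eq a with rfl | rfl <;> rcases zmod_two_eq b with rfl | rfl <;>
  rcases zmod_two_eq c with rfl | rfl <;> rcases zmod_two_eq d with rfl | rfl <;>
    ext <;> simp [re_quatUnit, imI_quatUnit, imJ_quatUnit, imK_quatUnit, sgn, h, ZMod.val_one]

theorem star_quatUnit (a b : ZMod 2) :
    star (quatUnit a b) = ((sgn (a + b + a * b) : ℤ) : ℝ) • quatUnit a b := by
  have h : (1 + 1 : ZMod 2) = 0 := rfl
  rcases zmod_two_eq a with rfl | rfl <;> rcases zmod_two_eq b with rfl | rfl <;> ext <;> simp [re_quatUnit, imI_quatUnit, imJ_quatUnit, imK_quatUnit, sgn, h, ZMod.val_one]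

theorem quatUnit_zero_zero : quatUnit 0 0 = 1 := by
  ext <;> simp [quatUnit]

theorem unit_eq (x : Fin 3 → ZMod 2) : unit x =
    if x 2 = 0 then mk (quatUnit (x 0) (x 1)) 0 else mk 0 (quatUnit (x 0) (x 1)) := by
  have hi : (if x 0 = 1 then i else 1) = mk (quatUnit (x 0) 0) 0 := by
    rcases zmod_two_eq (x 0) with h | h <;> rw [h]
    · exact congrArg (mk · 0) quatUnit_zero_zero.symm
    · refine congrArg (mk · 0) ?_
      ext <;> simp [quatUnit]
  have hj : (if x 1 = 1 then j else 1) = mk (quatUnit 0 (x 1)) 0 := by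
    rcases zmod_two_eq (x 1) with h | h <;> rw [h]
    · exact congrArg (mk · 0) quatUnit_zero_zero.symm
    · refine congrArg (mk · 0) ?_
      ext <;> simp [quatUnit]
  have h1 : (1 : Octonion) = mk 1 0 := rfl
  have hl : l = mk 0 1 := rfl
  rw [unit, hi, hj, h1, hl]
  rcases zmod_two_eq (x 2) with h | h <;> rw [h] <;> simp [mk_mul_mk, quatUnit_mul, sgn]

theorem unit_mul (x y : Fin 3 → ZMod 2) :
    unit x * unit y = ((sgn (f x y) : ℤ) : ℝ) • unit (x + y) := by
  obtain ⟨a, b, c, rfl⟩ : ∃ a b c, x = ![a, b, c] :=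
    ⟨x 0, x 1, x 2, by ext i; fin_cases i <;> rfl⟩
  obtain ⟨a', b', c', rfl⟩ : ∃ a b c, y = ![a, b, c] :=
    ⟨y 0, y 1, y 2, by ext i; fin_cases i <;> rfl⟩
  -- the signs that the product of the doubled quaternions produces
  have h00 : ∀ a b a' b' : ZMod 2, f ![a, b, 0] ![a', b', 0] = a * a' + b * (a' + b') := by decide
  have h01 : ∀ a b a' b' : ZMod 2, sgn (f ![a, b, 0] ![a', b', 1]) =
      sgn (a' * a + b' * (a + b)) := by decide
  have h10 : ∀ a b a' b' : ZMod 2, sgn (f ![a, b, 1] ![a', b', 0]) =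
      sgn (a' + b' + a' * b') * sgn (a * a' + b * (a' + b')) := by decide
  have h11 : ∀ a b a' b' : ZMod 2, sgn (f ![a, b, 1] ![a', b', 1]) =
      -(sgn (a' + b' + a' * b') * sgn (a' * a + b' * (a + b))) := by decide
  have h : (1 + 1 : ZMod 2) = 0 := rfl
  rw [unit_eq, unit_eq, unit_eq]
  rcases zmod_two_eq c with rfl | rfl <;>
  rcases zmod_two_eq c' with rfl | rfl
  · simp [mk_mul_mk, smul_mk, quatUnit_mul, h00]
  · simp [mk_mul_mk, smul_mk, quatUnit_mul, h01, add_comm]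
  · simp [mk_mul_mk, smul_mk, quatUnit_mul, h10, star_quatUnit, smul_smul]
  · simp [mk_mul_mk, smul_mk, quatUnit_mul, h11, star_quatUnit, smul_smul, h, add_comm, ← neg_mk]

/-- The coordinates of an octonion in the basis `1, i, j, k, l, il, jl, kl`. -/
def coord (a : Octonion) (x : Fin 3 → ZMod 2) : ℝ :=
  if x 2 = 0 then
    if x 1 = 0 then if x 0 = 0 then a.1.re else a.1.imI else if x 0 = 0 then a.1.imJ else a.1.imK
  else
    if x 1 = 0 then if x 0 = 0 then a.2.re else a.2.imI else if x 0 = 0 then a.2.imJ else a.2.imK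

/-- The coordinates, as a linear equivalence. -/
def coordEquiv : Octonion ≃ₗ[ℝ] ((Fin 3 → ZMod 2) → ℝ) where
  toFun := coord
  invFun c := ((⟨c ![0, 0, 0], c ![1, 0, 0], c ![0, 1, 0], c ![1, 1, 0]⟩ : ℍ[ℝ]),
    (⟨c ![0, 0, 1], c ![1, 0, 1], c ![0, 1, 1], c ![1, 1, 1]⟩ : ℍ[ℝ]))
  map_add' a b := by
    funext x
    rw [Pi.add_apply]
    unfold coord
    split_ifs <;> rfl
  map_smul' r a := by
    funext x
    rw [Pi.smul_apply]
    unfold coord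
    split_ifs <;> rfl
  left_inv a := rfl
  right_inv c := by
    funext x
    obtain ⟨a, b, c, rfl⟩ : ∃ a b c, x = ![a, b, c] :=
      ⟨x 0, x 1, x 2, by ext i; fin_cases i <;> rfl⟩
    rcases zmod_two_eq a with rfl | rfl <;> rcases zmod_two_eq b with rfl | rfl <;>
      rcases zmod_two_eq c with rfl | rfl <;> rfl

/-- The basis of `𝕆` formed by the units `e^x`. -/
noncomputable def unitBasis : Module.Basis (Fin 3 → ZMod 2) ℝ Octonion :=
  Module.Basis.ofEquivFun coordEquiv

theorem unitBasis_apply (x : Fin 3 → ZMod 2) : unitBasis x = unit x := by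
  rw [unit_eq, unitBasis, Module.Basis.coe_ofEquivFun]
  obtain ⟨a, b, c, rfl⟩ : ∃ a b c, x = ![a, b, c] :=
    ⟨x 0, x 1, x 2, by ext i; fin_cases i <;> rfl⟩
  refine (LinearEquiv.symm_apply_eq coordEquiv).2 (funext fun y => ?_)
  change _ = coord _ _
  obtain ⟨a', b', c', rfl⟩ : ∃ a b c, y = ![a, b, c] :=
    ⟨y 0, y 1, y 2, by ext i; fin_cases i <;> rfl⟩
  rw [Pi.single_apply]
  rcases zmod_two_eq c with rfl | rfl <;> rcases zmod_two_eq c' with rfl | rfl <;>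
  rcases zmod_two_eq a with rfl | rfl <;> rcases zmod_two_eq b with rfl | rfl <;>
  rcases zmod_two_eq a' with rfl | rfl <;> rcases zmod_two_eq b' with rfl | rfl <;>
  simp [coord, mk, quatUnit]

theorem linearIndependent_unit : LinearIndependent ℝ unit := by
  have := unitBasis.linearIndependent
  rwa [show (unitBasis : (Fin 3 → ZMod 2) → Octonion) = unit from funext unitBasis_apply] at this

theorem span_range_unit : Submodule.span ℝ (Set.range unit) = ⊤ := by
  have := unitBasis.span_eq
  rwa [show (unitBasis : (Fin 3 → ZMod 2) → Octonion) = unit from funext unitBasis_apply] at this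

end Octonion
end MagicModels

/-! ### The symplectic plane and the orthogonal Lie algebra of `V ⊗ V` -/

namespace SymplecticPlane

variable {F V : Type*} [Field F] [AddCommGroup V] [Module F V] (P : SymplecticPlane F V)

theorem exists_symplectic_basis : ∃ e₁ e₂ : V, P.form e₁ e₂ = 1 ∧
    ∀ v, v = P.form v e₂ • e₁ - P.form v e₁ • e₂ := by
  obtain ⟨a, b, hab⟩ := P.exists_form_ne_zero
  have h1 : P.form a ((P.form a b)⁻¹ • b) = 1 := by
    rw [map_smul, smul_eq_mul, inv_mul_cancel₀ hab]
  refine ⟨a, (P.form a b)⁻¹ • b, h1, fun v => ?_⟩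
  have := P.cyclic a ((P.form a b)⁻¹ • b) v
  rw [h1, P.form_swap _ v] at this
  linear_combination (norm := module) (1 : F) • this

/-- In coordinates the form is the determinant, so that identities between values of the form
become polynomial identities. -/
theorem exists_coord : ∃ x y : V →ₗ[F] F, ∀ u v, P.form u v = x u * y v - y u * x v := by
  obtain ⟨e₁, e₂, -, h⟩ := P.exists_symplectic_basis
  refine ⟨LinearMap.flip P.form e₂, P.form e₁, fun u v => ?_⟩
  conv_lhs => rw [h u]
  simp only [map_sub, map_smul, LinearMap.sub_apply, LinearMap.smul_apply, smul_eq_mul,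
    LinearMap.flip_apply]
  rw [P.form_swap u e₁, P.form_swap e₂ v]
  ring

theorem eq_zero_of_form {a : V} (h : ∀ b, P.form a b = 0) : a = 0 := by
  obtain ⟨e₁, e₂, -, h'⟩ := P.exists_symplectic_basis
  rw [h' a, h, h]
  simp

theorem tensor_ext {x y : V ⊗[F] V} (h : ∀ c d, P.tform x (c ⊗ₜ d) = P.tform y (c ⊗ₜ d)) :
    x = y := by
  rw [← sub_eq_zero]
  refine P.tform_sep fun z => ?_
  induction z using TensorProduct.induction_on with
  | zero => simp
  | add z z' hz hz' => rw [map_add, hz, hz', add_zero]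
  | tmul c d => rw [map_sub, LinearMap.sub_apply, h, sub_self]

/-- Dual bases of `V ⊗ V` with respect to its norm. -/
theorem exists_dual_bases : ∃ e e' : Fin 4 → V ⊗[F] V,
    (∀ z, z = ∑ i, P.tform (e' i) z • e i) ∧ ∀ z, z = ∑ i, P.tform z (e i) • e' i := by
  obtain ⟨e₁, e₂, h1, h⟩ := P.exists_symplectic_basis
  have key : ∀ z : V ⊗[F] V, z = P.tform (e₂ ⊗ₜ e₂) z • e₁ ⊗ₜ[F] e₁ -
      P.tform (e₂ ⊗ₜ e₁) z • e₁ ⊗ₜ[F] e₂ - P.tform (e₁ ⊗ₜ e₂) z • e₂ ⊗ₜ[F] e₁ +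
      P.tform (e₁ ⊗ₜ e₁) z • e₂ ⊗ₜ[F] e₂ := by
    intro z
    induction z using TensorProduct.induction_on with
    | zero => simp
    | tmul v w =>
      conv_lhs => rw [h v, h w]
      simp only [tform_tmul, TensorProduct.tmul_smul, TensorProduct.sub_tmul,
        TensorProduct.tmul_sub, ← TensorProduct.smul_tmul', P.form_swap e₁, P.form_swap e₂]
      module
    | add x y hx hy =>
      conv_lhs => rw [hx, hy]
      simp only [map_add]
      module
  refine ⟨![e₁ ⊗ₜ e₁, e₁ ⊗ₜ e₂, e₂ ⊗ₜ e₁, e₂ ⊗ₜ e₂],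
    ![e₂ ⊗ₜ e₂, -(e₂ ⊗ₜ e₁), -(e₁ ⊗ₜ e₂), e₁ ⊗ₜ e₁], fun z => ?_, fun z => ?_⟩
  · conv_lhs => rw [key z]
    simp [Fin.sum_univ_four]
    abel
  · conv_lhs => rw [key z]
    simp [Fin.sum_univ_four, P.tform_comm z]
    abel

theorem sp_skew (s : P.sp) (a b : V) : P.form (s.1 a) b = -P.form a (s.1 b) :=
  eq_neg_of_add_eq_zero_left (s.2 a b)

theorem gamma_apply (a b z : V) : (P.gamma a b).1 z = P.form a z • b + P.form b z • a := rfl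

theorem sp_eq_zero [NeZero (2 : F)] {s : P.sp} (h : ∀ a, P.form (s.1 a) a = 0) : s = 0 := by
  refine Subtype.ext (LinearMap.ext fun a => P.eq_zero_of_form fun b => ?_)
  have h1 := h (a + b)
  have h2 : P.form (s.1 b) a = P.form (s.1 a) b := by
    rw [P.sp_skew, ← P.form_swap]
  simp only [map_add, LinearMap.add_apply, h, h2, zero_add, add_zero] at h1
  rw [← two_mul] at h1
  exact (mul_eq_zero.1 h1).resolve_left (NeZero.ne 2)

theorem act2_tmul (s t : P.sp) (a b : V) :
    P.act2 s t (a ⊗ₜ b) = s.1 a ⊗ₜ b + a ⊗ₜ t.1 b := rfl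

/-- The action of `sp(V)²` on `V ⊗ V`, as a linear map. -/
noncomputable def act2Lin : P.sp × P.sp →ₗ[F] Module.End F (V ⊗[F] V) where
  toFun s := P.act2 s.1 s.2
  map_add' s t := TensorProduct.ext' fun a b => by
    simp only [act2_tmul, LinearMap.add_apply, Prod.fst_add, Prod.snd_add, Submodule.coe_add,
      TensorProduct.add_tmul, TensorProduct.tmul_add]
    abel
  map_smul' c s := TensorProduct.ext' fun a b => by
    simp only [act2_tmul, LinearMap.smul_apply, Prod.smul_fst, Prod.smul_snd,
      Submodule.coe_smul, TensorProduct.tmul_smul, ← TensorProduct.smul_tmul', smul_add,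
      RingHom.id_apply]

theorem act2Lin_apply (s t : P.sp) : P.act2Lin (s, t) = P.act2 s t := rfl

theorem act2_zero_zero : P.act2 0 0 = 0 := P.act2Lin.map_zero

theorem act2_skew (s t : P.sp) (x y : V ⊗[F] V) :
    P.tform (P.act2 s t x) y + P.tform x (P.act2 s t y) = 0 := by
  induction x using TensorProduct.induction_on with
  | zero => simp
  | add x x' hx hx' =>
    simp only [map_add, LinearMap.add_apply]
    linear_combination hx + hx'
  | tmul a b =>
  induction y using TensorProduct.induction_on with
  | zero => simp
  | add y y' hy hy' =>
    simp only [map_add]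
    linear_combination hy + hy'
  | tmul c d =>
    simp only [act2_tmul, map_add, LinearMap.add_apply, tform_tmul, sp_skew]
    ring

theorem act2_eq_zero [NeZero (2 : F)] {s t : P.sp} (h : P.act2 s t = 0) : s = 0 ∧ t = 0 := by
  obtain ⟨a', b', hab⟩ := P.exists_form_ne_zero
  have key : ∀ a b c d, P.form (s.1 a) c * P.form b d + P.form a c * P.form (t.1 b) d = 0 := by
    intro a b c d
    have := congrArg (fun z => P.tform z (c ⊗ₜ d)) (LinearMap.congr_fun h (a ⊗ₜ b))
    simpa [act2_tmul] using this
  constructor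
  · refine P.sp_eq_zero fun a => ?_
    have := key a a' a b'
    rw [P.alt a, zero_mul, add_zero] at this
    exact (mul_eq_zero.1 this).resolve_right hab
  · refine P.sp_eq_zero fun b => ?_
    have := key a' b b' b
    rw [P.alt b, mul_zero, zero_add] at this
    exact (mul_eq_zero.1 this).resolve_left hab

/-- The skew operator `σ_{x,y}` of `V ⊗ V`, for pure tensors `x = a ⊗ b` and `y = c ⊗ d`, is the
action of an element of `sp(V)²`. -/
theorem sigma_tmul [NeZero (2 : F)] (a b c d : V) (z : V ⊗[F] V) :
    P.tform (a ⊗ₜ b) z • c ⊗ₜ[F] d - P.tform (c ⊗ₜ d) z • a ⊗ₜ[F] b =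
      (2⁻¹ * P.form b d) • P.act2 (P.gamma a c) 0 z +
        (2⁻¹ * P.form a c) • P.act2 0 (P.gamma b d) z := by
  have h2 : (2 : F) ≠ 0 := NeZero.ne 2
  induction z using TensorProduct.induction_on with
  | zero => simp
  | add z z' hz hz' =>
    simp only [map_add]
    linear_combination (norm := module) (1 : F) • hz + (1 : F) • hz'
  | tmul u v =>
    refine P.tensor_ext fun g h => ?_
    obtain ⟨x, y, hxy⟩ := P.exists_coord
    simp only [act2_tmul, gamma_apply, map_add, map_sub, map_smul, LinearMap.add_apply,
      LinearMap.sub_apply, LinearMap.smul_apply, tform_tmul, smul_eq_mul, Submodule.coe_zero,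
      LinearMap.zero_apply, TensorProduct.zero_tmul, TensorProduct.tmul_zero, map_zero, hxy]
    field_simp
    ring

/-- Every element of the orthogonal Lie algebra of `V ⊗ V` is the action of an element
of `sp(V)²`: it is half a sum of operators `σ_{x,y}`. -/
theorem exists_act2_eq [NeZero (2 : F)] {f : Module.End F (V ⊗[F] V)}
    (hf : ∀ x y, P.tform (f x) y + P.tform x (f y) = 0) : ∃ s t : P.sp, f = P.act2 s t := by
  have h2 : (2 : F) ≠ 0 := NeZero.ne 2
  obtain ⟨e, e', h1, h1'⟩ := P.exists_dual_bases
  have hmem : ∀ x y : V ⊗[F] V,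
      ((P.tform x).smulRight y - (P.tform y).smulRight x : Module.End F (V ⊗[F] V)) ∈
        LinearMap.range P.act2Lin := by
    intro x y
    induction x using TensorProduct.induction_on with
    | zero => convert Submodule.zero_mem _; ext; simp
    | add x x' hx hx' =>
      convert Submodule.add_mem _ hx hx' using 1
      refine LinearMap.ext fun z => ?_
      simp only [map_add, LinearMap.add_apply, LinearMap.sub_apply, LinearMap.smulRight_apply]
      module
    | tmul a b =>
    induction y using TensorProduct.induction_on with
    | zero => convert Submodule.zero_mem _; ext; simp
    | add y y' hy hy' =>
      convert Submodule.add_mem _ hy hy' using 1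
      refine LinearMap.ext fun z => ?_
      simp only [map_add, LinearMap.add_apply, LinearMap.sub_apply, LinearMap.smulRight_apply]
      module
    | tmul c d =>
      refine ⟨(2⁻¹ * P.form b d) • (P.gamma a c, 0) + (2⁻¹ * P.form a c) • (0, P.gamma b d), ?_⟩
      rw [map_add, map_smul, map_smul, act2Lin_apply, act2Lin_apply]
      exact LinearMap.ext fun z => (P.sigma_tmul a b c d z).symm
  have hsum : f = (2⁻¹ : F) • ∑ i, ((P.tform (e' i)).smulRight (f (e i)) -
      (P.tform (f (e i))).smulRight (e' i)) := by
    refine LinearMap.ext fun z => ?_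
    have e1 : f z = ∑ i, P.tform (e' i) z • f (e i) := by
      conv_lhs => rw [h1 z]
      simp only [map_sum, map_smul]
    have e2 : f z = -∑ i, P.tform (f (e i)) z • e' i := by
      conv_lhs => rw [h1' (f z)]
      rw [← Finset.sum_neg_distrib]
      refine Finset.sum_congr rfl fun i _ => ?_
      rw [eq_neg_of_add_eq_zero_left (hf z (e i)), P.tform_comm z, neg_smul]
    simp only [LinearMap.smul_apply, LinearMap.sum_apply, LinearMap.sub_apply,
      LinearMap.smulRight_apply, Finset.sum_sub_distrib]
    rw [← e1, sub_eq_add_neg, ← e2, ← two_smul F, smul_smul, inv_mul_cancel₀ h2, one_smul]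
  have : f ∈ LinearMap.range P.act2Lin := by
    rw [hsum]
    exact Submodule.smul_mem _ _ (Submodule.sum_mem _ fun i _ => hmem _ _)
  obtain ⟨s, hs⟩ := this
  exact ⟨s.1, s.2, hs.symm⟩

/-! ### The triality Lie algebra of `S₄` -/

variable [NeZero (2 : F)]

theorem S4_mul (x y : V ⊗[F] V) : P.S4.mul x y = P.mul4 x y := rfl

theorem S4_pol (x y : V ⊗[F] V) : P.S4.pol x y = P.tform x y := P.polar_norm4 x y

theorem act2_mem_tri (s₁ s₂ s₃ : P.sp) :
    ![P.act2 s₁ s₂, P.act2 s₂ s₃, P.act2 s₃ s₁] ∈ P.S4.tri := by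
  refine ⟨fun i x y => ?_, fun x y => ?_⟩
  · rw [S4_pol, S4_pol]
    fin_cases i <;> exact P.act2_skew _ _ x y
  · change P.act2 s₁ s₂ (P.mul4 x y) = P.mul4 (P.act2 s₂ s₃ x) y + P.mul4 x (P.act2 s₃ s₁ y)
    induction x using TensorProduct.induction_on with
    | zero => simp
    | add x x' hx hx' => simp only [map_add, LinearMap.add_apply, hx, hx']; abel
    | tmul a b =>
    induction y using TensorProduct.induction_on with
    | zero => simp
    | add y y' hy hy' => simp only [map_add, hy, hy']; abel
    | tmul c d =>
      simp only [act2_tmul, mul4_tmul, map_add, map_smul, LinearMap.add_apply, sp_skew, neg_smul]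
      module

/-- The map `sp(V)³ → tri(S₄)`. -/
noncomputable def spTri4 : P.sp × P.sp × P.sp →ₗ[F] P.S4.tri where
  toFun s := ⟨_, P.act2_mem_tri s.1 s.2.1 s.2.2⟩
  map_add' s t := Subtype.ext (funext fun k => by
    fin_cases k
    exacts [P.act2Lin.map_add (s.1, s.2.1) (t.1, t.2.1),
      P.act2Lin.map_add (s.2.1, s.2.2) (t.2.1, t.2.2), P.act2Lin.map_add (s.2.2, s.1) (t.2.2, t.1)])
  map_smul' c s := Subtype.ext (funext fun k => by
    fin_cases k
    exacts [P.act2Lin.map_smul c (s.1, s.2.1), P.act2Lin.map_smul c (s.2.1, s.2.2),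
      P.act2Lin.map_smul c (s.2.2, s.1)])

theorem spTri4_val (s₁ s₂ s₃ : P.sp) :
    (P.spTri4 (s₁, s₂, s₃)).1 = ![P.act2 s₁ s₂, P.act2 s₂ s₃, P.act2 s₃ s₁] := rfl

/-- The components of a triple in `tri(S₄)` are the actions of three pairs in `sp(V)²`, and local
triality forces the six entries to coincide in pairs. -/
theorem spTri4_bijective : Function.Bijective P.spTri4 := by
  constructor
  · refine (injective_iff_map_eq_zero _).2 fun s hs => ?_
    have h0 := P.act2_eq_zero (congrFun (congrArg Subtype.val hs) 0)
    have h1 := P.act2_eq_zero (congrFun (congrArg Subtype.val hs) 1)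
    exact Prod.ext h0.1 (Prod.ext h0.2 h1.2)
  · intro d
    have skew : ∀ i x y, P.tform (d.1 i x) y + P.tform x (d.1 i y) = 0 := by
      intro i x y
      rw [← S4_pol, ← S4_pol]
      exact d.2.1 i x y
    obtain ⟨s₁, s₂, h0⟩ := P.exists_act2_eq (skew 0)
    obtain ⟨s₂', s₃, h1⟩ := P.exists_act2_eq (skew 1)
    obtain ⟨s₃', s₁', h2⟩ := P.exists_act2_eq (skew 2)
    -- local triality compares the components that belong to the same factor `V`
    have key : ∀ a b c e : V, P.form b c • (P.act2 (s₁' - s₁) (s₂' - s₂) (e ⊗ₜ a)) +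
        P.form b ((s₃' - s₃).1 c) • e ⊗ₜ[F] a = 0 := by
      intro a b c e
      have := d.2.2 (a ⊗ₜ b) (c ⊗ₜ e)
      rw [h0, h1, h2, S4_mul, S4_mul, S4_mul] at this
      simp only [act2_tmul, mul4_tmul, map_add, map_smul, LinearMap.add_apply, sp_skew,
        neg_smul] at this
      simp only [act2_tmul, AddSubgroupClass.coe_sub, LinearMap.sub_apply, map_sub,
        TensorProduct.sub_tmul, TensorProduct.tmul_sub]
      linear_combination (norm := module) (-1 : F) • this
    obtain ⟨e, a, hea⟩ := P.exists_form_ne_zero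
    have h3 : s₃' - s₃ = 0 := by
      refine P.sp_eq_zero fun b => ?_
      have := congrArg (fun z => P.tform z (a ⊗ₜ e)) (key a b b e)
      rw [P.alt b, zero_smul, zero_add] at this
      simp only [map_smul, LinearMap.smul_apply, tform_tmul, smul_eq_mul, map_zero,
        LinearMap.zero_apply] at this
      rw [P.form_swap a e] at this
      rw [P.sp_skew, (mul_eq_zero.1 this).resolve_right (by simpa using hea), neg_zero]
    have h4 : P.act2 (s₁' - s₁) (s₂' - s₂) = 0 := by
      refine TensorProduct.ext' fun u v => ?_
      have := key v e a u
      rw [h3] at this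
      simpa [hea] using this
    obtain ⟨h5, h6⟩ := P.act2_eq_zero h4
    rw [sub_eq_zero] at h3 h5 h6
    subst h3 h5 h6
    refine ⟨(s₁', s₂', s₃'), Subtype.ext (funext fun k => ?_)⟩
    fin_cases k
    exacts [h0.symm, h1.symm, h2.symm]

theorem S4_tFun_one (a b c d u v : V) :
    P.S4.tFun (a ⊗ₜ b) (c ⊗ₜ d) 1 (u ⊗ₜ v) =
      (2⁻¹ * P.form a c) • P.act2 (P.gamma b d) 0 (u ⊗ₜ v) := by
  have h2 : (2 : F) ≠ 0 := NeZero.ne 2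
  refine P.tensor_ext fun g h => ?_
  obtain ⟨x, y, hxy⟩ := P.exists_coord
  simp only [SymmetricComposition.tFun_one, S4_mul, S4_pol, mul4_tmul, act2_tmul, gamma_apply,
    map_add, map_sub, map_smul, LinearMap.add_apply, LinearMap.sub_apply, LinearMap.smul_apply,
    tform_tmul, smul_eq_mul, Submodule.coe_zero, LinearMap.zero_apply, TensorProduct.tmul_zero,
    map_zero, hxy]
  field_simp
  ring

theorem S4_tFun_two (a b c d u v : V) :
    P.S4.tFun (a ⊗ₜ b) (c ⊗ₜ d) 2 (u ⊗ₜ v) =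
      (2⁻¹ * P.form b d) • P.act2 0 (P.gamma a c) (u ⊗ₜ v) := by
  have h2 : (2 : F) ≠ 0 := NeZero.ne 2
  refine P.tensor_ext fun g h => ?_
  obtain ⟨x, y, hxy⟩ := P.exists_coord
  simp only [SymmetricComposition.tFun_two, S4_mul, S4_pol, mul4_tmul, act2_tmul, gamma_apply,
    map_add, map_sub, map_smul, LinearMap.add_apply, LinearMap.sub_apply, LinearMap.smul_apply,
    tform_tmul, smul_eq_mul, Submodule.coe_zero, LinearMap.zero_apply, TensorProduct.zero_tmul,
    map_zero, hxy]
  field_simp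
  ring

/-- The elements `t_{x,y}` of `tri(S₄)`, for pure tensors `x`, `y`, in terms of `sp(V)³`. -/
theorem t4_tmul (a b c d : V) : P.S4.t (a ⊗ₜ b) (c ⊗ₜ d) =
    (2⁻¹ * P.form b d) • P.spTri4 (P.gamma a c, 0, 0) +
      (2⁻¹ * P.form a c) • P.spTri4 (0, P.gamma b d, 0) := by
  refine Subtype.ext (funext fun k => ?_)
  rw [Submodule.coe_add, Submodule.coe_smul, Submodule.coe_smul, spTri4_val, spTri4_val,
    SymmetricComposition.t_val, Pi.add_apply, Pi.smul_apply, Pi.smul_apply]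
  fin_cases k
  · refine LinearMap.ext fun z => ?_
    refine Eq.trans ?_ (P.sigma_tmul a b c d z)
    refine (SymmetricComposition.tFun_zero _ _ _ _).trans ?_
    rw [S4_pol, S4_pol]
  · refine TensorProduct.ext' fun u v => (P.S4_tFun_one a b c d u v).trans ?_
    change _ = (2⁻¹ * P.form b d) • P.act2 0 0 (u ⊗ₜ v) + _
    rw [act2_zero_zero, LinearMap.zero_apply, smul_zero, zero_add]
    rfl
  · refine TensorProduct.ext' fun u v => (P.S4_tFun_two a b c d u v).trans ?_
    change _ = _ + (2⁻¹ * P.form a c) • P.act2 0 0 (u ⊗ₜ v)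
    rw [act2_zero_zero, LinearMap.zero_apply, smul_zero, add_zero]
    rfl

end SymplecticPlane

/-! ### The triality Lie algebra of `S₈` -/

namespace SymplecticPlane

variable {F V : Type*} [Field F] [AddCommGroup V] [Module F V] (P : SymplecticPlane F V)

theorem rhoSp_apply (s₁ s₂ s₃ s₄ : P.sp) (z : (V ⊗[F] V) × (V ⊗[F] V)) :
    P.rhoSp s₁ s₂ s₃ s₄ z = (P.act2 s₁ s₂ z.1, P.act2 s₃ s₄ z.2) := rfl

theorem rhoTensor_apply (a b c d : V) (z : (V ⊗[F] V) × (V ⊗[F] V)) :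
    P.rhoTensor a b c d z =
      (P.tform (c ⊗ₜ d) z.2 • a ⊗ₜ b, -(P.tform (a ⊗ₜ b) z.1 • c ⊗ₜ d)) := rfl

/-- Linear endomorphisms of `S₈` are determined by their values on the elements `(a ⊗ b, 0)` and
`(0, a ⊗ b)`. -/
theorem end8_ext {M : Type*} [AddCommGroup M] [Module F M]
    {f g : (V ⊗[F] V) × (V ⊗[F] V) →ₗ[F] M}
    (h1 : ∀ a b : V, f (a ⊗ₜ b, 0) = g (a ⊗ₜ b, 0))
    (h2 : ∀ a b : V, f (0, a ⊗ₜ b) = g (0, a ⊗ₜ b)) : f = g :=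
  LinearMap.prod_ext (TensorProduct.ext' h1) (TensorProduct.ext' h2)

theorem mul8_left_left (a b a' b' : V) :
    P.mul8 (a ⊗ₜ b, 0) (a' ⊗ₜ b', 0) = (P.form b a' • b' ⊗ₜ a, 0) := by
  simp [mul8, flip]

theorem mul8_right_right (c d c' d' : V) :
    P.mul8 (0, c ⊗ₜ d) (0, c' ⊗ₜ d') = (-(P.form d d' • c ⊗ₜ c'), 0) := by
  simp [mul8, flip]

theorem mul8_left_right (a b c' d' : V) :
    P.mul8 (a ⊗ₜ b, 0) (0, c' ⊗ₜ d') = (0, -(P.form a c' • b ⊗ₜ d')) := by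
  simp [mul8, flip]

theorem mul8_right_left (c d a' b' : V) :
    P.mul8 (0, c ⊗ₜ d) (a' ⊗ₜ b', 0) = (0, -(P.form c b' • a' ⊗ₜ d)) := by
  simp [mul8, flip]

theorem act2_lie (s t s' t' : P.sp) (z : V ⊗[F] V) :
    P.act2 s t (P.act2 s' t' z) - P.act2 s' t' (P.act2 s t z) =
      P.act2 (P.spLie s s') (P.spLie t t') z := by
  have h : ∀ (s t : P.sp) (v : V), (P.spLie s t).1 v = s.1 (t.1 v) - t.1 (s.1 v) :=
    fun _ _ _ => rfl
  induction z using TensorProduct.induction_on with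
  | zero => simp
  | add z z' hz hz' => simp only [map_add, ← hz, ← hz']; abel
  | tmul a b =>
    simp only [act2_tmul, map_add, h, TensorProduct.sub_tmul, TensorProduct.tmul_sub]
    abel

variable [NeZero (2 : F)]

theorem S8_mul (x y : (V ⊗[F] V) × (V ⊗[F] V)) : P.S8.mul x y = P.mul8 x y := rfl

theorem S8_pol (x y : (V ⊗[F] V) × (V ⊗[F] V)) :
    P.S8.pol x y = P.tform x.1 y.1 + P.tform x.2 y.2 := P.polar_norm8 x y

theorem rhoSp_mem_tri (s₁ s₂ s₃ s₄ : P.sp) :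
    ![P.rhoSp s₁ s₂ s₃ s₄, P.rhoSp s₂ s₃ s₁ s₄, P.rhoSp s₃ s₁ s₂ s₄] ∈ P.S8.tri := by
  have skew : ∀ s₁ s₂ s₃ s₄ x y, P.S8.pol (P.rhoSp s₁ s₂ s₃ s₄ x) y +
      P.S8.pol x (P.rhoSp s₁ s₂ s₃ s₄ y) = 0 := by
    intro s₁ s₂ s₃ s₄ x y
    rw [S8_pol, S8_pol, rhoSp_apply, rhoSp_apply]
    linear_combination P.act2_skew s₁ s₂ x.1 y.1 + P.act2_skew s₃ s₄ x.2 y.2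
  refine ⟨fun i x y => ?_, fun x y => ?_⟩
  · fin_cases i <;> exact skew _ _ _ _ x y
  · have : P.mul8.compr₂ (P.rhoSp s₁ s₂ s₃ s₄) =
        P.mul8 ∘ₗ P.rhoSp s₂ s₃ s₁ s₄ + P.mul8.compl₂ (P.rhoSp s₃ s₁ s₂ s₄) := by
      refine end8_ext (fun a b => end8_ext (fun c d => ?_) fun c d => ?_)
        fun a b => end8_ext (fun c d => ?_) fun c d => ?_
      all_goals
        simp only [LinearMap.compr₂_apply, LinearMap.add_apply, LinearMap.comp_apply,
          LinearMap.compl₂_apply, rhoSp_apply, act2_tmul, map_zero]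
        simp only [mul8, flip, LinearMap.mk₂_apply, map_add, map_zero, LinearMap.add_apply,
          LinearMap.zero_apply, LinearEquiv.coe_coe, TensorProduct.comm_tmul, mul4_tmul, map_smul,
          map_neg, map_sub, act2_tmul, sp_skew, neg_smul]
        refine Prod.ext ?_ ?_ <;> simp only [Prod.fst_add, Prod.snd_add] <;> module
    exact LinearMap.congr_fun₂ this x y

/-- The map `sp(V)⁴ → tri(S₈)`. -/
noncomputable def spTri8 : P.sp × P.sp × P.sp × P.sp →ₗ[F] P.S8.tri where
  toFun s := ⟨_, P.rhoSp_mem_tri s.1 s.2.1 s.2.2.1 s.2.2.2⟩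
  map_add' s t := by
    have h : ∀ s₁ s₂ s₃ s₄ t₁ t₂ t₃ t₄, P.rhoSp (s₁ + t₁) (s₂ + t₂) (s₃ + t₃) (s₄ + t₄) =
        P.rhoSp s₁ s₂ s₃ s₄ + P.rhoSp t₁ t₂ t₃ t₄ := by
      intro s₁ s₂ s₃ s₄ t₁ t₂ t₃ t₄
      have e1 := P.act2Lin.map_add (s₁, s₂) (t₁, t₂)
      have e2 := P.act2Lin.map_add (s₃, s₄) (t₃, t₄)
      simp only [Prod.mk_add_mk, act2Lin_apply] at e1 e2
      rw [rhoSp, e1, e2]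
      rfl
    refine Subtype.ext (funext fun k => ?_)
    fin_cases k <;> exact h _ _ _ _ _ _ _ _
  map_smul' c s := by
    have h : ∀ s₁ s₂ s₃ s₄, P.rhoSp (c • s₁) (c • s₂) (c • s₃) (c • s₄) =
        c • P.rhoSp s₁ s₂ s₃ s₄ := by
      intro s₁ s₂ s₃ s₄
      have e1 := P.act2Lin.map_smul c (s₁, s₂)
      have e2 := P.act2Lin.map_smul c (s₃, s₄)
      simp only [Prod.smul_mk, act2Lin_apply] at e1 e2
      rw [rhoSp, e1, e2]
      rfl
    refine Subtype.ext (funext fun k => ?_)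
    fin_cases k <;> exact h _ _ _ _

theorem spTri8_val (s₁ s₂ s₃ s₄ : P.sp) : (P.spTri8 (s₁, s₂, s₃, s₄)).1 =
    ![P.rhoSp s₁ s₂ s₃ s₄, P.rhoSp s₂ s₃ s₁ s₄, P.rhoSp s₃ s₁ s₂ s₄] := rfl

/-- The map `V^{⊗4} → tri(S₈)`, `(a ⊗ b) ⊗ (c ⊗ d) ↦ t_{(0, c ⊗ d), (a ⊗ b, 0)}`. -/
noncomputable def tensorTri8 : (V ⊗[F] V) ⊗[F] (V ⊗[F] V) →ₗ[F] P.S8.tri :=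
  TensorProduct.lift (P.S8.t.compl₁₂ (LinearMap.inr F _ _) (LinearMap.inl F _ _)).flip

theorem tensorTri8_tmul (p r : V ⊗[F] V) :
    P.tensorTri8 (p ⊗ₜ r) = P.S8.t (0, r) (p, 0) := rfl

theorem tensorTri8_zero (p r : V ⊗[F] V) (z : (V ⊗[F] V) × (V ⊗[F] V)) :
    (P.tensorTri8 (p ⊗ₜ r)).1 0 z = (P.tform r z.2 • p, -(P.tform p z.1 • r)) := by
  rw [tensorTri8_tmul]
  change P.S8.tFun (0, r) (p, 0) 0 z = _
  rw [SymmetricComposition.tFun_zero, S8_pol, S8_pol]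
  refine Prod.ext ?_ ?_ <;> simp

/-- The elements of `tri(S₈)` that come from `V^{⊗4}` are `θ`-related in the same way as those
that come from `sp(V)⁴`: the first three indices are rotated. -/
theorem tensorTri8_val (a b c d : V) : (P.tensorTri8 ((a ⊗ₜ b) ⊗ₜ (c ⊗ₜ d))).1 =
    ![P.rhoTensor a b c d, P.rhoTensor b c a d, P.rhoTensor c a b d] := by
  refine funext fun k => ?_
  fin_cases k
  · refine LinearMap.ext fun z => ?_
    exact P.tensorTri8_zero _ _ z
  · have h : ∀ z, (P.tensorTri8 ((a ⊗ₜ b) ⊗ₜ (c ⊗ₜ d))).1 1 z =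
        -P.mul8 (P.mul8 (a ⊗ₜ b, 0) z) (0, c ⊗ₜ d) := by
      intro z
      rw [tensorTri8_tmul]
      change P.S8.tFun _ _ 1 z = _
      rw [SymmetricComposition.tFun_one, S8_pol]
      simp [S8_mul]
    refine end8_ext (fun u v => (h _).trans ?_) fun u v => (h _).trans ?_
    all_goals
      change _ = P.rhoTensor b c a d _
      simp only [mul8, flip, LinearMap.mk₂_apply, rhoTensor_apply, map_zero,
        LinearMap.zero_apply, LinearEquiv.coe_coe, TensorProduct.comm_tmul, mul4_tmul, map_smul,
        map_neg, tform_tmul, LinearMap.smul_apply, sub_zero, neg_zero, zero_sub, zero_smul,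
        LinearMap.neg_apply, Prod.neg_mk, neg_neg, P.form_swap v c, P.form_swap v d]
      refine Prod.ext ?_ ?_ <;> module
  · have h : ∀ z, (P.tensorTri8 ((a ⊗ₜ b) ⊗ₜ (c ⊗ₜ d))).1 2 z =
        -P.mul8 (0, c ⊗ₜ d) (P.mul8 z (a ⊗ₜ b, 0)) := by
      intro z
      rw [tensorTri8_tmul]
      change P.S8.tFun _ _ 2 z = _
      rw [SymmetricComposition.tFun_two, S8_pol]
      simp [S8_mul]
    refine end8_ext (fun u v => (h _).trans ?_) fun u v => (h _).trans ?_
    all_goals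
      change _ = P.rhoTensor c a b d _
      simp only [mul8, flip, LinearMap.mk₂_apply, rhoTensor_apply, map_zero,
        LinearMap.zero_apply, LinearEquiv.coe_coe, TensorProduct.comm_tmul, mul4_tmul, map_smul,
        map_neg, tform_tmul, sub_zero, neg_zero, zero_sub, zero_smul,
        Prod.neg_mk, neg_neg, P.form_swap u b, P.form_swap v a]
      refine Prod.ext ?_ ?_ <;> module

/-- An element of `o(S₈)` commuting with all operators `ρ(a ⊗ b ⊗ c ⊗ d)` vanishes. -/
theorem eq_zero_of_commute_rhoTensor {f : Module.End F ((V ⊗[F] V) × (V ⊗[F] V))}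
    (hf : ∀ x y, P.S8.pol (f x) y + P.S8.pol x (f y) = 0)
    (hc : ∀ a b c d, f * P.rhoTensor a b c d = P.rhoTensor a b c d * f) : f = 0 := by
  have h2 : (2 : F) ≠ 0 := NeZero.ne 2
  obtain ⟨e₁, e₂, he⟩ := P.exists_form_ne_zero
  have hne : P.tform (e₁ ⊗ₜ e₁) (e₂ ⊗ₜ e₂) ≠ 0 := by simpa using he
  have he0 : ∀ u v : V, P.tform (u ⊗ₜ v) (u ⊗ₜ v) = 0 := by
    intro u v
    rw [tform_tmul, P.alt u, zero_mul]
  -- both sides of the commutation relation are linear in the two factors of the tensor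
  have key : ∀ p r z : V ⊗[F] V, P.tform r z • f (p, 0) =
      (P.tform r (f (0, z)).2 • p, -(P.tform p (f (0, z)).1 • r)) := by
    intro p r z
    induction p using TensorProduct.induction_on with
    | zero =>
      rw [Prod.mk_zero_zero, map_zero, smul_zero]
      refine Prod.ext ?_ ?_ <;> simp
    | add p p' hp hp' =>
      have : ((p + p', 0) : (V ⊗[F] V) × (V ⊗[F] V)) = (p, 0) + (p', 0) := by simp
      rw [this, map_add, smul_add, hp, hp']
      simp only [map_add, LinearMap.add_apply, smul_add, add_smul, neg_add, Prod.mk_add_mk]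
    | tmul a b =>
    induction r using TensorProduct.induction_on with
    | zero =>
      rw [map_zero, LinearMap.zero_apply, zero_smul]
      refine Prod.ext ?_ ?_ <;> simp
    | add r r' hr hr' =>
      rw [map_add, LinearMap.add_apply, add_smul, hr, hr']
      simp only [LinearMap.add_apply, smul_add, add_smul, neg_add, Prod.mk_add_mk]
    | tmul c d =>
      have := LinearMap.congr_fun (hc a b c d) (0, z)
      simp only [Module.End.mul_apply, rhoTensor_apply, map_zero, zero_smul, neg_zero] at this
      rw [← this, ← map_smul, Prod.smul_mk, smul_zero]
  have hskew : ∀ x y, P.tform (f x).1 y.1 + P.tform (f x).2 y.2 +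
      (P.tform x.1 (f y).1 + P.tform x.2 (f y).2) = 0 := by
    intro x y
    rw [← S8_pol, ← S8_pol]
    exact hf x y
  set lam := P.tform (e₁ ⊗ₜ e₁) (f (0, e₂ ⊗ₜ e₂)).2 with hlam
  have k1 : ∀ p, P.tform (e₁ ⊗ₜ e₁) (e₂ ⊗ₜ e₂) • (f (p, 0)).1 = lam • p :=
    fun p => congrArg Prod.fst (key p (e₁ ⊗ₜ e₁) (e₂ ⊗ₜ e₂))
  have hl : lam = 0 := by
    have h := hskew (e₁ ⊗ₜ e₁, 0) (e₂ ⊗ₜ e₂, 0)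
    have h1 := congrArg (fun u => P.tform u (e₂ ⊗ₜ e₂)) (k1 (e₁ ⊗ₜ e₁))
    have h2' := congrArg (fun u => P.tform (e₁ ⊗ₜ e₁) u) (k1 (e₂ ⊗ₜ e₂))
    simp only [map_smul, LinearMap.smul_apply, smul_eq_mul, map_zero, LinearMap.zero_apply,
      add_zero] at h h1 h2'
    have : P.tform (e₁ ⊗ₜ e₁) (e₂ ⊗ₜ e₂) * (2 * lam) = 0 := by
      linear_combination P.tform (e₁ ⊗ₜ e₁) (e₂ ⊗ₜ e₂) * h - h1 - h2'
    exact (mul_eq_zero.1 ((mul_eq_zero.1 this).resolve_left hne)).resolve_left h2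
  have f1 : ∀ p, (f (p, 0)).1 = 0 := by
    intro p
    have := k1 p
    rw [hl, zero_smul] at this
    exact (smul_eq_zero.1 this).resolve_left hne
  have f2 : ∀ z, (f (0, z)).2 = 0 := by
    intro z
    refine P.tform_sep fun r => ?_
    have := congrArg Prod.fst (key (e₁ ⊗ₜ e₁) r z)
    rw [Prod.smul_fst, f1, smul_zero] at this
    rw [P.tform_comm]
    refine (smul_eq_zero.1 this.symm).resolve_right fun h0 => hne ?_
    rw [h0, map_zero, LinearMap.zero_apply]
  have f3 : ∀ p u v, P.tform p (f (0, u ⊗ₜ v)).1 = 0 := by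
    intro p u v
    by_cases h0 : u ⊗ₜ[F] v = 0
    · have h0' : ((0, u ⊗ₜ v) : (V ⊗[F] V) × (V ⊗[F] V)) = 0 := by rw [h0]; rfl
      rw [h0', map_zero, Prod.fst_zero, map_zero]
    · have := congrArg Prod.snd (key p (u ⊗ₜ v) (u ⊗ₜ v))
      rw [he0, zero_smul] at this
      exact (smul_eq_zero.1 (neg_eq_zero.1 this.symm)).resolve_right h0
  have f4 : ∀ p, (f (p, 0)).2 = 0 := by
    intro p
    have := congrArg Prod.snd (key p (e₁ ⊗ₜ e₁) (e₂ ⊗ₜ e₂))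
    rw [f3, zero_smul, neg_zero] at this
    exact (smul_eq_zero.1 this).resolve_left hne
  refine end8_ext (fun a b => Prod.ext (f1 _) (f4 _)) fun a b => Prod.ext ?_ (f2 _)
  refine P.tform_sep fun p => ?_
  rw [P.tform_comm]
  exact f3 p a b

/-- An element of `tri(S₈)` is determined by its first component. The other components of an
element with `d₀ = 0` commute with all components of the elements `t_{x,y}`. -/
theorem tri8_ext {d e : P.S8.tri} (h : d.1 0 = e.1 0) : d = e := by
  rw [← sub_eq_zero]
  set g := d - e with hg
  have h0 : g.1 0 = 0 := by
    rw [hg]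
    exact sub_eq_zero.2 h
  have comm : ∀ (k : Fin 3) a b c d, g.1 k * (P.tensorTri8 ((a ⊗ₜ b) ⊗ₜ (c ⊗ₜ d))).1 k =
      (P.tensorTri8 ((a ⊗ₜ b) ⊗ₜ (c ⊗ₜ d))).1 k * g.1 k := by
    intro k a b c d
    have := P.S8.triLie_t g (0, c ⊗ₜ d) (a ⊗ₜ b, 0)
    rw [h0] at this
    simp only [LinearMap.zero_apply, map_zero, add_zero] at this
    have h1 := congrFun (congrArg Subtype.val this) k
    simp only [SymmetricComposition.triLie_val, Pi.sub_apply, Pi.mul_apply,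
      Submodule.coe_zero, Pi.zero_apply] at h1
    rw [tensorTri8_tmul, sub_eq_zero.1 h1]
  refine Subtype.ext (funext fun k => ?_)
  fin_cases k
  · exact h0
  · refine P.eq_zero_of_commute_rhoTensor (g.2.1 1) fun a b c d => ?_
    have := comm 1 c a b d
    rwa [tensorTri8_val] at this
  · refine P.eq_zero_of_commute_rhoTensor (g.2.1 2) fun a b c d => ?_
    have := comm 2 b c a d
    rwa [tensorTri8_val] at this

theorem tensorTri8_left_left (w : (V ⊗[F] V) ⊗[F] (V ⊗[F] V)) (z : V ⊗[F] V) :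
    ((P.tensorTri8 w).1 0 (z, 0)).1 = 0 := by
  induction w using TensorProduct.induction_on with
  | zero => rw [map_zero]; rfl
  | add w w' h h' =>
    rw [map_add, Submodule.coe_add, Pi.add_apply, LinearMap.add_apply, Prod.fst_add, h, h', add_zero]
  | tmul p r => rw [tensorTri8_zero, map_zero, zero_smul]

theorem tensorTri8_right_right (w : (V ⊗[F] V) ⊗[F] (V ⊗[F] V)) (z : V ⊗[F] V) :
    ((P.tensorTri8 w).1 0 (0, z)).2 = 0 := by
  induction w using TensorProduct.induction_on with
  | zero => rw [map_zero]; rfl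
  | add w w' h h' =>
    rw [map_add, Submodule.coe_add, Pi.add_apply, LinearMap.add_apply, Prod.snd_add, h, h', add_zero]
  | tmul p r => rw [tensorTri8_zero, map_zero, zero_smul, neg_zero]

/-- `sp(V)⁴ ⊕ V^{⊗4}` is isomorphic to `tri(S₈)`: an element of `o(S₈)` consists of two elements
of `o(V ⊗ V) = sp(V)²` and a linear map `V ⊗ V → V ⊗ V`, and it determines the element of
`tri(S₈)`. -/
theorem tri8_bijective : Function.Bijective (P.spTri8.coprod P.tensorTri8) := by
  obtain ⟨e, e', he, he'⟩ := P.exists_dual_bases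
  constructor
  · refine (injective_iff_map_eq_zero _).2 ?_
    rintro ⟨⟨s₁, s₂, s₃, s₄⟩, w⟩ h
    rw [LinearMap.coprod_apply] at h
    have h0 : ∀ z, P.rhoSp s₁ s₂ s₃ s₄ z + (P.tensorTri8 w).1 0 z = 0 := fun z =>
      LinearMap.congr_fun (congrFun (congrArg Subtype.val h) 0) z
    have h1 := P.act2_eq_zero (s := s₁) (t := s₂) (LinearMap.ext fun z => by
      have := congrArg Prod.fst (h0 (z, 0))
      rwa [Prod.fst_add, tensorTri8_left_left, add_zero] at this)
    have h2 := P.act2_eq_zero (s := s₃) (t := s₄) (LinearMap.ext fun z => by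
      have := congrArg Prod.snd (h0 (0, z))
      rwa [Prod.snd_add, tensorTri8_right_right, add_zero] at this)
    have hw : w = ∑ i, ((P.tensorTri8 w).1 0 (0, e i)).1 ⊗ₜ e' i := by
      clear h h0
      induction w using TensorProduct.induction_on with
      | zero => simp
      | add w w' h h' =>
        simp only [map_add, Submodule.coe_add, Pi.add_apply, LinearMap.add_apply, Prod.fst_add,
          TensorProduct.add_tmul, Finset.sum_add_distrib]
        rw [← h, ← h']
      | tmul p r =>
        simp only [tensorTri8_zero, TensorProduct.smul_tmul]
        rw [← TensorProduct.tmul_sum, ← he']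
    obtain ⟨rfl, rfl⟩ := h1
    obtain ⟨rfl, rfl⟩ := h2
    have hz : ∀ z, (P.tensorTri8 w).1 0 z = 0 := by
      intro z
      have := h0 z
      rwa [rhoSp_apply, act2_zero_zero, LinearMap.zero_apply, LinearMap.zero_apply,
        Prod.mk_zero_zero, zero_add] at this
    rw [hw]
    simp only [hz, Prod.fst_zero, TensorProduct.zero_tmul, Finset.sum_const_zero]
    rfl
  · intro d
    have skew : ∀ x y, P.tform (d.1 0 x).1 y.1 + P.tform (d.1 0 x).2 y.2 +
        (P.tform x.1 (d.1 0 y).1 + P.tform x.2 (d.1 0 y).2) = 0 := by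
      intro x y
      rw [← S8_pol, ← S8_pol]
      exact d.2.1 0 x y
    obtain ⟨s₁, s₂, h1⟩ := P.exists_act2_eq
      (f := LinearMap.fst F _ _ ∘ₗ d.1 0 ∘ₗ LinearMap.inl F _ _) fun x y => by
        simpa using skew (x, 0) (y, 0)
    obtain ⟨s₃, s₄, h2⟩ := P.exists_act2_eq
      (f := LinearMap.snd F _ _ ∘ₗ d.1 0 ∘ₗ LinearMap.inr F _ _) fun x y => by
        simpa using skew (0, x) (0, y)
    set w := ∑ i, (d.1 0 (0, e i)).1 ⊗ₜ[F] e' i with hw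
    have h3 : ∀ z, ((P.tensorTri8 w).1 0 (0, z)).1 = (d.1 0 (0, z)).1 := by
      intro z
      have e1 : (d.1 0 (0, z)).1 = ∑ i, P.tform (e' i) z • (d.1 0 (0, e i)).1 := by
        have : (d.1 0 (0, z)).1 = (LinearMap.fst F _ _ ∘ₗ d.1 0 ∘ₗ LinearMap.inr F _ _) z := rfl
        rw [this]
        conv_lhs => rw [he z]
        simp
      have e2 : ((P.tensorTri8 w).1 0 (0, z)).1 =
          (LinearMap.fst F _ _ ∘ₗ LinearMap.applyₗ (0, z) ∘ₗ LinearMap.proj 0 ∘ₗ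
            P.S8.tri.subtype ∘ₗ P.tensorTri8) w := rfl
      rw [e1, e2, hw, map_sum]
      refine Finset.sum_congr rfl fun i _ => ?_
      exact congrArg Prod.fst (P.tensorTri8_zero _ _ (0, z))
    refine ⟨((s₁, s₂, s₃, s₄), w), P.tri8_ext ?_⟩
    rw [LinearMap.coprod_apply]
    -- the difference of the two first components is skew, and only its block `V ⊗ V → V ⊗ V`
    -- from the first to the second summand remains
    set g := P.spTri8 (s₁, s₂, s₃, s₄) + P.tensorTri8 w with hg
    have hz : ∀ z, g.1 0 z = P.rhoSp s₁ s₂ s₃ s₄ z + (P.tensorTri8 w).1 0 z := fun z => rfl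
    have g1 : ∀ z, g.1 0 (0, z) = d.1 0 (0, z) := by
      intro z
      rw [hz]
      refine Prod.ext ?_ ?_
      · rw [Prod.fst_add, h3, rhoSp_apply, map_zero, zero_add]
      · rw [Prod.snd_add, tensorTri8_right_right, add_zero]
        exact (LinearMap.congr_fun h2 z).symm
    refine end8_ext (fun a b => Prod.ext ?_ ?_) fun a b => g1 _
    · rw [hz, Prod.fst_add, tensorTri8_left_left, add_zero]
      exact (LinearMap.congr_fun h1 _).symm
    · refine P.tensor_ext fun u v => ?_
      have e1 := g.2.1 0 (a ⊗ₜ b, 0) (0, u ⊗ₜ v)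
      have e2 := d.2.1 0 (a ⊗ₜ b, 0) (0, u ⊗ₜ v)
      rw [S8_pol, S8_pol] at e1 e2
      rw [g1] at e1
      simp only [map_zero, LinearMap.zero_apply, zero_add, add_zero] at e1 e2
      linear_combination e1 - e2

/-! ### Brackets in the triality Lie algebras -/

theorem t8_left_left (a b c d : V) : P.S8.t (a ⊗ₜ b, 0) (c ⊗ₜ d, 0) =
    (2⁻¹ * P.form b d) • P.spTri8 (P.gamma a c, 0, 0, 0) +
      (2⁻¹ * P.form a c) • P.spTri8 (0, P.gamma b d, 0, 0) := by
  refine P.tri8_ext (LinearMap.ext fun z => ?_)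
  change P.S8.tFun _ _ 0 z = (2⁻¹ * P.form b d) • P.rhoSp (P.gamma a c) 0 0 0 z +
    (2⁻¹ * P.form a c) • P.rhoSp 0 (P.gamma b d) 0 0 z
  rw [SymmetricComposition.tFun_zero, S8_pol, S8_pol, rhoSp_apply, rhoSp_apply, act2_zero_zero]
  refine Prod.ext ?_ ?_
  · simpa using P.sigma_tmul a b c d z.1
  · simp

theorem t8_right_right (a b c d : V) : P.S8.t (0, a ⊗ₜ b) (0, c ⊗ₜ d) =
    (2⁻¹ * P.form b d) • P.spTri8 (0, 0, P.gamma a c, 0) +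
      (2⁻¹ * P.form a c) • P.spTri8 (0, 0, 0, P.gamma b d) := by
  refine P.tri8_ext (LinearMap.ext fun z => ?_)
  change P.S8.tFun _ _ 0 z = (2⁻¹ * P.form b d) • P.rhoSp 0 0 (P.gamma a c) 0 z +
    (2⁻¹ * P.form a c) • P.rhoSp 0 0 0 (P.gamma b d) z
  rw [SymmetricComposition.tFun_zero, S8_pol, S8_pol, rhoSp_apply, rhoSp_apply, act2_zero_zero]
  refine Prod.ext ?_ ?_
  · simp
  · simpa using P.sigma_tmul a b c d z.2

theorem t8_right_left (a b c d : V) :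
    P.S8.t (0, c ⊗ₜ d) (a ⊗ₜ b, 0) = P.tensorTri8 ((a ⊗ₜ b) ⊗ₜ (c ⊗ₜ d)) := rfl

theorem theta_spTri4 (s₁ s₂ s₃ : P.sp) :
    P.S4.theta (P.spTri4 (s₁, s₂, s₃)) = P.spTri4 (s₃, s₁, s₂) := rfl

theorem theta_spTri8 (s₁ s₂ s₃ s₄ : P.sp) :
    P.S8.theta (P.spTri8 (s₁, s₂, s₃, s₄)) = P.spTri8 (s₃, s₁, s₂, s₄) := rfl

theorem theta_tensorTri8 (a b c d : V) :
    P.S8.theta (P.tensorTri8 ((a ⊗ₜ b) ⊗ₜ (c ⊗ₜ d))) = P.tensorTri8 ((c ⊗ₜ a) ⊗ₜ (b ⊗ₜ d)) := by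
  refine P.tri8_ext ?_
  change (P.tensorTri8 ((a ⊗ₜ b) ⊗ₜ (c ⊗ₜ d))).1 2 = _
  rw [tensorTri8_val, tensorTri8_val]
  rfl

theorem triLie_spTri4 (s₁ s₂ s₃ t₁ t₂ t₃ : P.sp) :
    P.S4.triLie (P.spTri4 (s₁, s₂, s₃)) (P.spTri4 (t₁, t₂, t₃)) =
      P.spTri4 (P.spLie s₁ t₁, P.spLie s₂ t₂, P.spLie s₃ t₃) := by
  refine Subtype.ext (funext fun k => LinearMap.ext fun z => ?_)
  fin_cases k <;> exact P.act2_lie _ _ _ _ z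

theorem triLie_spTri8 (s₁ s₂ s₃ s₄ t₁ t₂ t₃ t₄ : P.sp) :
    P.S8.triLie (P.spTri8 (s₁, s₂, s₃, s₄)) (P.spTri8 (t₁, t₂, t₃, t₄)) =
      P.spTri8 (P.spLie s₁ t₁, P.spLie s₂ t₂, P.spLie s₃ t₃, P.spLie s₄ t₄) := by
  refine P.tri8_ext (LinearMap.ext fun z => ?_)
  exact Prod.ext (P.act2_lie _ _ _ _ z.1) (P.act2_lie _ _ _ _ z.2)

theorem triLie_spTri8_tensorTri8 (s₁ s₂ s₃ s₄ : P.sp) (a b c d : V) :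
    P.S8.triLie (P.spTri8 (s₁, s₂, s₃, s₄)) (P.tensorTri8 ((a ⊗ₜ b) ⊗ₜ (c ⊗ₜ d))) =
      P.tensorTri8 ((s₁.1 a ⊗ₜ b) ⊗ₜ (c ⊗ₜ d)) + P.tensorTri8 ((a ⊗ₜ s₂.1 b) ⊗ₜ (c ⊗ₜ d)) +
        (P.tensorTri8 ((a ⊗ₜ b) ⊗ₜ (s₃.1 c ⊗ₜ d)) +
          P.tensorTri8 ((a ⊗ₜ b) ⊗ₜ (c ⊗ₜ s₄.1 d))) := by
  have h1 : (P.spTri8 (s₁, s₂, s₃, s₄)).1 0 (0, c ⊗ₜ d) = (0, P.act2 s₃ s₄ (c ⊗ₜ d)) := by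
    exact Prod.ext (map_zero (P.act2 s₁ s₂)) rfl
  have h2 : (P.spTri8 (s₁, s₂, s₃, s₄)).1 0 (a ⊗ₜ b, 0) = (P.act2 s₁ s₂ (a ⊗ₜ b), 0) := by
    exact Prod.ext rfl (map_zero (P.act2 s₃ s₄))
  rw [tensorTri8_tmul, SymmetricComposition.triLie_t, h1, h2, ← tensorTri8_tmul,
    ← tensorTri8_tmul, act2_tmul, act2_tmul, TensorProduct.add_tmul, TensorProduct.tmul_add,
    map_add, map_add, add_comm]

/-- As `w = p ⊗ r` corresponds to `t_{(0,r),(p,0)}`, the bracket of two such elements is obtained by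
letting the first one act on the indices of the second one. -/
theorem triLie_tensorTri8 (p r p' r' : V ⊗[F] V) :
    P.S8.triLie (P.tensorTri8 (p ⊗ₜ r)) (P.tensorTri8 (p' ⊗ₜ r')) =
      P.tform r r' • P.S8.t (p, 0) (p', 0) + P.tform p p' • P.S8.t (0, r) (0, r') := by
  have h1 : (P.tensorTri8 (p ⊗ₜ r)).1 0 (0, r') = P.tform r r' • (p, 0) := by
    rw [tensorTri8_zero]
    refine Prod.ext ?_ ?_ <;> simp
  have h2 : (P.tensorTri8 (p ⊗ₜ r)).1 0 (p', 0) = -(P.tform p p' • (0, r)) := by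
    rw [tensorTri8_zero]
    refine Prod.ext ?_ ?_ <;> simp
  rw [tensorTri8_tmul P p', SymmetricComposition.triLie_t, h1, h2, map_smul, map_neg, map_smul,
    LinearMap.smul_apply, P.S8.neg_smul_t]

end SymplecticPlane

/-! ### The modules `V(σ)` for four-element `σ` -/

namespace SymplecticPlane

open MagicModels

variable {F V : Type*} [Field F] [AddCommGroup V] [Module F V]

/-- The enumeration of a four-element set `σ = {i, j, k, l}` by two ordered pairs. -/
noncomputable def quadEnum {σ : Finset ℕ} {i j k l : ℕ} (h : {i, j, k, l} = σ) (hc : σ.card = 4) :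
    ((Unit ⊕ Unit) ⊕ (Unit ⊕ Unit)) ≃ σ :=
  Equiv.ofBijective
    (Sum.elim
      (Sum.elim (fun _ => ⟨i, by simp [← h]⟩) fun _ => ⟨j, by simp [← h]⟩)
      (Sum.elim (fun _ => ⟨k, by simp [← h]⟩) fun _ => ⟨l, by simp [← h]⟩)) <| by
    refine (Fintype.bijective_iff_surjective_and_card _).2 ⟨?_, by simp [hc]⟩
    rintro ⟨x, hx⟩
    have hx' := hx
    rw [← h] at hx'
    simp only [Finset.mem_insert, Finset.mem_singleton] at hx'
    rcases hx' with rfl | rfl | rfl | rfl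
    exacts [⟨.inl (.inl ()), rfl⟩, ⟨.inl (.inr ()), rfl⟩, ⟨.inr (.inl ()), rfl⟩,
      ⟨.inr (.inr ()), rfl⟩]

variable (F V) in
/-- A tensor product indexed by two points is `V ⊗ V`. -/
noncomputable def pairEquiv : (⨂[F] _ : Unit ⊕ Unit, V) ≃ₗ[F] V ⊗[F] V :=
  (PiTensorProduct.tmulEquiv F V).symm.trans
    (TensorProduct.congr (PiTensorProduct.subsingletonEquiv (s := fun _ => V) ())
      (PiTensorProduct.subsingletonEquiv (s := fun _ => V) ()))

theorem pairEquiv_tprod (v : Unit ⊕ Unit → V) :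
    pairEquiv F V (PiTensorProduct.tprod F v) = v (.inl ()) ⊗ₜ v (.inr ()) := by
  simp [pairEquiv]

/-- For `σ = {i, j, k, l}` the natural isomorphism of `⨂_σ V` with
`(V_i ⊗ V_j) ⊗ (V_k ⊗ V_l)`. -/
noncomputable def quadTensor {σ : Finset ℕ} {i j k l : ℕ} (h : {i, j, k, l} = σ)
    (hc : σ.card = 4) : (⨂[F] _ : σ, V) ≃ₗ[F] (V ⊗[F] V) ⊗[F] (V ⊗[F] V) :=
  (PiTensorProduct.reindex F (fun _ => V) (quadEnum h hc).symm).trans <|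
    (PiTensorProduct.tmulEquiv F V).symm.trans <|
      TensorProduct.congr (pairEquiv F V) (pairEquiv F V)

theorem quadTensor_tprod {σ : Finset ℕ} {i j k l : ℕ} (h : {i, j, k, l} = σ) (hc : σ.card = 4)
    (v : ℕ → V) : quadTensor (F := F) h hc (PiTensorProduct.tprod F fun i : σ => v i) =
      (v i ⊗ₜ v j) ⊗ₜ (v k ⊗ₜ v l) := by
  simp only [quadTensor, LinearEquiv.trans_apply]
  rw [PiTensorProduct.reindex_tprod, PiTensorProduct.tmulEquiv_symm_apply,
    TensorProduct.congr_tmul, pairEquiv_tprod, pairEquiv_tprod]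
  rfl

variable (P : SymplecticPlane F V)

/-- For `σ = {i, j, k, l}` the natural isomorphism of `V(σ)` with
`(V_i ⊗ V_j) ⊗ (V_k ⊗ V_l)`. -/
noncomputable def quad (N σ : Finset ℕ) (i j k l : ℕ) (h : {i, j, k, l} = σ ∧ σ.card = 4) :
    P.VMod N σ ≃ₗ[F] (V ⊗[F] V) ⊗[F] (V ⊗[F] V) :=
  (P.tensorEquiv N (by rintro rfl; simp at h)).trans (quadTensor h.1 h.2)

theorem quad_pureTensor (N σ : Finset ℕ) (i j k l : ℕ) (h : {i, j, k, l} = σ ∧ σ.card = 4)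
    (v : ℕ → V) : P.quad N σ i j k l h (P.pureTensor N σ v) = (v i ⊗ₜ v j) ⊗ₜ (v k ⊗ₜ v l) :=
  quadTensor_tprod h.1 h.2 v

/-- The component in `V(σ)` of an element of `⨁_{σ ∈ 𝒮} V(σ)`. -/
noncomputable def comp (N : Finset ℕ) (𝒮 : Finset (Finset ℕ)) (σ : Finset ℕ) :
    P.Model N 𝒮 →ₗ[F] P.VMod N σ :=
  if h : σ ∈ 𝒮 then DirectSum.component F 𝒮 (fun σ : 𝒮 => P.VMod N σ) ⟨σ, h⟩ else 0

theorem comp_inc_self (N : Finset ℕ) {𝒮 : Finset (Finset ℕ)} {σ : Finset ℕ} (h : σ ∈ 𝒮)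
    (x : P.VMod N σ) : P.comp N 𝒮 σ (P.inc N 𝒮 σ x) = x := by
  rw [comp, inc, dif_pos h, dif_pos h, DirectSum.component.lof_self]

theorem comp_inc_of_ne (N : Finset ℕ) {𝒮 : Finset (Finset ℕ)} {σ τ : Finset ℕ} (h : σ ≠ τ)
    (x : P.VMod N τ) : P.comp N 𝒮 σ (P.inc N 𝒮 τ x) = 0 := by
  rw [comp, inc]
  split_ifs with h1 h2
  · rw [DirectSum.component.of, dif_neg]
    exact fun h' => h (congrArg Subtype.val h').symm
  all_goals simp

theorem model_ext {N : Finset ℕ} {𝒮 : Finset (Finset ℕ)} {M : Type*} [AddCommGroup M] [Module F M]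
    {f g : P.Model N 𝒮 →ₗ[F] M} (h : ∀ σ ∈ 𝒮, ∀ x, f (P.inc N 𝒮 σ x) = g (P.inc N 𝒮 σ x)) :
    f = g := by
  refine DirectSum.linearMap_ext F fun σ => LinearMap.ext fun x => ?_
  have := h σ σ.2 x
  rwa [inc, dif_pos σ.2] at this

/-- The component of index `i` of the part `sp(V)^N` of `⨁_{σ ∈ 𝒮} V(σ)`. -/
noncomputable def spComp (N : Finset ℕ) (𝒮 : Finset (Finset ℕ)) (i : ℕ) :
    P.Model N 𝒮 →ₗ[F] P.sp :=
  P.spAt N i ∘ₗ (P.spEquiv N rfl).toLinearMap ∘ₗ P.comp N 𝒮 ∅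

theorem spComp_inc_ofSp (N : Finset ℕ) {𝒮 : Finset (Finset ℕ)} (h : ∅ ∈ 𝒮) (i : ℕ)
    (s : N → P.sp) : P.spComp N 𝒮 i (P.inc N 𝒮 ∅ (P.ofSp N s)) = P.spAt N i s := by
  rw [spComp, LinearMap.comp_apply, LinearMap.comp_apply, P.comp_inc_self N h]
  rfl

theorem spComp_inc_of_ne (N : Finset ℕ) {𝒮 : Finset (Finset ℕ)} (i : ℕ) {σ : Finset ℕ}
    (h : σ ≠ ∅) (x : P.VMod N σ) : P.spComp N 𝒮 i (P.inc N 𝒮 σ x) = 0 := by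
  rw [spComp, LinearMap.comp_apply, LinearMap.comp_apply, P.comp_inc_of_ne N h.symm, map_zero,
    map_zero]

theorem spAt_nu_self (N : Finset ℕ) {i : ℕ} (h : i ∈ N) (s : P.sp) :
    P.spAt N i (P.nu N i s) = s := by
  simp [spAt, nu, h]

theorem spAt_nu_of_ne (N : Finset ℕ) {i j : ℕ} (h : i ≠ j) (s : P.sp) :
    P.spAt N i (P.nu N j s) = 0 := by
  rw [spAt]
  split_ifs with hi
  · simp [nu, h]
  · rfl

/-! ### The isomorphism `Φ` for `𝔢₇` -/

variable (F V) in
/-- Four copies of `V`, grouped in two pairs. -/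
abbrev W : Type _ := (V ⊗[F] V) ⊗[F] (V ⊗[F] V)

/-- The coordinates on the model of `𝔢₇`. -/
noncomputable def coordE7 : P.Model N7 SE7 →ₗ[F]
    (((P.sp × P.sp × P.sp × P.sp) × W F V) × (P.sp × P.sp × P.sp)) ×
      (Fin 3 → W F V × W F V) :=
  LinearMap.prod
    (LinearMap.prod
      (LinearMap.prod
        (LinearMap.prod (P.spComp _ _ 1) <| LinearMap.prod (P.spComp _ _ 2) <|
          LinearMap.prod (P.spComp _ _ 3) (P.spComp _ _ 4))
        ((P.quad N7 {1, 2, 3, 4} 1 2 3 4 (by decide)).toLinearMap ∘ₗ P.comp _ _ _))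
      (LinearMap.prod (P.spComp _ _ 5) <| LinearMap.prod (P.spComp _ _ 6) (P.spComp _ _ 7)))
    (LinearMap.pi ![
      LinearMap.prod ((P.quad N7 {1, 2, 5, 6} 1 2 5 6 (by decide)).toLinearMap ∘ₗ P.comp _ _ _)
        ((P.quad N7 {3, 4, 5, 6} 3 4 5 6 (by decide)).toLinearMap ∘ₗ P.comp _ _ _),
      LinearMap.prod ((P.quad N7 {2, 3, 6, 7} 2 3 6 7 (by decide)).toLinearMap ∘ₗ P.comp _ _ _)
        ((P.quad N7 {1, 4, 6, 7} 1 4 6 7 (by decide)).toLinearMap ∘ₗ P.comp _ _ _),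
      LinearMap.prod ((P.quad N7 {1, 3, 5, 7} 3 1 7 5 (by decide)).toLinearMap ∘ₗ
          P.comp _ _ _)
        ((P.quad N7 {2, 4, 5, 7} 2 4 7 5 (by decide)).toLinearMap ∘ₗ P.comp _ _ _)])

/-- The element of the model of `𝔢₇` with given coordinates. -/
noncomputable def ofCoordE7 : ((((P.sp × P.sp × P.sp × P.sp) × W F V) × (P.sp × P.sp × P.sp)) ×
      (Fin 3 → W F V × W F V)) → P.Model N7 SE7 := fun y =>
  P.inc N7 SE7 ∅ (P.ofSp N7 (P.nu N7 1 y.1.1.1.1 + P.nu N7 2 y.1.1.1.2.1 +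
    P.nu N7 3 y.1.1.1.2.2.1 + P.nu N7 4 y.1.1.1.2.2.2 + P.nu N7 5 y.1.2.1 + P.nu N7 6 y.1.2.2.1 +
    P.nu N7 7 y.1.2.2.2)) +
  P.inc N7 SE7 _ ((P.quad N7 {1, 2, 3, 4} 1 2 3 4 (by decide)).symm y.1.1.2) +
  P.inc N7 SE7 _ ((P.quad N7 {1, 2, 5, 6} 1 2 5 6 (by decide)).symm (y.2 0).1) +
  P.inc N7 SE7 _ ((P.quad N7 {3, 4, 5, 6} 3 4 5 6 (by decide)).symm (y.2 0).2) +
  P.inc N7 SE7 _ ((P.quad N7 {2, 3, 6, 7} 2 3 6 7 (by decide)).symm (y.2 1).1) +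
  P.inc N7 SE7 _ ((P.quad N7 {1, 4, 6, 7} 1 4 6 7 (by decide)).symm (y.2 1).2) +
  P.inc N7 SE7 _ ((P.quad N7 {1, 3, 5, 7} 3 1 7 5 (by decide)).symm (y.2 2).1) +
  P.inc N7 SE7 _ ((P.quad N7 {2, 4, 5, 7} 2 4 7 5 (by decide)).symm (y.2 2).2)

theorem comp_empty_eq_zero (N : Finset ℕ) {𝒮 : Finset (Finset ℕ)} {x : P.Model N 𝒮}
    (h : ∀ i ∈ N, P.spComp N 𝒮 i x = 0) : P.comp N 𝒮 ∅ x = 0 := by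
  refine (P.spEquiv N rfl).map_eq_zero_iff.1 (funext fun i => ?_)
  have := h i i.2
  rw [spComp, spAt, dif_pos i.2] at this
  exact this

theorem model_eq_zero {N : Finset ℕ} {𝒮 : Finset (Finset ℕ)} {x : P.Model N 𝒮}
    (h : ∀ σ ∈ 𝒮, P.comp N 𝒮 σ x = 0) : x = 0 := by
  refine DirectSum.ext_component F fun σ => ?_
  have := h σ σ.2
  rw [comp, dif_pos σ.2] at this
  rw [map_zero]
  exact this

theorem coordE7_surjective : Function.Surjective P.coordE7 := by
  intro y
  refine ⟨P.ofCoordE7 y, ?_⟩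
  obtain ⟨⟨⟨⟨s1, s2, s3, s4⟩, w⟩, s5, s6, s7⟩, u⟩ := y
  have h0 : ∅ ∈ SE7 := by decide
  have hs : ∀ i, P.spComp N7 SE7 i (P.ofCoordE7 (((((s1, s2, s3, s4), w), s5, s6, s7), u))) =
      P.spAt N7 i (P.nu N7 1 s1 + P.nu N7 2 s2 + P.nu N7 3 s3 + P.nu N7 4 s4 + P.nu N7 5 s5 +
        P.nu N7 6 s6 + P.nu N7 7 s7) := by
    intro i
    simp (decide := true) only [ofCoordE7, map_add, P.spComp_inc_ofSp N7 h0, spComp_inc_of_ne,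
      ne_eq, add_zero]
  have hq : ∀ (σ : Finset ℕ) i j k l (h : {i, j, k, l} = σ ∧ σ.card = 4) z y,
      P.comp N7 SE7 σ z = (P.quad N7 σ i j k l h).symm y →
      P.quad N7 σ i j k l h (P.comp N7 SE7 σ z) = y := by
    intro σ i j k l h z y hy
    rw [hy, LinearEquiv.apply_symm_apply]
  refine Prod.ext (Prod.ext (Prod.ext (Prod.ext ?_ <| Prod.ext ?_ <| Prod.ext ?_ ?_) ?_) <|
    Prod.ext ?_ <| Prod.ext ?_ ?_) (funext fun k => ?_)
  iterate 4
    refine (hs _).trans ?_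
    simp (decide := true) only [map_add, spAt_nu_self, spAt_nu_of_ne, ne_eq, add_zero, zero_add]
  · refine hq _ _ _ _ _ (by decide) _ _ ?_
    simp (decide := true) only [ofCoordE7, map_add, comp_inc_self, comp_inc_of_ne, ne_eq, add_zero,
      zero_add]
  iterate 3
    refine (hs _).trans ?_
    simp (decide := true) only [map_add, spAt_nu_self, spAt_nu_of_ne, ne_eq, add_zero, zero_add]
  · fin_cases k <;> refine Prod.ext ?_ ?_ <;> refine hq _ _ _ _ _ (by decide) _ _ ?_ <;>
    simp (decide := true) only [ofCoordE7, map_add, comp_inc_self, comp_inc_of_ne, ne_eq, add_zero,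
      zero_add] <;> rfl

theorem coordE7_injective : Function.Injective P.coordE7 := by
  refine (injective_iff_map_eq_zero P.coordE7).2 fun x hx => ?_
  have h1 := congrArg (fun y => y.1.1.1) hx
  have h2 := congrArg (fun y => y.1.2) hx
  have h3 := congrArg (fun y => y.1.1.2) hx
  have h4 := congrArg (fun y => y.2) hx
  refine P.model_eq_zero ?_
  simp only [SE7, Finset.mem_insert, Finset.mem_singleton]
  rintro σ (rfl | rfl | rfl | rfl | rfl | rfl | rfl | rfl)
  · refine P.comp_empty_eq_zero N7 ?_
    simp only [N7, Finset.mem_insert, Finset.mem_singleton]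
    rintro i (rfl | rfl | rfl | rfl | rfl | rfl | rfl)
    exacts [congrArg (·.1) h1, congrArg (·.2.1) h1, congrArg (·.2.2.1) h1, congrArg (·.2.2.2) h1,
      congrArg (·.1) h2, congrArg (·.2.1) h2, congrArg (·.2.2) h2]
  · exact (P.quad N7 {1, 2, 5, 6} 1 2 5 6 (by decide)).map_eq_zero_iff.1 (congrArg (fun u => (u 0).1) h4)
  · exact (P.quad N7 {2, 3, 6, 7} 2 3 6 7 (by decide)).map_eq_zero_iff.1 (congrArg (fun u => (u 1).1) h4)
  · exact (P.quad N7 {1, 3, 5, 7} 3 1 7 5 (by decide)).map_eq_zero_iff.1 (congrArg (fun u => (u 2).1) h4)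
  · exact (P.quad N7 {1, 2, 3, 4} 1 2 3 4 (by decide)).map_eq_zero_iff.1 h3
  · exact (P.quad N7 {3, 4, 5, 6} 3 4 5 6 (by decide)).map_eq_zero_iff.1 (congrArg (fun u => (u 0).2) h4)
  · exact (P.quad N7 {1, 4, 6, 7} 1 4 6 7 (by decide)).map_eq_zero_iff.1 (congrArg (fun u => (u 1).2) h4)
  · exact (P.quad N7 {2, 4, 5, 7} 2 4 7 5 (by decide)).map_eq_zero_iff.1 (congrArg (fun u => (u 2).2) h4)

theorem prodLeft_symm_apply (u w : W F V) :
    (TensorProduct.prodLeft F F (V ⊗[F] V) (V ⊗[F] V) (V ⊗[F] V)).symm (u, w) =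
      LinearMap.rTensor (V ⊗[F] V) (LinearMap.inl F (V ⊗[F] V) (V ⊗[F] V)) u +
        LinearMap.rTensor (V ⊗[F] V) (LinearMap.inr F (V ⊗[F] V) (V ⊗[F] V)) w := by
  have h1 : (TensorProduct.prodLeft F F (V ⊗[F] V) (V ⊗[F] V) (V ⊗[F] V)).toLinearMap ∘ₗ
      LinearMap.rTensor (V ⊗[F] V) (LinearMap.inl F (V ⊗[F] V) (V ⊗[F] V)) =
      LinearMap.inl F _ _ := TensorProduct.ext' fun a b => by simp
  have h2 : (TensorProduct.prodLeft F F (V ⊗[F] V) (V ⊗[F] V) (V ⊗[F] V)).toLinearMap ∘ₗ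
      LinearMap.rTensor (V ⊗[F] V) (LinearMap.inr F (V ⊗[F] V) (V ⊗[F] V)) =
      LinearMap.inr F _ _ := TensorProduct.ext' fun a b => by simp
  rw [LinearEquiv.symm_apply_eq, map_add]
  refine (Prod.ext ?_ ?_ : (u, w) = ((u, 0) : W F V × W F V) + (0, w)).trans
    (congrArg₂ (· + ·) (LinearMap.congr_fun h1 u).symm (LinearMap.congr_fun h2 w).symm)
  · exact (add_zero u).symm
  · exact (zero_add w).symm

variable [NeZero (2 : F)]

/-- The natural identification of the model of `𝔢₇` with `𝔢₇`. -/
noncomputable def equivE7 : P.Model N7 SE7 ≃ₗ[F] P.E7 :=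
  (LinearEquiv.ofBijective P.coordE7 ⟨P.coordE7_injective, P.coordE7_surjective⟩).trans <|
    ((LinearEquiv.ofBijective _ P.tri8_bijective).prodCongr
      (LinearEquiv.ofBijective _ P.spTri4_bijective)).prodCongr
        (LinearEquiv.piCongrRight fun _ => (TensorProduct.prodLeft F F _ _ _).symm)

theorem equivE7_apply (x : P.Model N7 SE7) : P.equivE7 x =
    MagicAlg.triIncl P.S8 P.S4
      (P.spTri8 (P.spComp N7 SE7 1 x, P.spComp N7 SE7 2 x, P.spComp N7 SE7 3 x,
          P.spComp N7 SE7 4 x) +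
        P.tensorTri8 (P.quad N7 {1, 2, 3, 4} 1 2 3 4 (by decide) (P.comp N7 SE7 _ x)),
      P.spTri4 (P.spComp N7 SE7 5 x, P.spComp N7 SE7 6 x, P.spComp N7 SE7 7 x)) +
    MagicAlg.iota P.S8 P.S4 0
      (LinearMap.rTensor _ (LinearMap.inl F _ _) (P.quad N7 {1, 2, 5, 6} 1 2 5 6 (by decide) (P.comp N7 SE7 _ x)) +
      LinearMap.rTensor _ (LinearMap.inr F _ _) (P.quad N7 {3, 4, 5, 6} 3 4 5 6 (by decide) (P.comp N7 SE7 _ x))) +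
    MagicAlg.iota P.S8 P.S4 1
      (LinearMap.rTensor _ (LinearMap.inl F _ _) (P.quad N7 {2, 3, 6, 7} 2 3 6 7 (by decide) (P.comp N7 SE7 _ x)) +
      LinearMap.rTensor _ (LinearMap.inr F _ _) (P.quad N7 {1, 4, 6, 7} 1 4 6 7 (by decide) (P.comp N7 SE7 _ x))) +
    MagicAlg.iota P.S8 P.S4 2
      (LinearMap.rTensor _ (LinearMap.inl F _ _)
        (P.quad N7 {1, 3, 5, 7} 3 1 7 5 (by decide) (P.comp N7 SE7 _ x)) +
      LinearMap.rTensor _ (LinearMap.inr F _ _)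
        (P.quad N7 {2, 4, 5, 7} 2 4 7 5 (by decide) (P.comp N7 SE7 _ x))) := by
  simp only [← prodLeft_symm_apply]
  refine Prod.ext ?_ (funext fun k => ?_)
  · simp only [MagicAlg.triIncl_apply, MagicAlg.iota_apply, Prod.fst_add, add_zero]
    rfl
  · fin_cases k <;>
    · simp [MagicAlg.triIncl_apply, MagicAlg.iota_apply]
      rfl

theorem equivE7_sp (s : N7 → P.sp) : P.equivE7 (P.inc N7 SE7 ∅ (P.ofSp N7 s)) =
    MagicAlg.triIncl P.S8 P.S4
      (P.spTri8 (P.spAt N7 1 s, P.spAt N7 2 s, P.spAt N7 3 s, P.spAt N7 4 s),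
        P.spTri4 (P.spAt N7 5 s, P.spAt N7 6 s, P.spAt N7 7 s)) := by
  have h0 : ∅ ∈ SE7 := by decide
  rw [equivE7_apply]
  simp (decide := true) only [P.spComp_inc_ofSp N7 h0, comp_inc_of_ne, ne_eq, map_zero, add_zero]

theorem equivE7_1234 (x : P.VMod N7 {1, 2, 3, 4}) : P.equivE7 (P.inc N7 SE7 {1, 2, 3, 4} x) =
    MagicAlg.triIncl P.S8 P.S4 (P.tensorTri8 (P.quad N7 {1, 2, 3, 4} 1 2 3 4 (by decide) x), 0) := by
  rw [equivE7_apply]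
  simp (decide := true) only [spComp_inc_of_ne, comp_inc_self, comp_inc_of_ne, ne_eq, map_zero,
    add_zero, Prod.mk_zero_zero, zero_add]

theorem equivE7_1256 (x : P.VMod N7 {1, 2, 5, 6}) : P.equivE7 (P.inc N7 SE7 {1, 2, 5, 6} x) =
    MagicAlg.iota P.S8 P.S4 0
      (LinearMap.rTensor _ (LinearMap.inl F _ _) (P.quad N7 {1, 2, 5, 6} 1 2 5 6 (by decide) x)) := by
  rw [equivE7_apply]
  simp (decide := true) only [spComp_inc_of_ne, comp_inc_self, comp_inc_of_ne, ne_eq, map_zero,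
    add_zero, Prod.mk_zero_zero, zero_add]

theorem equivE7_3456 (x : P.VMod N7 {3, 4, 5, 6}) : P.equivE7 (P.inc N7 SE7 {3, 4, 5, 6} x) =
    MagicAlg.iota P.S8 P.S4 0
      (LinearMap.rTensor _ (LinearMap.inr F _ _) (P.quad N7 {3, 4, 5, 6} 3 4 5 6 (by decide) x)) := by
  rw [equivE7_apply]
  simp (decide := true) only [spComp_inc_of_ne, comp_inc_self, comp_inc_of_ne, ne_eq, map_zero,
    add_zero, Prod.mk_zero_zero, zero_add]

theorem equivE7_2367 (x : P.VMod N7 {2, 3, 6, 7}) : P.equivE7 (P.inc N7 SE7 {2, 3, 6, 7} x) =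
    MagicAlg.iota P.S8 P.S4 1
      (LinearMap.rTensor _ (LinearMap.inl F _ _) (P.quad N7 {2, 3, 6, 7} 2 3 6 7 (by decide) x)) := by
  rw [equivE7_apply]
  simp (decide := true) only [spComp_inc_of_ne, comp_inc_self, comp_inc_of_ne, ne_eq, map_zero,
    add_zero, Prod.mk_zero_zero, zero_add]

theorem equivE7_1467 (x : P.VMod N7 {1, 4, 6, 7}) : P.equivE7 (P.inc N7 SE7 {1, 4, 6, 7} x) =
    MagicAlg.iota P.S8 P.S4 1
      (LinearMap.rTensor _ (LinearMap.inr F _ _) (P.quad N7 {1, 4, 6, 7} 1 4 6 7 (by decide) x)) := by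
  rw [equivE7_apply]
  simp (decide := true) only [spComp_inc_of_ne, comp_inc_self, comp_inc_of_ne, ne_eq, map_zero,
    add_zero, Prod.mk_zero_zero, zero_add]

theorem equivE7_1357 (x : P.VMod N7 {1, 3, 5, 7}) : P.equivE7 (P.inc N7 SE7 {1, 3, 5, 7} x) =
    MagicAlg.iota P.S8 P.S4 2
      (LinearMap.rTensor _ (LinearMap.inl F _ _) (P.quad N7 {1, 3, 5, 7} 3 1 7 5 (by decide) x)) := by
  rw [equivE7_apply]
  simp (decide := true) only [spComp_inc_of_ne, comp_inc_self, comp_inc_of_ne, ne_eq, map_zero,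
    add_zero, Prod.mk_zero_zero, zero_add]

theorem equivE7_2457 (x : P.VMod N7 {2, 4, 5, 7}) : P.equivE7 (P.inc N7 SE7 {2, 4, 5, 7} x) =
    MagicAlg.iota P.S8 P.S4 2
      (LinearMap.rTensor _ (LinearMap.inr F _ _) (P.quad N7 {2, 4, 5, 7} 2 4 7 5 (by decide) x)) := by
  rw [equivE7_apply]
  simp (decide := true) only [spComp_inc_of_ne, comp_inc_self, comp_inc_of_ne, ne_eq, map_zero,
    add_zero, Prod.mk_zero_zero, zero_add]

theorem isE7Identification_equivE7 : P.IsE7Identification P.equivE7.toLinearMap where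
  sp s := ⟨_, P.equivE7_sp s, P.spTri8_val _ _ _ _, P.spTri4_val _ _ _⟩
  v1234 v := ⟨_, P.equivE7_1234 _, by rw [quad_pureTensor, tensorTri8_val]⟩
  v1256 v := (P.equivE7_1256 _).trans (by rw [quad_pureTensor]; rfl)
  v3456 v := (P.equivE7_3456 _).trans (by rw [quad_pureTensor]; rfl)
  v2367 v := (P.equivE7_2367 _).trans (by rw [quad_pureTensor]; rfl)
  v1467 v := (P.equivE7_1467 _).trans (by rw [quad_pureTensor]; rfl)
  v1357 v := (P.equivE7_1357 _).trans (by rw [quad_pureTensor]; rfl)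
  v2457 v := (P.equivE7_2457 _).trans (by rw [quad_pureTensor]; rfl)

end SymplecticPlane

/-! ### The isomorphism `Φ` for `𝔡₆` -/

namespace SymplecticPlane

open MagicModels

variable {F V : Type*} [Field F] [AddCommGroup V] [Module F V] (P : SymplecticPlane F V)

/-- The coordinates on the model of `𝔡₆`. -/
noncomputable def coordD6 : P.Model N6 SD6 →ₗ[F]
    ((P.sp × P.sp × P.sp) × (P.sp × P.sp × P.sp)) × (Fin 3 → W F V) :=
  LinearMap.prod
    (LinearMap.prod
      (LinearMap.prod (P.spComp _ _ 1) <| LinearMap.prod (P.spComp _ _ 2) (P.spComp _ _ 3))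
      (LinearMap.prod (P.spComp _ _ 5) <| LinearMap.prod (P.spComp _ _ 6) (P.spComp _ _ 7)))
    (LinearMap.pi ![
      (P.quad N6 {1, 2, 5, 6} 1 2 5 6 (by decide)).toLinearMap ∘ₗ P.comp _ _ _,
      (P.quad N6 {2, 3, 6, 7} 2 3 6 7 (by decide)).toLinearMap ∘ₗ P.comp _ _ _,
      (P.quad N6 {1, 3, 5, 7} 3 1 7 5 (by decide)).toLinearMap ∘ₗ P.comp _ _ _])

/-- The element of the model of `𝔡₆` with given coordinates. -/
noncomputable def ofCoordD6 : (((P.sp × P.sp × P.sp) × (P.sp × P.sp × P.sp)) ×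
      (Fin 3 → W F V)) → P.Model N6 SD6 := fun y =>
  P.inc N6 SD6 ∅ (P.ofSp N6 (P.nu N6 1 y.1.1.1 + P.nu N6 2 y.1.1.2.1 + P.nu N6 3 y.1.1.2.2 +
    P.nu N6 5 y.1.2.1 + P.nu N6 6 y.1.2.2.1 + P.nu N6 7 y.1.2.2.2)) +
  P.inc N6 SD6 _ ((P.quad N6 {1, 2, 5, 6} 1 2 5 6 (by decide)).symm (y.2 0)) +
  P.inc N6 SD6 _ ((P.quad N6 {2, 3, 6, 7} 2 3 6 7 (by decide)).symm (y.2 1)) +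
  P.inc N6 SD6 _ ((P.quad N6 {1, 3, 5, 7} 3 1 7 5 (by decide)).symm (y.2 2))

theorem coordD6_surjective : Function.Surjective P.coordD6 := by
  intro y
  refine ⟨P.ofCoordD6 y, ?_⟩
  obtain ⟨⟨⟨s1, s2, s3⟩, s5, s6, s7⟩, u⟩ := y
  have h0 : ∅ ∈ SD6 := by decide
  have hs : ∀ i, P.spComp N6 SD6 i (P.ofCoordD6 (((s1, s2, s3), s5, s6, s7), u)) =
      P.spAt N6 i (P.nu N6 1 s1 + P.nu N6 2 s2 + P.nu N6 3 s3 + P.nu N6 5 s5 +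
        P.nu N6 6 s6 + P.nu N6 7 s7) := by
    intro i
    simp (decide := true) only [ofCoordD6, map_add, P.spComp_inc_ofSp N6 h0, spComp_inc_of_ne,
      ne_eq, add_zero]
  have hq : ∀ (σ : Finset ℕ) i j k l (h : {i, j, k, l} = σ ∧ σ.card = 4) z y,
      P.comp N6 SD6 σ z = (P.quad N6 σ i j k l h).symm y →
      P.quad N6 σ i j k l h (P.comp N6 SD6 σ z) = y := by
    intro σ i j k l h z y hy
    rw [hy, LinearEquiv.apply_symm_apply]
  refine Prod.ext (Prod.ext (Prod.ext ?_ <| Prod.ext ?_ ?_) <|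
    Prod.ext ?_ <| Prod.ext ?_ ?_) (funext fun k => ?_)
  iterate 6
    refine (hs _).trans ?_
    simp (decide := true) only [map_add, spAt_nu_self, spAt_nu_of_ne, ne_eq, add_zero, zero_add]
  · fin_cases k <;> refine hq _ _ _ _ _ (by decide) _ _ ?_ <;>
    simp (decide := true) only [ofCoordD6, map_add, comp_inc_self, comp_inc_of_ne, ne_eq, add_zero,
      zero_add] <;> rfl

theorem coordD6_injective : Function.Injective P.coordD6 := by
  refine (injective_iff_map_eq_zero P.coordD6).2 fun x hx => ?_
  have h1 := congrArg (fun y => y.1.1) hx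
  have h2 := congrArg (fun y => y.1.2) hx
  have h4 := congrArg (fun y => y.2) hx
  refine P.model_eq_zero ?_
  simp only [SD6, Finset.mem_insert, Finset.mem_singleton]
  rintro σ (rfl | rfl | rfl | rfl)
  · refine P.comp_empty_eq_zero N6 ?_
    simp only [N6, Finset.mem_insert, Finset.mem_singleton]
    rintro i (rfl | rfl | rfl | rfl | rfl | rfl)
    exacts [congrArg (·.1) h1, congrArg (·.2.1) h1, congrArg (·.2.2) h1,
      congrArg (·.1) h2, congrArg (·.2.1) h2, congrArg (·.2.2) h2]
  · exact (P.quad N6 {1, 2, 5, 6} 1 2 5 6 (by decide)).map_eq_zero_iff.1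
      (congrArg (fun u => u 0) h4)
  · exact (P.quad N6 {2, 3, 6, 7} 2 3 6 7 (by decide)).map_eq_zero_iff.1
      (congrArg (fun u => u 1) h4)
  · exact (P.quad N6 {1, 3, 5, 7} 3 1 7 5 (by decide)).map_eq_zero_iff.1
      (congrArg (fun u => u 2) h4)

variable [NeZero (2 : F)]

/-- The natural identification of the model of `𝔡₆` with `𝔡₆`. -/
noncomputable def equivD6 : P.Model N6 SD6 ≃ₗ[F] P.D6 :=
  (LinearEquiv.ofBijective P.coordD6 ⟨P.coordD6_injective, P.coordD6_surjective⟩).trans <|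
    ((LinearEquiv.ofBijective _ P.spTri4_bijective).prodCongr
      (LinearEquiv.ofBijective _ P.spTri4_bijective)).prodCongr (LinearEquiv.refl F _)

theorem equivD6_apply (x : P.Model N6 SD6) : P.equivD6 x =
    MagicAlg.triIncl P.S4 P.S4
      (P.spTri4 (P.spComp N6 SD6 1 x, P.spComp N6 SD6 2 x, P.spComp N6 SD6 3 x),
      P.spTri4 (P.spComp N6 SD6 5 x, P.spComp N6 SD6 6 x, P.spComp N6 SD6 7 x)) +
    MagicAlg.iota P.S4 P.S4 0 (P.quad N6 {1, 2, 5, 6} 1 2 5 6 (by decide) (P.comp N6 SD6 _ x)) +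
    MagicAlg.iota P.S4 P.S4 1 (P.quad N6 {2, 3, 6, 7} 2 3 6 7 (by decide) (P.comp N6 SD6 _ x)) +
    MagicAlg.iota P.S4 P.S4 2 (P.quad N6 {1, 3, 5, 7} 3 1 7 5 (by decide) (P.comp N6 SD6 _ x)) := by
  refine Prod.ext ?_ (funext fun k => ?_)
  · simp only [MagicAlg.triIncl_apply, MagicAlg.iota_apply, Prod.fst_add, add_zero]
    rfl
  · fin_cases k <;>
    · simp [MagicAlg.triIncl_apply, MagicAlg.iota_apply]
      rfl

theorem equivD6_sp (s : N6 → P.sp) : P.equivD6 (P.inc N6 SD6 ∅ (P.ofSp N6 s)) =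
    MagicAlg.triIncl P.S4 P.S4
      (P.spTri4 (P.spAt N6 1 s, P.spAt N6 2 s, P.spAt N6 3 s),
        P.spTri4 (P.spAt N6 5 s, P.spAt N6 6 s, P.spAt N6 7 s)) := by
  have h0 : ∅ ∈ SD6 := by decide
  rw [equivD6_apply]
  simp (decide := true) only [P.spComp_inc_ofSp N6 h0, comp_inc_of_ne, ne_eq, map_zero, add_zero]

theorem equivD6_1256 (x : P.VMod N6 {1, 2, 5, 6}) : P.equivD6 (P.inc N6 SD6 {1, 2, 5, 6} x) =
    MagicAlg.iota P.S4 P.S4 0 (P.quad N6 {1, 2, 5, 6} 1 2 5 6 (by decide) x) := by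
  rw [equivD6_apply]
  simp (decide := true) only [spComp_inc_of_ne, comp_inc_self, comp_inc_of_ne, ne_eq, map_zero,
    add_zero, Prod.mk_zero_zero, zero_add]

theorem equivD6_2367 (x : P.VMod N6 {2, 3, 6, 7}) : P.equivD6 (P.inc N6 SD6 {2, 3, 6, 7} x) =
    MagicAlg.iota P.S4 P.S4 1 (P.quad N6 {2, 3, 6, 7} 2 3 6 7 (by decide) x) := by
  rw [equivD6_apply]
  simp (decide := true) only [spComp_inc_of_ne, comp_inc_self, comp_inc_of_ne, ne_eq, map_zero,
    add_zero, Prod.mk_zero_zero, zero_add]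

theorem equivD6_1357 (x : P.VMod N6 {1, 3, 5, 7}) : P.equivD6 (P.inc N6 SD6 {1, 3, 5, 7} x) =
    MagicAlg.iota P.S4 P.S4 2 (P.quad N6 {1, 3, 5, 7} 3 1 7 5 (by decide) x) := by
  rw [equivD6_apply]
  simp (decide := true) only [spComp_inc_of_ne, comp_inc_self, comp_inc_of_ne, ne_eq, map_zero,
    add_zero, Prod.mk_zero_zero, zero_add]

theorem isD6Identification_equivD6 : P.IsD6Identification P.equivD6.toLinearMap where
  sp s := ⟨_, P.equivD6_sp s, P.spTri4_val _ _ _, P.spTri4_val _ _ _⟩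
  v1256 v := (P.equivD6_1256 _).trans (by rw [quad_pureTensor])
  v2367 v := (P.equivD6_2367 _).trans (by rw [quad_pureTensor])
  v1357 v := (P.equivD6_1357 _).trans (by rw [quad_pureTensor])

end SymplecticPlane

/-! ### The maps `φ_{σ,τ}` on generators -/

namespace SymplecticPlane

open MagicModels

variable {F V : Type*} [Field F] [AddCommGroup V] [Module F V] (P : SymplecticPlane F V)

theorem inc_castV (N : Finset ℕ) (𝒮 : Finset (Finset ℕ)) {σ τ : Finset ℕ} (h : σ = τ)
    (x : P.VMod N σ) : P.inc N 𝒮 τ (P.castV N h x) = P.inc N 𝒮 σ x := by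
  subst h
  rfl

theorem inc_phi_sp_sp (N : Finset ℕ) (𝒮 : Finset (Finset ℕ)) (s t : N → P.sp) :
    P.inc N 𝒮 _ (P.phi N ∅ ∅ (P.ofSp N s) (P.ofSp N t)) =
      P.inc N 𝒮 ∅ (P.ofSp N (P.spLiePi N s t)) := by
  rw [phi_sp_sp, inc_castV]
  rfl

theorem act_pure (N : Finset ℕ) {τ : Finset ℕ} (hτ : τ ≠ ∅) (s : N → P.sp) (v : ℕ → V) :
    (P.tensorEquiv N hτ).symm (P.act N τ s (PiTensorProduct.tprod F fun i : τ => v i)) =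
      ∑ i ∈ τ, P.pureTensor N τ (Function.update v i ((P.spAt N i s).1 (v i))) := by
  rw [act_tprod, map_sum, ← Finset.sum_coe_sort τ]
  refine Finset.sum_congr rfl fun i _ => ?_
  rw [← P.tensorEquiv_symm_tprod N hτ]
  congr 2
  funext j
  by_cases hj : j = i
  · subst hj
    simp
  · rw [Function.update_of_ne hj, Function.update_of_ne fun h => hj (Subtype.ext h)]

theorem inc_phi_sp_pure (N : Finset ℕ) (𝒮 : Finset (Finset ℕ)) {τ : Finset ℕ} (hτ : τ ≠ ∅)
    (s : N → P.sp) (v : ℕ → V) :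
    P.inc N 𝒮 _ (P.phi N ∅ τ (P.ofSp N s) (P.pureTensor N τ v)) =
      ∑ i ∈ τ, P.inc N 𝒮 τ (P.pureTensor N τ (Function.update v i ((P.spAt N i s).1 (v i)))) := by
  rw [← P.tensorEquiv_symm_tprod N hτ, phi_sp_tensor, inc_castV, act_pure, map_sum]

theorem inc_phi_pure_sp (N : Finset ℕ) (𝒮 : Finset (Finset ℕ)) {τ : Finset ℕ} (hτ : τ ≠ ∅)
    (s : N → P.sp) (v : ℕ → V) :
    P.inc N 𝒮 _ (P.phi N τ ∅ (P.pureTensor N τ v) (P.ofSp N s)) =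
      -∑ i ∈ τ, P.inc N 𝒮 τ (P.pureTensor N τ (Function.update v i ((P.spAt N i s).1 (v i)))) := by
  rw [← P.tensorEquiv_symm_tprod N hτ, phi_tensor_sp, map_neg, inc_castV, act_pure, map_sum]

theorem inc_phi_pure_self (N : Finset ℕ) (𝒮 : Finset (Finset ℕ)) {σ : Finset ℕ} (hσ : σ ≠ ∅)
    (v w : ℕ → V) : P.inc N 𝒮 _ (P.phi N σ σ (P.pureTensor N σ v) (P.pureTensor N σ w)) =
      P.inc N 𝒮 ∅ (P.ofSp N (P.selfFun N σ v w)) := by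
  rw [P.phi_pure_self N hσ, inc_castV]
  rfl

theorem spAt_spLiePi (N : Finset ℕ) (i : ℕ) (s t : N → P.sp) :
    P.spAt N i (P.spLiePi N s t) = P.spLie (P.spAt N i s) (P.spAt N i t) := by
  simp only [spAt]
  split_ifs
  · rfl
  · simp

theorem spAt_selfFun (N σ : Finset ℕ) (i : ℕ) (hi : i ∈ N) (v w : ℕ → V) :
    P.spAt N i (P.selfFun N σ v w) =
      (-(2⁻¹ * if i ∈ σ then ∏ k ∈ σ.erase i, P.form (v k) (w k) else 0) : F) •
        P.gamma (v i) (w i) := by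
  refine Eq.trans ?_ (neg_smul _ (P.gamma (v i) (w i))).symm
  rw [selfFun, map_neg, map_smul, map_sum, mul_smul]
  congr 2
  split_ifs with h
  · rw [Finset.sum_eq_single_of_mem i h, map_smul, P.spAt_nu_self N hi]
    intro j _ hj
    rw [map_smul, P.spAt_nu_of_ne N hj.symm, smul_zero]
  · rw [zero_smul]
    refine Finset.sum_eq_zero fun j hj => ?_
    rw [map_smul, P.spAt_nu_of_ne N (fun h' : i = j => h (by rwa [h'])), smul_zero]

/-- Linear maps on `V(σ)`, `σ ≠ ∅`, are determined by their values on pure tensors. -/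
theorem VMod_ext {N σ : Finset ℕ} (hσ : σ ≠ ∅) {M : Type*} [AddCommGroup M] [Module F M]
    {f g : P.VMod N σ →ₗ[F] M} (h : ∀ v, f (P.pureTensor N σ v) = g (P.pureTensor N σ v)) :
    f = g := by
  have h' : f ∘ₗ (P.tensorEquiv N hσ).symm.toLinearMap =
      g ∘ₗ (P.tensorEquiv N hσ).symm.toLinearMap := by
    refine PiTensorProduct.ext (MultilinearMap.ext fun v => ?_)
    have hv : v = fun i : σ => (fun j => if h : j ∈ σ then v ⟨j, h⟩ else 0 : ℕ → V) i := by
      funext i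
      simp
    rw [hv]
    have h1 := P.tensorEquiv_symm_tprod N hσ fun j => if h : j ∈ σ then v ⟨j, h⟩ else 0
    exact (congrArg f h1).trans <| (h _).trans (congrArg g h1).symm
  refine LinearMap.ext fun x => ?_
  simpa using LinearMap.congr_fun h' (P.tensorEquiv N hσ x)

theorem VMod_ext₂ {N σ τ : Finset ℕ} (hσ : σ ≠ ∅) (hτ : τ ≠ ∅) {M : Type*} [AddCommGroup M]
    [Module F M] {f g : P.VMod N σ →ₗ[F] P.VMod N τ →ₗ[F] M}
    (h : ∀ v w, f (P.pureTensor N σ v) (P.pureTensor N τ w) =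
      g (P.pureTensor N σ v) (P.pureTensor N τ w)) : f = g :=
  P.VMod_ext hσ fun v => P.VMod_ext hτ fun w => h v w

section Bracket

variable {N : Finset ℕ} {𝒮 : Finset (Finset ℕ)} {L : Type*} [AddCommGroup L] [Module F L]
  (B : L →ₗ[F] L →ₗ[F] L) (Φ : P.Model N 𝒮 →ₗ[F] L) (e : F)

/-- The difference of the two sides of `[x_σ, y_τ] = ε φ_{σ,τ}(x_σ, y_τ)`, where `[·, ·]` is
transported to the model through `Φ`. -/
noncomputable def defect (σ τ : Finset ℕ) : P.VMod N σ →ₗ[F] P.VMod N τ →ₗ[F] L :=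
  B.compl₁₂ (Φ ∘ₗ P.inc N 𝒮 σ) (Φ ∘ₗ P.inc N 𝒮 τ) -
    e • (P.phi N σ τ).compr₂ (Φ ∘ₗ P.inc N 𝒮 (symmDiff σ τ))

theorem defect_eq_zero_iff (σ τ : Finset ℕ) : P.defect B Φ e σ τ = 0 ↔
    ∀ x y, B (Φ (P.inc N 𝒮 σ x)) (Φ (P.inc N 𝒮 τ y)) =
      e • Φ (P.inc N 𝒮 _ (P.phi N σ τ x y)) := by
  constructor
  · intro h x y
    exact sub_eq_zero.1 (LinearMap.congr_fun₂ h x y)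
  · intro h
    exact LinearMap.ext₂ fun x y => sub_eq_zero.2 (h x y)

variable {B Φ e}

theorem bracket_sp_sp (h : ∀ s t, B (Φ (P.inc N 𝒮 ∅ (P.ofSp N s))) (Φ (P.inc N 𝒮 ∅ (P.ofSp N t))) =
      e • Φ (P.inc N 𝒮 ∅ (P.ofSp N (P.spLiePi N s t)))) (x y : P.VMod N ∅) :
    B (Φ (P.inc N 𝒮 ∅ x)) (Φ (P.inc N 𝒮 ∅ y)) = e • Φ (P.inc N 𝒮 _ (P.phi N ∅ ∅ x y)) := by
  obtain ⟨s, rfl⟩ := (P.spEquiv N rfl).symm.surjective x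
  obtain ⟨t, rfl⟩ := (P.spEquiv N rfl).symm.surjective y
  exact (h s t).trans (by rw [← inc_phi_sp_sp]; rfl)

theorem bracket_sp_tensor {τ : Finset ℕ} (hτ : τ ≠ ∅)
    (h : ∀ s v, B (Φ (P.inc N 𝒮 ∅ (P.ofSp N s))) (Φ (P.inc N 𝒮 τ (P.pureTensor N τ v))) =
      e • ∑ i ∈ τ, Φ (P.inc N 𝒮 τ
        (P.pureTensor N τ (Function.update v i ((P.spAt N i s).1 (v i))))))
    (x : P.VMod N ∅) (y : P.VMod N τ) :
    B (Φ (P.inc N 𝒮 ∅ x)) (Φ (P.inc N 𝒮 τ y)) = e • Φ (P.inc N 𝒮 _ (P.phi N ∅ τ x y)) := by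
  obtain ⟨s, rfl⟩ := (P.spEquiv N rfl).symm.surjective x
  refine sub_eq_zero.1 (LinearMap.congr_fun (P.VMod_ext (f := P.defect B Φ e ∅ τ _) (g := 0) hτ
    fun v => sub_eq_zero.2 ((h s v).trans ?_)) y)
  rw [← map_sum, ← P.inc_phi_sp_pure N 𝒮 hτ]
  rfl

theorem bracket_tensor_sp {τ : Finset ℕ} (hτ : τ ≠ ∅)
    (h : ∀ s v, B (Φ (P.inc N 𝒮 τ (P.pureTensor N τ v))) (Φ (P.inc N 𝒮 ∅ (P.ofSp N s))) =
      e • -∑ i ∈ τ, Φ (P.inc N 𝒮 τ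
        (P.pureTensor N τ (Function.update v i ((P.spAt N i s).1 (v i))))))
    (y : P.VMod N τ) (x : P.VMod N ∅) :
    B (Φ (P.inc N 𝒮 τ y)) (Φ (P.inc N 𝒮 ∅ x)) = e • Φ (P.inc N 𝒮 _ (P.phi N τ ∅ y x)) := by
  obtain ⟨s, rfl⟩ := (P.spEquiv N rfl).symm.surjective x
  refine sub_eq_zero.1 (LinearMap.congr_fun (P.VMod_ext (f := (P.defect B Φ e τ ∅).flip _) (g := 0)
    hτ fun v => sub_eq_zero.2 ((h s v).trans ?_)) y)
  rw [← map_sum, ← map_neg, ← P.inc_phi_pure_sp N 𝒮 hτ]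
  rfl

theorem bracket_tensor_self {σ : Finset ℕ} (hσ : σ ≠ ∅)
    (h : ∀ v w, B (Φ (P.inc N 𝒮 σ (P.pureTensor N σ v))) (Φ (P.inc N 𝒮 σ (P.pureTensor N σ w))) =
      e • Φ (P.inc N 𝒮 ∅ (P.ofSp N (P.selfFun N σ v w)))) (x y : P.VMod N σ) :
    B (Φ (P.inc N 𝒮 σ x)) (Φ (P.inc N 𝒮 σ y)) = e • Φ (P.inc N 𝒮 _ (P.phi N σ σ x y)) := by
  refine (P.defect_eq_zero_iff B Φ e σ σ).1 (P.VMod_ext₂ hσ hσ fun v w => ?_) x y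
  refine sub_eq_zero.2 ((h v w).trans ?_)
  rw [← P.inc_phi_pure_self N 𝒮 hσ]
  rfl

theorem bracket_tensor_tensor {σ τ : Finset ℕ} (hσ : σ ≠ ∅) (hτ : τ ≠ ∅) (hne : σ ≠ τ)
    (h : ∀ v w, B (Φ (P.inc N 𝒮 σ (P.pureTensor N σ v))) (Φ (P.inc N 𝒮 τ (P.pureTensor N τ w))) =
      (e * ∏ i ∈ σ, if i ∈ τ then P.form (v i) (w i) else 1) •
        Φ (P.inc N 𝒮 (symmDiff σ τ) (P.pureTensor N (symmDiff σ τ)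
          fun j => if j ∈ σ then v j else w j))) (x : P.VMod N σ) (y : P.VMod N τ) :
    B (Φ (P.inc N 𝒮 σ x)) (Φ (P.inc N 𝒮 τ y)) = e • Φ (P.inc N 𝒮 _ (P.phi N σ τ x y)) := by
  refine (P.defect_eq_zero_iff B Φ e σ τ).1 (P.VMod_ext₂ hσ hτ fun v w => ?_) x y
  refine sub_eq_zero.2 ((h v w).trans ?_)
  rw [Finset.prod_ite_mem, mul_smul, ← map_smul Φ, ← map_smul (P.inc N 𝒮 _), ← P.phi_pure_pure N hσ hτ hne]
  rfl

/-- If `[x_σ, y_τ] = ε(σ, τ) φ_{σ,τ}(x_σ, y_τ)` holds for pure tensors and for elements of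
`sp(V)^N`, then it holds on all of `V(σ) × V(τ)`; by anticommutativity the case `τ = ∅` follows from
the case `σ = ∅`. -/
theorem bracket_eq_of_generators (T : Finset ℕ → (ℕ → V) → L) (ε : Finset ℕ → Finset ℕ → ℤ)
    (hT : ∀ σ ∈ 𝒮, σ ≠ ∅ → ∀ v, Φ (P.inc N 𝒮 σ (P.pureTensor N σ v)) = T σ v)
    (hadd : ∀ σ ∈ 𝒮, ∀ τ ∈ 𝒮, symmDiff σ τ ∈ 𝒮)
    (hε_left : ∀ τ ∈ 𝒮, ε ∅ τ = 1) (hε_right : ∀ τ ∈ 𝒮, ε τ ∅ = 1)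
    (hB : ∀ X Y, B X Y = -B Y X)
    (h_sp_sp : ∀ s t, B (Φ (P.inc N 𝒮 ∅ (P.ofSp N s))) (Φ (P.inc N 𝒮 ∅ (P.ofSp N t))) =
      Φ (P.inc N 𝒮 ∅ (P.ofSp N (P.spLiePi N s t))))
    (h_sp_tensor : ∀ τ ∈ 𝒮, τ ≠ ∅ → ∀ s v, B (Φ (P.inc N 𝒮 ∅ (P.ofSp N s))) (T τ v) =
      ∑ i ∈ τ, T τ (Function.update v i ((P.spAt N i s).1 (v i))))
    (h_self : ∀ σ ∈ 𝒮, σ ≠ ∅ → ∀ v w, B (T σ v) (T σ w) =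
      (ε σ σ : F) • Φ (P.inc N 𝒮 ∅ (P.ofSp N (P.selfFun N σ v w))))
    (h_tensor : ∀ σ ∈ 𝒮, ∀ τ ∈ 𝒮, σ ≠ ∅ → τ ≠ ∅ → σ ≠ τ → ∀ v w, B (T σ v) (T τ w) =
      ((ε σ τ : F) * ∏ i ∈ σ, if i ∈ τ then P.form (v i) (w i) else 1) •
        T (symmDiff σ τ) fun j => if j ∈ σ then v j else w j)
    {σ τ : Finset ℕ} (hσ : σ ∈ 𝒮) (hτ : τ ∈ 𝒮) (x : P.VMod N σ) (y : P.VMod N τ) :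
    B (Φ (P.inc N 𝒮 σ x)) (Φ (P.inc N 𝒮 τ y)) =
      (ε σ τ : F) • Φ (P.inc N 𝒮 _ (P.phi N σ τ x y)) := by
  by_cases h0 : σ = ∅
  · subst h0
    rw [hε_left τ hτ, Int.cast_one]
    by_cases h1 : τ = ∅
    · subst h1
      exact P.bracket_sp_sp (fun s t => (h_sp_sp s t).trans (one_smul F _).symm) x y
    · refine P.bracket_sp_tensor h1 (fun s v => ?_) x y
      simp only [hT τ hτ h1, h_sp_tensor τ hτ h1, one_smul]
  by_cases h1 : τ = ∅
  · subst h1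
    rw [hε_right σ hσ, Int.cast_one]
    refine P.bracket_tensor_sp h0 (fun s v => ?_) x y
    simp only [hT σ hσ h0, one_smul]
    rw [hB, h_sp_tensor σ hσ h0]
  by_cases hne : σ = τ
  · subst hne
    refine P.bracket_tensor_self h0 (fun v w => ?_) x y
    simp only [hT σ hσ h0]
    exact h_self σ hσ h0 v w
  · refine P.bracket_tensor_tensor h0 h1 hne (fun v w => ?_) x y
    have h2 : symmDiff σ τ ≠ ∅ := fun h' => hne (symmDiff_eq_bot.1 h')
    simp only [hT σ hσ h0, hT τ hτ h1, hT _ (hadd σ hσ τ hτ) h2]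
    exact h_tensor σ hσ τ hτ h0 h1 hne v w

end Bracket

end SymplecticPlane

/-! ### The bracket of `𝔢₇` on the model -/

theorem SymmetricComposition.t_eq_neg_one_smul {F S : Type*} [Field F] [NeZero (2 : F)]
    [AddCommGroup S] [Module F S] (A : SymmetricComposition F S) (x y : S) :
    A.t x y = (-1 : F) • A.t y x :=
  (A.t_swap x y).trans (neg_one_smul F (A.t y x)).symm

namespace MagicAlg

variable {F S S' : Type*} [Field F] [NeZero (2 : F)] [AddCommGroup S] [Module F S]
  [AddCommGroup S'] [Module F S'] (A : SymmetricComposition F S) (A' : SymmetricComposition F S')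

theorem bracket_iota_zero_one (u v : S ⊗[F] S') :
    bracket A A' (iota A A' 0 u) (iota A A' 1 v) = iota A A' 2 (tmulMul A A' u v) :=
  bracket_iota_iota_succ A A' 0 u v

theorem bracket_iota_one_two (u v : S ⊗[F] S') :
    bracket A A' (iota A A' 1 u) (iota A A' 2 v) = iota A A' 0 (tmulMul A A' u v) :=
  bracket_iota_iota_succ A A' 1 u v

theorem bracket_iota_two_zero (u v : S ⊗[F] S') :
    bracket A A' (iota A A' 2 u) (iota A A' 0 v) = iota A A' 1 (tmulMul A A' u v) :=
  bracket_iota_iota_succ A A' 2 u v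

theorem bracket_iota_one_zero (u v : S ⊗[F] S') :
    bracket A A' (iota A A' 1 u) (iota A A' 0 v) = -iota A A' 2 (tmulMul A A' v u) :=
  bracket_iota_succ_iota A A' 0 u v

theorem bracket_iota_two_one (u v : S ⊗[F] S') :
    bracket A A' (iota A A' 2 u) (iota A A' 1 v) = -iota A A' 0 (tmulMul A A' v u) :=
  bracket_iota_succ_iota A A' 1 u v

theorem bracket_iota_zero_two (u v : S ⊗[F] S') :
    bracket A A' (iota A A' 0 u) (iota A A' 2 v) = -iota A A' 1 (tmulMul A A' v u) :=
  bracket_iota_succ_iota A A' 2 u v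

theorem thetaT_zero_tmul (a b : S) (x y : S') :
    thetaT A A' 0 (a ⊗ₜ x) (b ⊗ₜ y) = A'.pol x y • A.t a b := rfl

theorem thetaT_one_tmul (a b : S) (x y : S') :
    thetaT A A' 1 (a ⊗ₜ x) (b ⊗ₜ y) = A'.pol x y • A.theta (A.t a b) := rfl

theorem thetaT_two_tmul (a b : S) (x y : S') :
    thetaT A A' 2 (a ⊗ₜ x) (b ⊗ₜ y) = A'.pol x y • A.theta (A.theta (A.t a b)) := rfl

theorem thetaT'_zero_tmul (a b : S) (x y : S') :
    thetaT' A A' 0 (a ⊗ₜ x) (b ⊗ₜ y) = A.pol a b • A'.t x y := rfl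

theorem thetaT'_one_tmul (a b : S) (x y : S') :
    thetaT' A A' 1 (a ⊗ₜ x) (b ⊗ₜ y) = A.pol a b • A'.theta (A'.t x y) := rfl

theorem thetaT'_two_tmul (a b : S) (x y : S') :
    thetaT' A A' 2 (a ⊗ₜ x) (b ⊗ₜ y) = A.pol a b • A'.theta (A'.theta (A'.t x y)) := rfl

end MagicAlg

namespace SymplecticPlane

open MagicModels

variable {F V : Type*} [Field F] [AddCommGroup V] [Module F V] (P : SymplecticPlane F V)
variable [NeZero (2 : F)]

/-- The element of `𝔢₇` corresponding to the element `⊗_{i ∈ σ} v_i` of the model. -/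
noncomputable def tensorE7 (σ : Finset ℕ) (v : ℕ → V) : P.E7 :=
  if σ = {1, 2, 5, 6} then MagicAlg.iota P.S8 P.S4 0 ((v 1 ⊗ₜ v 2, 0) ⊗ₜ (v 5 ⊗ₜ v 6))
  else if σ = {2, 3, 6, 7} then MagicAlg.iota P.S8 P.S4 1 ((v 2 ⊗ₜ v 3, 0) ⊗ₜ (v 6 ⊗ₜ v 7))
  else if σ = {1, 3, 5, 7} then MagicAlg.iota P.S8 P.S4 2 ((v 3 ⊗ₜ v 1, 0) ⊗ₜ (v 7 ⊗ₜ v 5))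
  else if σ = {1, 2, 3, 4} then
    MagicAlg.triIncl P.S8 P.S4 (P.tensorTri8 ((v 1 ⊗ₜ v 2) ⊗ₜ (v 3 ⊗ₜ v 4)), 0)
  else if σ = {3, 4, 5, 6} then MagicAlg.iota P.S8 P.S4 0 ((0, v 3 ⊗ₜ v 4) ⊗ₜ (v 5 ⊗ₜ v 6))
  else if σ = {1, 4, 6, 7} then MagicAlg.iota P.S8 P.S4 1 ((0, v 1 ⊗ₜ v 4) ⊗ₜ (v 6 ⊗ₜ v 7))
  else if σ = {2, 4, 5, 7} then MagicAlg.iota P.S8 P.S4 2 ((0, v 2 ⊗ₜ v 4) ⊗ₜ (v 7 ⊗ₜ v 5))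
  else 0

theorem equivE7_pure {σ : Finset ℕ} (hσ : σ ∈ SE7) (h0 : σ ≠ ∅) (v : ℕ → V) :
    P.equivE7 (P.inc N7 SE7 σ (P.pureTensor N7 σ v)) = P.tensorE7 σ v := by
  have H := P.isE7Identification_equivE7
  simp only [SE7, Finset.mem_insert, Finset.mem_singleton] at hσ
  rcases hσ with rfl | rfl | rfl | rfl | rfl | rfl | rfl | rfl
  · exact absurd rfl h0
  · exact H.v1256 v
  · exact H.v2367 v
  · exact H.v1357 v
  · exact (P.equivE7_1234 _).trans (by rw [quad_pureTensor]; rfl)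
  · exact H.v3456 v
  · exact H.v1467 v
  · exact H.v2457 v

theorem tensorTri8_apply_zero (a b c d : V) (x y : V ⊗[F] V) :
    (P.tensorTri8 ((a ⊗ₜ b) ⊗ₜ (c ⊗ₜ d))).1 0 (x, y) =
      (P.tform (c ⊗ₜ d) y • a ⊗ₜ b, -(P.tform (a ⊗ₜ b) x • c ⊗ₜ d)) := by
  rw [tensorTri8_val]
  exact P.rhoTensor_apply _ _ _ _ (x, y)

theorem tensorTri8_apply_one (a b c d : V) (x y : V ⊗[F] V) :
    (P.tensorTri8 ((a ⊗ₜ b) ⊗ₜ (c ⊗ₜ d))).1 1 (x, y) =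
      (P.tform (a ⊗ₜ d) y • b ⊗ₜ c, -(P.tform (b ⊗ₜ c) x • a ⊗ₜ d)) := by
  rw [tensorTri8_val]
  exact P.rhoTensor_apply _ _ _ _ (x, y)

theorem tensorTri8_apply_two (a b c d : V) (x y : V ⊗[F] V) :
    (P.tensorTri8 ((a ⊗ₜ b) ⊗ₜ (c ⊗ₜ d))).1 2 (x, y) =
      (P.tform (b ⊗ₜ d) y • c ⊗ₜ a, -(P.tform (c ⊗ₜ a) x • b ⊗ₜ d)) := by
  rw [tensorTri8_val]
  exact P.rhoTensor_apply _ _ _ _ (x, y)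

set_option maxHeartbeats 4000000 in
/-- For distinct nonempty `σ`, `τ` both sides become a scalar multiple of one pure tensor in a single
component of `𝔢₇` when the products in `S₈` and `S₄` and the elements `t_{x,y}` are written out; the
signs come from the products and from `⟨w|v⟩ = -⟨v|w⟩`. -/
theorem bracket_tensorE7 {σ τ : Finset ℕ} (hσ : σ ∈ SE7) (hτ : τ ∈ SE7) (h0 : σ ≠ ∅) (h1 : τ ≠ ∅)
    (hne : σ ≠ τ) (v w : ℕ → V) :
    MagicAlg.bracket P.S8 P.S4 (P.tensorE7 σ v) (P.tensorE7 τ w) =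
      ((epsE7 σ τ : F) * ∏ i ∈ σ, if i ∈ τ then P.form (v i) (w i) else 1) •
        P.tensorE7 (symmDiff σ τ) fun j => if j ∈ σ then v j else w j := by
  have hs : ∀ i, P.form (w i) (v i) = -P.form (v i) (w i) := fun i => P.form_swap _ _
  have h2 : ∀ (c : F) (x : V ⊗[F] V),
    ((c • x, 0) : (V ⊗[F] V) × (V ⊗[F] V)) = c • (x, 0) := by simp
  have h3 : ∀ (c : F) (x : V ⊗[F] V),
    ((0, c • x) : (V ⊗[F] V) × (V ⊗[F] V)) = c • (0, x) := by simp
  have h4 : ∀ (c : F) (x : P.S8.tri), ((c • x, 0) : P.S8.tri × P.S4.tri) = c • (x, 0) := by simp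
  -- the sign is written as a scalar, to be collected with the other scalars
  have h5 : ∀ a b c d : V, P.S8.t (a ⊗ₜ b, 0) (0, c ⊗ₜ d) =
      (-1 : F) • P.tensorTri8 ((a ⊗ₜ b) ⊗ₜ (c ⊗ₜ d)) :=
    fun a b c d => P.S8.t_eq_neg_one_smul _ _
  simp only [SE7, Finset.mem_insert, Finset.mem_singleton] at hσ hτ
  rcases hσ with rfl | rfl | rfl | rfl | rfl | rfl | rfl | rfl <;> try contradiction
  all_goals
    rcases hτ with rfl | rfl | rfl | rfl | rfl | rfl | rfl | rfl <;> try contradiction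
  all_goals
    simp (decide := true) only [tensorE7, if_true, if_false, epsE7, tableIndex]
    simp only [MagicAlg.bracket_iota_zero_one, MagicAlg.bracket_iota_zero_two,
      MagicAlg.bracket_iota_one_two, MagicAlg.bracket_iota_one_zero,
      MagicAlg.bracket_iota_two_one, MagicAlg.bracket_iota_two_zero,
      MagicAlg.bracket_tri_iota, MagicAlg.bracket_iota_tri, MagicAlg.bracket_iota_iota_self,
      MagicAlg.tmulMul_tmul, MagicAlg.triAct_tmul, MagicAlg.thetaT_zero_tmul,
      MagicAlg.thetaT_one_tmul, MagicAlg.thetaT_two_tmul, MagicAlg.thetaT'_zero_tmul,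
      MagicAlg.thetaT'_one_tmul, MagicAlg.thetaT'_two_tmul, theta_tensorTri8,
      S8_mul, S4_mul, S8_pol, S4_pol, mul8_left_left, mul8_left_right, mul8_right_left,
      mul8_right_right, mul4_tmul, tform_tmul, map_zero, LinearMap.zero_apply, add_zero,
      h5, t8_right_left, neg_zero,
      tensorTri8_apply_zero, tensorTri8_apply_one, tensorTri8_apply_two, Submodule.coe_zero,
      Pi.zero_apply, zero_smul]
    try simp only [hs, ← neg_smul, h2, h3, h4, theta_tensorTri8, TensorProduct.tmul_smul, TensorProduct.smul_tmul,
      map_smul, TensorProduct.tmul_zero, add_zero]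
    try
      match_scalars
      simp [tableE7] <;> try ring

end SymplecticPlane

namespace SymplecticPlane

open MagicModels

variable {F V : Type*} [Field F] [AddCommGroup V] [Module F V] (P : SymplecticPlane F V)
variable [NeZero (2 : F)]

theorem epsE7_empty_left (τ : Finset ℕ) (hτ : τ ∈ SE7) : epsE7 ∅ τ = 1 := by
  revert τ
  decide

theorem epsE7_empty_right (τ : Finset ℕ) (hτ : τ ∈ SE7) : epsE7 τ ∅ = 1 := by
  revert τ
  decide

theorem epsE7_self (τ : Finset ℕ) (hτ : τ ∈ SE7) (h : τ ≠ ∅) : epsE7 τ τ = -1 := by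
  revert τ
  decide

theorem bracketE7_sp_sp (s t : N7 → P.sp) :
    MagicAlg.bracket P.S8 P.S4 (P.equivE7 (P.inc N7 SE7 ∅ (P.ofSp N7 s)))
      (P.equivE7 (P.inc N7 SE7 ∅ (P.ofSp N7 t))) =
      P.equivE7 (P.inc N7 SE7 ∅ (P.ofSp N7 (P.spLiePi N7 s t))) := by
  simp only [equivE7_sp, MagicAlg.bracket_tri_tri, triLie_spTri8, triLie_spTri4, spAt_spLiePi]

theorem spTri8_apply_zero (s₁ s₂ s₃ s₄ : P.sp) (x y : V ⊗[F] V) :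
    (P.spTri8 (s₁, s₂, s₃, s₄)).1 0 (x, y) = (P.act2 s₁ s₂ x, P.act2 s₃ s₄ y) := rfl

theorem spTri8_apply_one (s₁ s₂ s₃ s₄ : P.sp) (x y : V ⊗[F] V) :
    (P.spTri8 (s₁, s₂, s₃, s₄)).1 1 (x, y) = (P.act2 s₂ s₃ x, P.act2 s₁ s₄ y) := rfl

theorem spTri8_apply_two (s₁ s₂ s₃ s₄ : P.sp) (x y : V ⊗[F] V) :
    (P.spTri8 (s₁, s₂, s₃, s₄)).1 2 (x, y) = (P.act2 s₃ s₁ x, P.act2 s₂ s₄ y) := rfl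

theorem spTri4_apply_zero (s₁ s₂ s₃ : P.sp) :
    (P.spTri4 (s₁, s₂, s₃)).1 0 = P.act2 s₁ s₂ := rfl

theorem spTri4_apply_one (s₁ s₂ s₃ : P.sp) :
    (P.spTri4 (s₁, s₂, s₃)).1 1 = P.act2 s₂ s₃ := rfl

theorem spTri4_apply_two (s₁ s₂ s₃ : P.sp) :
    (P.spTri4 (s₁, s₂, s₃)).1 2 = P.act2 s₃ s₁ := rfl

theorem bracketE7_sp_tensor {τ : Finset ℕ} (hτ : τ ∈ SE7) (h0 : τ ≠ ∅) (s : N7 → P.sp)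
    (v : ℕ → V) :
    MagicAlg.bracket P.S8 P.S4 (P.equivE7 (P.inc N7 SE7 ∅ (P.ofSp N7 s))) (P.tensorE7 τ v) =
      ∑ i ∈ τ, P.tensorE7 τ (Function.update v i ((P.spAt N7 i s).1 (v i))) := by
  have h1 : ∀ x y : V ⊗[F] V, ((x + y, 0) : (V ⊗[F] V) × (V ⊗[F] V)) = (x, 0) + (y, 0) := by simp
  have h2 : ∀ x y : V ⊗[F] V, ((0, x + y) : (V ⊗[F] V) × (V ⊗[F] V)) = (0, x) + (0, y) := by simp
  rw [equivE7_sp]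
  simp only [SE7, Finset.mem_insert, Finset.mem_singleton] at hτ
  rcases hτ with rfl | rfl | rfl | rfl | rfl | rfl | rfl | rfl <;> try contradiction
  all_goals
    simp (decide := true) only [Finset.sum_insert, Finset.mem_insert, Finset.mem_singleton,
      not_false_eq_true, Finset.sum_singleton]
    simp (decide := true) only [tensorE7, if_true, if_false, Function.update_self,
      Function.update_of_ne, ne_eq]
  case inr.inr.inr.inr.inl =>
    rw [MagicAlg.bracket_tri_tri, map_zero, triLie_spTri8_tensorTri8]
    simp only [← map_add, Prod.mk_add_mk, add_zero, add_assoc]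
  all_goals
    simp only [MagicAlg.bracket_tri_iota, MagicAlg.triAct_tmul, spTri8_apply_zero,
      spTri8_apply_one, spTri8_apply_two, spTri4_apply_zero, spTri4_apply_one, spTri4_apply_two,
      act2_tmul, map_zero, h1, h2, TensorProduct.add_tmul, TensorProduct.tmul_add, map_add]
    abel

set_option maxHeartbeats 1000000 in
theorem bracketE7_tensor_self {σ : Finset ℕ} (hσ : σ ∈ SE7) (h0 : σ ≠ ∅) (v w : ℕ → V) :
    MagicAlg.bracket P.S8 P.S4 (P.tensorE7 σ v) (P.tensorE7 σ w) =
      (epsE7 σ σ : F) • P.equivE7 (P.inc N7 SE7 ∅ (P.ofSp N7 (P.selfFun N7 σ v w))) := by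
  rw [equivE7_sp, epsE7_self σ hσ h0, Int.cast_neg, Int.cast_one]
  simp only [SE7, Finset.mem_insert, Finset.mem_singleton] at hσ
  rcases hσ with rfl | rfl | rfl | rfl | rfl | rfl | rfl | rfl <;> try contradiction
  all_goals
    simp (decide := true) only [tensorE7, if_true, if_false, spAt_selfFun]
    simp (decide := true) only [Finset.erase_insert, Finset.prod_insert, Finset.erase_insert_of_ne,
      Finset.erase_singleton, Finset.prod_singleton, Finset.mem_insert, Finset.mem_singleton,
      insert_empty_eq, not_false_eq_true, ne_eq]
    simp only [MagicAlg.bracket_tri_tri, MagicAlg.bracket_iota_iota_self, MagicAlg.thetaT_zero_tmul,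
      MagicAlg.thetaT_one_tmul, MagicAlg.thetaT_two_tmul, MagicAlg.thetaT'_zero_tmul,
      MagicAlg.thetaT'_one_tmul, MagicAlg.thetaT'_two_tmul, t8_left_left, t8_right_right, t4_tmul,
      triLie_tensorTri8, theta_spTri8, theta_spTri4, map_add, map_smul, map_zero, mul_zero,
      zero_smul, neg_zero, S8_pol, S4_pol, tform_tmul, add_zero, zero_add]
    simp only [← map_smul, ← map_add, Prod.smul_mk, Prod.mk_add_mk, smul_zero, add_zero, zero_add,
      Prod.mk_zero_zero, map_zero, smul_smul]
    ring_nf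

/-- The multiplication of `𝔢₇` is given on the model by the maps `ε(σ, τ) φ_{σ,τ}`. -/
theorem bracket_equivE7 {σ τ : Finset ℕ} (hσ : σ ∈ SE7) (hτ : τ ∈ SE7) (x : P.VMod N7 σ)
    (y : P.VMod N7 τ) :
    MagicAlg.bracket P.S8 P.S4 (P.equivE7 (P.inc N7 SE7 σ x)) (P.equivE7 (P.inc N7 SE7 τ y)) =
      (epsE7 σ τ : F) • P.equivE7 (P.inc N7 SE7 (symmDiff σ τ) (P.phi N7 σ τ x y)) :=
  P.bracket_eq_of_generators (L := P.E7) (B := MagicAlg.bracket P.S8 P.S4)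
    (Φ := P.equivE7.toLinearMap) P.tensorE7 epsE7 (fun _ hσ h0 v => P.equivE7_pure hσ h0 v)
    (by decide) epsE7_empty_left epsE7_empty_right (MagicAlg.bracket_swap P.S8 P.S4)
    P.bracketE7_sp_sp (fun _ hτ h0 s v => P.bracketE7_sp_tensor hτ h0 s v)
    (fun _ hσ h0 v w => P.bracketE7_tensor_self hσ h0 v w)
    (fun _ hσ _ hτ h0 h1 hne v w => P.bracket_tensorE7 hσ hτ h0 h1 hne v w) hσ hτ x y

end SymplecticPlane

/-! ### The bracket of `𝔡₆` on the model -/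

namespace SymplecticPlane

open MagicModels

variable {F V : Type*} [Field F] [AddCommGroup V] [Module F V] (P : SymplecticPlane F V)
variable [NeZero (2 : F)]

/-- The element of `𝔡₆` corresponding to the element `⊗_{i ∈ σ} v_i` of the model. -/
noncomputable def tensorD6 (σ : Finset ℕ) (v : ℕ → V) : P.D6 :=
  if σ = {1, 2, 5, 6} then MagicAlg.iota P.S4 P.S4 0 ((v 1 ⊗ₜ v 2) ⊗ₜ (v 5 ⊗ₜ v 6))
  else if σ = {2, 3, 6, 7} then MagicAlg.iota P.S4 P.S4 1 ((v 2 ⊗ₜ v 3) ⊗ₜ (v 6 ⊗ₜ v 7))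
  else if σ = {1, 3, 5, 7} then MagicAlg.iota P.S4 P.S4 2 ((v 3 ⊗ₜ v 1) ⊗ₜ (v 7 ⊗ₜ v 5))
  else 0

theorem equivD6_pure {σ : Finset ℕ} (hσ : σ ∈ SD6) (h0 : σ ≠ ∅) (v : ℕ → V) :
    P.equivD6 (P.inc N6 SD6 σ (P.pureTensor N6 σ v)) = P.tensorD6 σ v := by
  have H := P.isD6Identification_equivD6
  simp only [SD6, Finset.mem_insert, Finset.mem_singleton] at hσ
  rcases hσ with rfl | rfl | rfl | rfl
  · exact absurd rfl h0
  · exact H.v1256 v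
  · exact H.v2367 v
  · exact H.v1357 v

theorem epsD6_empty_left (τ : Finset ℕ) (hτ : τ ∈ SD6) : epsD6 ∅ τ = 1 := by
  revert τ
  decide

theorem epsD6_empty_right (τ : Finset ℕ) (hτ : τ ∈ SD6) : epsD6 τ ∅ = 1 := by
  revert τ
  decide

theorem epsD6_self (τ : Finset ℕ) (hτ : τ ∈ SD6) (h : τ ≠ ∅) : epsD6 τ τ = -1 := by
  revert τ
  decide

set_option maxHeartbeats 4000000 in
theorem bracket_tensorD6 {σ τ : Finset ℕ} (hσ : σ ∈ SD6) (hτ : τ ∈ SD6) (h0 : σ ≠ ∅) (h1 : τ ≠ ∅)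
    (hne : σ ≠ τ) (v w : ℕ → V) :
    MagicAlg.bracket P.S4 P.S4 (P.tensorD6 σ v) (P.tensorD6 τ w) =
      ((epsD6 σ τ : F) * ∏ i ∈ σ, if i ∈ τ then P.form (v i) (w i) else 1) •
        P.tensorD6 (symmDiff σ τ) fun j => if j ∈ σ then v j else w j := by
  have hs : ∀ i, P.form (w i) (v i) = -P.form (v i) (w i) := fun i => P.form_swap _ _
  simp only [SD6, Finset.mem_insert, Finset.mem_singleton] at hσ hτ
  rcases hσ with rfl | rfl | rfl | rfl <;> try contradiction
  all_goals
    rcases hτ with rfl | rfl | rfl | rfl <;> try contradiction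
  all_goals
    simp (decide := true) only [tensorD6, if_true, if_false, epsD6, epsE7, tableIndex]
    simp only [MagicAlg.bracket_iota_zero_one, MagicAlg.bracket_iota_zero_two,
      MagicAlg.bracket_iota_one_two, MagicAlg.bracket_iota_one_zero,
      MagicAlg.bracket_iota_two_one, MagicAlg.bracket_iota_two_zero,
      MagicAlg.tmulMul_tmul, S4_mul, mul4_tmul]
    try simp only [hs, TensorProduct.tmul_smul, TensorProduct.smul_tmul,
      map_smul]
    try
      match_scalars
      simp [tableE7]
      try ring

theorem bracketD6_sp_sp (s t : N6 → P.sp) :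
    MagicAlg.bracket P.S4 P.S4 (P.equivD6 (P.inc N6 SD6 ∅ (P.ofSp N6 s)))
      (P.equivD6 (P.inc N6 SD6 ∅ (P.ofSp N6 t))) =
      P.equivD6 (P.inc N6 SD6 ∅ (P.ofSp N6 (P.spLiePi N6 s t))) := by
  simp only [equivD6_sp, MagicAlg.bracket_tri_tri, triLie_spTri4, spAt_spLiePi]

theorem bracketD6_sp_tensor {τ : Finset ℕ} (hτ : τ ∈ SD6) (h0 : τ ≠ ∅) (s : N6 → P.sp)
    (v : ℕ → V) :
    MagicAlg.bracket P.S4 P.S4 (P.equivD6 (P.inc N6 SD6 ∅ (P.ofSp N6 s))) (P.tensorD6 τ v) =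
      ∑ i ∈ τ, P.tensorD6 τ (Function.update v i ((P.spAt N6 i s).1 (v i))) := by
  rw [equivD6_sp]
  simp only [SD6, Finset.mem_insert, Finset.mem_singleton] at hτ
  rcases hτ with rfl | rfl | rfl | rfl <;> try contradiction
  all_goals
    simp (decide := true) only [Finset.sum_insert, Finset.mem_insert, Finset.mem_singleton,
      not_false_eq_true, Finset.sum_singleton]
    simp (decide := true) only [tensorD6, if_true, if_false, Function.update_self,
      Function.update_of_ne, ne_eq]
  all_goals
    simp only [MagicAlg.bracket_tri_iota, MagicAlg.triAct_tmul, spTri4_apply_zero, spTri4_apply_one, spTri4_apply_two,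
      act2_tmul, TensorProduct.add_tmul, TensorProduct.tmul_add, map_add]
    abel

theorem bracketD6_tensor_self {σ : Finset ℕ} (hσ : σ ∈ SD6) (h0 : σ ≠ ∅) (v w : ℕ → V) :
    MagicAlg.bracket P.S4 P.S4 (P.tensorD6 σ v) (P.tensorD6 σ w) =
      (epsD6 σ σ : F) • P.equivD6 (P.inc N6 SD6 ∅ (P.ofSp N6 (P.selfFun N6 σ v w))) := by
  rw [equivD6_sp, epsD6_self σ hσ h0, Int.cast_neg, Int.cast_one]
  simp only [SD6, Finset.mem_insert, Finset.mem_singleton] at hσ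
  rcases hσ with rfl | rfl | rfl | rfl <;> try contradiction
  all_goals
    simp (decide := true) only [tensorD6, if_true, if_false, spAt_selfFun]
    simp (decide := true) only [Finset.erase_insert, Finset.prod_insert, Finset.erase_insert_of_ne,
      Finset.erase_singleton, Finset.prod_singleton, Finset.mem_insert, Finset.mem_singleton,
      insert_empty_eq, not_false_eq_true, ne_eq]
    simp only [MagicAlg.bracket_iota_iota_self, MagicAlg.thetaT_zero_tmul,
      MagicAlg.thetaT_one_tmul, MagicAlg.thetaT_two_tmul, MagicAlg.thetaT'_zero_tmul,
      MagicAlg.thetaT'_one_tmul, MagicAlg.thetaT'_two_tmul, t4_tmul,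
      theta_spTri4, map_add, map_smul, mul_zero,
      zero_smul, neg_zero, S4_pol, tform_tmul]
    simp only [← map_smul, ← map_add, Prod.smul_mk, Prod.mk_add_mk, smul_zero, add_zero, zero_add,
      Prod.mk_zero_zero, smul_smul]
    ring_nf

/-- The multiplication of `𝔡₆` is given on the model by the maps `ε(σ, τ) φ_{σ,τ}`. -/
theorem bracket_equivD6 {σ τ : Finset ℕ} (hσ : σ ∈ SD6) (hτ : τ ∈ SD6) (x : P.VMod N6 σ)
    (y : P.VMod N6 τ) :
    MagicAlg.bracket P.S4 P.S4 (P.equivD6 (P.inc N6 SD6 σ x)) (P.equivD6 (P.inc N6 SD6 τ y)) =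
      (epsD6 σ τ : F) • P.equivD6 (P.inc N6 SD6 (symmDiff σ τ) (P.phi N6 σ τ x y)) :=
  P.bracket_eq_of_generators (L := P.D6) (B := MagicAlg.bracket P.S4 P.S4)
    (Φ := P.equivD6.toLinearMap) P.tensorD6 epsD6 (fun _ hσ h0 v => P.equivD6_pure hσ h0 v)
    (by decide) epsD6_empty_left epsD6_empty_right (MagicAlg.bracket_swap P.S4 P.S4)
    P.bracketD6_sp_sp (fun _ hτ h0 s v => P.bracketD6_sp_tensor hτ h0 s v)
    (fun _ hσ h0 v w => P.bracketD6_tensor_self hσ h0 v w)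
    (fun _ hσ _ hτ h0 h1 hne v w => P.bracket_tensorD6 hσ hτ h0 h1 hne v w) hσ hτ x y

end SymplecticPlane

/-! ### The inclusion of `𝔡₆` in `𝔢₇` -/

namespace SymplecticPlane

open MagicModels

variable {F V : Type*} [Field F] [AddCommGroup V] [Module F V] (P : SymplecticPlane F V)

section Extension

variable (N M : Finset ℕ)

theorem extV_castV {σ τ : Finset ℕ} (h : σ = τ) (x : P.VMod N σ) :
    P.extV N M τ (P.castV N h x) = P.castV M h (P.extV N M σ x) := by
  subst h
  rfl

/-- Extension by zero `sp(V)^N → sp(V)^M`. -/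
noncomputable def extSp : (N → P.sp) →ₗ[F] (M → P.sp) := LinearMap.pi fun i : M => P.spAt N i

theorem extV_ofSp (s : N → P.sp) : P.extV N M ∅ (P.ofSp N s) = P.ofSp M (P.extSp N M s) := by
  rw [extV, dif_pos rfl]
  rfl

theorem extV_tensorEquiv_symm {σ : Finset ℕ} (hσ : σ ≠ ∅) (u : ⨂[F] _ : σ, V) :
    P.extV N M σ ((P.tensorEquiv N hσ).symm u) = (P.tensorEquiv M hσ).symm u := by
  rw [extV, dif_neg hσ]
  rfl

theorem tensorEquiv_extV {σ : Finset ℕ} (hσ : σ ≠ ∅) (x : P.VMod N σ) :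
    P.tensorEquiv M hσ (P.extV N M σ x) = P.tensorEquiv N hσ x := by
  rw [extV, dif_neg hσ]
  rfl

theorem extV_pureTensor {σ : Finset ℕ} (hσ : σ ≠ ∅) (v : ℕ → V) :
    P.extV N M σ (P.pureTensor N σ v) = P.pureTensor M σ v := by
  rw [← P.tensorEquiv_symm_tprod N hσ, extV_tensorEquiv_symm, P.tensorEquiv_symm_tprod M hσ]

variable {N M}

theorem spAt_extSp {i : ℕ} (hi : i ∈ M) (s : N → P.sp) :
    P.spAt M i (P.extSp N M s) = P.spAt N i s := by
  rw [spAt, dif_pos hi]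
  rfl

theorem sp_ext {s t : M → P.sp} (h : ∀ i ∈ M, P.spAt M i s = P.spAt M i t) : s = t := by
  funext i
  have := h i i.2
  rwa [spAt, dif_pos i.2] at this

theorem extSp_spLiePi (s t : N → P.sp) :
    P.extSp N M (P.spLiePi N s t) = P.spLiePi M (P.extSp N M s) (P.extSp N M t) := by
  refine P.sp_ext fun i hi => ?_
  rw [P.spAt_extSp hi, spAt_spLiePi, spAt_spLiePi, P.spAt_extSp hi, P.spAt_extSp hi]

theorem extSp_selfFun {σ : Finset ℕ} (hσ : σ ⊆ N) (v w : ℕ → V) :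
    P.extSp N M (P.selfFun N σ v w) = P.selfFun M σ v w := by
  refine P.sp_ext fun i hi => ?_
  rw [P.spAt_extSp hi, P.spAt_selfFun M σ i hi]
  by_cases hN : i ∈ N
  · rw [P.spAt_selfFun N σ i hN]
  · rw [spAt, dif_neg hN, if_neg fun h => hN (hσ h), mul_zero, neg_zero, zero_smul]
    rfl

theorem act_extSp {τ : Finset ℕ} (hτ : τ ⊆ M) (s : N → P.sp) :
    P.act M τ (P.extSp N M s) = P.act N τ s := by
  refine PiTensorProduct.ext (MultilinearMap.ext fun v => ?_)
  refine (P.act_tprod M τ _ v).trans (Eq.trans ?_ (P.act_tprod N τ s v).symm)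
  refine Finset.sum_congr rfl fun i _ => ?_
  rw [P.spAt_extSp (hτ i.2)]

/-- The maps `φ_{σ,τ}` are compatible with the extension of the set of indices. -/
theorem extV_phi {σ τ : Finset ℕ} (hN : N ⊆ M) (hσ : σ ⊆ N) (hτ : τ ⊆ N) (x : P.VMod N σ)
    (y : P.VMod N τ) : P.extV N M _ (P.phi N σ τ x y) =
      P.phi M σ τ (P.extV N M σ x) (P.extV N M τ y) := by
  by_cases h0 : σ = ∅
  · subst h0
    obtain ⟨s, rfl⟩ := (P.spEquiv N rfl).symm.surjective x
    change P.extV N M _ (P.phi N ∅ τ (P.ofSp N s) y) =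
      P.phi M ∅ τ (P.extV N M ∅ (P.ofSp N s)) _
    by_cases h1 : τ = ∅
    · subst h1
      obtain ⟨t, rfl⟩ := (P.spEquiv N rfl).symm.surjective y
      change P.extV N M _ (P.phi N ∅ ∅ (P.ofSp N s) (P.ofSp N t)) =
        P.phi M ∅ ∅ _ (P.extV N M ∅ (P.ofSp N t))
      rw [extV_ofSp, extV_ofSp, phi_sp_sp, phi_sp_sp, extV_castV, ← extSp_spLiePi]
      exact congrArg _ (P.extV_ofSp N M _)
    · obtain ⟨u, rfl⟩ := (P.tensorEquiv N h1).symm.surjective y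
      rw [extV_ofSp, extV_tensorEquiv_symm, phi_sp_tensor, phi_sp_tensor, extV_castV,
        extV_tensorEquiv_symm, P.act_extSp (hτ.trans hN)]
  by_cases h1 : τ = ∅
  · subst h1
    obtain ⟨s, rfl⟩ := (P.spEquiv N rfl).symm.surjective y
    change P.extV N M _ (P.phi N σ ∅ x (P.ofSp N s)) =
      P.phi M σ ∅ _ (P.extV N M ∅ (P.ofSp N s))
    obtain ⟨u, rfl⟩ := (P.tensorEquiv N h0).symm.surjective x
    rw [extV_ofSp, extV_tensorEquiv_symm, phi_tensor_sp, phi_tensor_sp, map_neg, extV_castV,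
      extV_tensorEquiv_symm, P.act_extSp (hσ.trans hN)]
  refine LinearMap.congr_fun₂ (P.VMod_ext₂ (f := (P.phi N σ τ).compr₂ (P.extV N M _))
    (g := (P.phi M σ τ).compl₁₂ (P.extV N M σ) (P.extV N M τ)) h0 h1 fun v w => ?_) x y
  change P.extV N M _ (P.phi N σ τ _ _) = P.phi M σ τ (P.extV N M σ _) (P.extV N M τ _)
  rw [P.extV_pureTensor N M h0, P.extV_pureTensor N M h1]
  by_cases h : σ = τ
  · subst h
    rw [P.phi_pure_self N h0, P.phi_pure_self M h0, extV_castV, ← P.extSp_selfFun (N := N) (M := M) hσ v w]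
    exact congrArg _ (P.extV_ofSp N M _)
  · rw [P.phi_pure_pure N h0 h1 h, P.phi_pure_pure M h0 h1 h, map_smul, P.extV_pureTensor N M
      fun h' => h (symmDiff_eq_bot.1 h')]

theorem extV_injective (hN : N ⊆ M) (σ : Finset ℕ) : Function.Injective (P.extV N M σ) := by
  refine (injective_iff_map_eq_zero _).2 fun x hx => ?_
  by_cases h : σ = ∅
  · subst h
    obtain ⟨s, rfl⟩ := (P.spEquiv N rfl).symm.surjective x
    change P.extV N M ∅ (P.ofSp N s) = 0 at hx
    rw [extV_ofSp] at hx
    have h1 : P.extSp N M s = 0 := (P.spEquiv M rfl).symm.map_eq_zero_iff.1 hx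
    have h2 : s = 0 := P.sp_ext fun i hi => by
      rw [← P.spAt_extSp (hN hi), h1, map_zero, map_zero]
    rw [h2, map_zero]
  · refine (P.tensorEquiv N h).map_eq_zero_iff.1 ?_
    rw [← P.tensorEquiv_extV N M h, hx, map_zero]

theorem quad_extV (σ : Finset ℕ) (i j k l : ℕ) (h : {i, j, k, l} = σ ∧ σ.card = 4)
    (x : P.VMod N σ) : P.quad M σ i j k l h (P.extV N M σ x) = P.quad N σ i j k l h x :=
  congrArg (quadTensor h.1 h.2) (P.tensorEquiv_extV N M _ x)

variable (N M) in
/-- The map `⨁_{σ ∈ 𝒮} V(σ) → ⨁_{σ ∈ 𝒯} V(σ)` from the model for the set `N` of indices to the one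
for `M`, for `𝒮 ⊆ 𝒯` and `N ⊆ M`. -/
noncomputable def modelExt (𝒮 𝒯 : Finset (Finset ℕ)) : P.Model N 𝒮 →ₗ[F] P.Model M 𝒯 :=
  DirectSum.toModule F 𝒮 _ fun σ => P.inc M 𝒯 σ ∘ₗ P.extV N M σ

theorem modelExt_inc {𝒮 𝒯 : Finset (Finset ℕ)} {σ : Finset ℕ} (hσ : σ ∈ 𝒮) (x : P.VMod N σ) :
    P.modelExt N M 𝒮 𝒯 (P.inc N 𝒮 σ x) = P.inc M 𝒯 σ (P.extV N M σ x) := by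
  have h : P.inc N 𝒮 σ x = DirectSum.lof F 𝒮 (fun σ : 𝒮 => P.VMod N σ) ⟨σ, hσ⟩ x := by
    rw [inc, dif_pos hσ]
  rw [h, modelExt]
  exact DirectSum.toModule_lof (R := F) (M := fun σ : 𝒮 => P.VMod N σ)
    (φ := fun σ : 𝒮 => P.inc M 𝒯 σ ∘ₗ P.extV N M σ) ⟨σ, hσ⟩ x

theorem comp_modelExt {𝒮 𝒯 : Finset (Finset ℕ)} (h𝒮 : 𝒮 ⊆ 𝒯) {σ : Finset ℕ} (hσ : σ ∈ 𝒮)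
    (x : P.Model N 𝒮) :
    P.comp M 𝒯 σ (P.modelExt N M 𝒮 𝒯 x) = P.extV N M σ (P.comp N 𝒮 σ x) := by
  refine LinearMap.congr_fun (P.model_ext (f := P.comp M 𝒯 σ ∘ₗ P.modelExt N M 𝒮 𝒯)
    (g := P.extV N M σ ∘ₗ P.comp N 𝒮 σ) fun τ hτ y => ?_) x
  simp only [LinearMap.comp_apply]
  rw [P.modelExt_inc hτ]
  by_cases h : σ = τ
  · subst h
    rw [P.comp_inc_self M (h𝒮 hσ), P.comp_inc_self N hσ]
  · rw [P.comp_inc_of_ne M h, P.comp_inc_of_ne N h, map_zero]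

theorem modelExt_injective {𝒮 𝒯 : Finset (Finset ℕ)} (h𝒮 : 𝒮 ⊆ 𝒯) (hN : N ⊆ M) :
    Function.Injective (P.modelExt N M 𝒮 𝒯) := by
  refine (injective_iff_map_eq_zero _).2 fun x hx => P.model_eq_zero fun σ hσ => ?_
  refine (map_eq_zero_iff _ (P.extV_injective hN σ)).1 ?_
  rw [← P.comp_modelExt h𝒮 hσ, hx, map_zero]

/-- A linear map is compatible with two multiplications if it is so on the summands `V(σ)`. -/
theorem map_bracket_of_inc {𝒮 : Finset (Finset ℕ)} {L L' : Type*} [AddCommGroup L] [Module F L]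
    [AddCommGroup L'] [Module F L'] (B : L →ₗ[F] L →ₗ[F] L) (B' : L' →ₗ[F] L' →ₗ[F] L')
    (Φ : P.Model N 𝒮 ≃ₗ[F] L) (ψ : L →ₗ[F] L')
    (h : ∀ σ ∈ 𝒮, ∀ τ ∈ 𝒮, ∀ (x : P.VMod N σ) (y : P.VMod N τ),
      ψ (B (Φ (P.inc N 𝒮 σ x)) (Φ (P.inc N 𝒮 τ y))) =
        B' (ψ (Φ (P.inc N 𝒮 σ x))) (ψ (Φ (P.inc N 𝒮 τ y)))) (X Y : L) :
    ψ (B X Y) = B' (ψ X) (ψ Y) := by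
  obtain ⟨x, rfl⟩ := Φ.surjective X
  obtain ⟨y, rfl⟩ := Φ.surjective Y
  refine LinearMap.congr_fun (P.model_ext (f := (B.compr₂ ψ).flip (Φ y) ∘ₗ Φ.toLinearMap)
    (g := (B'.compl₁₂ ψ ψ).flip (Φ y) ∘ₗ Φ.toLinearMap) fun σ hσ x => ?_) x
  exact LinearMap.congr_fun (P.model_ext (f := B.compr₂ ψ (Φ (P.inc N 𝒮 σ x)) ∘ₗ Φ.toLinearMap)
    (g := B'.compl₁₂ ψ ψ (Φ (P.inc N 𝒮 σ x)) ∘ₗ Φ.toLinearMap) fun τ hτ y => h σ hσ τ hτ x y) y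

end Extension

theorem SD6_subset_SE7 : SD6 ⊆ SE7 := by decide

variable [NeZero (2 : F)]

/-- The inclusion of `𝔡₆` in `𝔢₇`. -/
noncomputable def inclD6 : P.D6 →ₗ[F] P.E7 :=
  P.equivE7.toLinearMap ∘ₗ P.modelExt N6 N7 SD6 SE7 ∘ₗ P.equivD6.symm.toLinearMap

theorem inclD6_equivD6 (x : P.Model N6 SD6) : P.inclD6 (P.equivD6 x) =
      P.equivE7 (P.modelExt N6 N7 SD6 SE7 x) := by
  simp only [inclD6, LinearMap.comp_apply, LinearEquiv.coe_coe, LinearEquiv.symm_apply_apply]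

theorem inclD6_injective : Function.Injective P.inclD6 :=
  P.equivE7.injective.comp ((P.modelExt_injective SD6_subset_SE7 (by decide)).comp P.equivD6.symm.injective)

theorem inclD6_bracket (X Y : P.D6) :
    P.inclD6 (MagicAlg.bracket P.S4 P.S4 X Y) =
      MagicAlg.bracket P.S8 P.S4 (P.inclD6 X) (P.inclD6 Y) := by
  refine P.map_bracket_of_inc (L := P.D6) (L' := P.E7) (MagicAlg.bracket P.S4 P.S4)
    (MagicAlg.bracket P.S8 P.S4) P.equivD6 P.inclD6 (fun σ hσ τ hτ x y => ?_) X Y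
  have hd : symmDiff σ τ ∈ SD6 :=
    (by decide : ∀ σ ∈ SD6, ∀ τ ∈ SD6, symmDiff σ τ ∈ SD6) σ hσ τ hτ
  have hs : ∀ σ ∈ SD6, σ ⊆ N6 := by decide
  rw [P.bracket_equivD6 hσ hτ, map_smul, inclD6_equivD6, inclD6_equivD6, inclD6_equivD6,
    P.modelExt_inc hσ, P.modelExt_inc hτ, P.modelExt_inc hd,
    P.bracket_equivE7 (SD6_subset_SE7 hσ) (SD6_subset_SE7 hτ),
    P.extV_phi (by decide) (hs σ hσ) (hs τ hτ)]
  rfl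

theorem inclD6_iota (i : Fin 3) (u : (V ⊗[F] V) ⊗[F] (V ⊗[F] V)) :
    P.inclD6 (MagicAlg.iota P.S4 P.S4 i u) = MagicAlg.iota P.S8 P.S4 i
      (LinearMap.rTensor (V ⊗[F] V) (LinearMap.inl F (V ⊗[F] V) (V ⊗[F] V)) u) := by
  fin_cases i
  · obtain ⟨x, rfl⟩ := (P.quad N6 {1, 2, 5, 6} 1 2 5 6 (by decide)).surjective u
    refine (congrArg P.inclD6 (P.equivD6_1256 x).symm).trans ?_
    rw [inclD6_equivD6, P.modelExt_inc (by decide), equivE7_1256, quad_extV]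
    rfl
  · obtain ⟨x, rfl⟩ := (P.quad N6 {2, 3, 6, 7} 2 3 6 7 (by decide)).surjective u
    refine (congrArg P.inclD6 (P.equivD6_2367 x).symm).trans ?_
    rw [inclD6_equivD6, P.modelExt_inc (by decide), equivE7_2367, quad_extV]
    rfl
  · obtain ⟨x, rfl⟩ := (P.quad N6 {1, 3, 5, 7} 3 1 7 5 (by decide)).surjective u
    refine (congrArg P.inclD6 (P.equivD6_1357 x).symm).trans ?_
    rw [inclD6_equivD6, P.modelExt_inc (by decide), equivE7_1357, quad_extV]
    rfl

end SymplecticPlane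

open MagicModels in
theorem mainTheorem5 {F V : Type*} [Field F] [NeZero (2 : F)] [AddCommGroup V] [Module F V]
    (P : SymplecticPlane F V) :
    -- the combinatorics of `𝒮` for `𝔢₇`: `χ₃`, the Fano plane, the signs, the octonions
    Set.BijOn (fun x => toSubset lab7 (chi3 x)) Set.univ SE7 ∧
    (Function.Injective fanoPoint ∧ Set.range fanoPoint = {0}ᶜ ∧
      ∀ σ : Finset ℕ, (σ ∈ SE7 ∧ σ ≠ ∅) ↔ IsFanoQuadrilateral σ) ∧
    (∀ x y, epsE7 (toSubset lab7 (chi3 x)) (toSubset lab7 (chi3 y)) = sgn (f x y)) ∧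
    (LinearIndependent ℝ Octonion.unit ∧ Submodule.span ℝ (Set.range Octonion.unit) = ⊤ ∧
      ∀ x y, Octonion.unit x * Octonion.unit y =
        (epsE7 (toSubset lab7 (chi3 x)) (toSubset lab7 (chi3 y)) : ℝ) • Octonion.unit (x + y)) ∧
    -- the combinatorics of `𝒮` for `𝔡₆`
    Set.BijOn (fun x => toSubset lab6 (chi2 x)) Set.univ SD6 ∧
    (∀ x y, epsD6 (toSubset lab6 (chi2 x)) (toSubset lab6 (chi2 y)) = sgn (f' x y)) ∧
    -- the Lie algebras `𝔢₇`, `𝔡₆` and their models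
    MagicAlg.IsLieAlgebra P.S8 P.S4 ∧
    MagicAlg.IsLieAlgebra P.S4 P.S4 ∧
    ∃ (Φ₇ : P.Model N7 SE7 ≃ₗ[F] P.E7) (Φ₆ : P.Model N6 SD6 ≃ₗ[F] P.D6) (ψ : P.D6 →ₗ[F] P.E7),
      P.IsE7Identification Φ₇.toLinearMap ∧
      (∀ σ ∈ SE7, ∀ τ ∈ SE7, symmDiff σ τ ∈ SE7 ∧ ∀ (x : P.VMod N7 σ) (y : P.VMod N7 τ),
        MagicAlg.bracket P.S8 P.S4 (Φ₇ (P.inc N7 SE7 σ x)) (Φ₇ (P.inc N7 SE7 τ y)) =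
          (epsE7 σ τ : F) • Φ₇ (P.inc N7 SE7 (symmDiff σ τ) (P.phi N7 σ τ x y))) ∧
      P.IsD6Identification Φ₆.toLinearMap ∧
      (∀ σ ∈ SD6, ∀ τ ∈ SD6, symmDiff σ τ ∈ SD6 ∧ ∀ (x : P.VMod N6 σ) (y : P.VMod N6 τ),
        MagicAlg.bracket P.S4 P.S4 (Φ₆ (P.inc N6 SD6 σ x)) (Φ₆ (P.inc N6 SD6 τ y)) =
          (epsD6 σ τ : F) • Φ₆ (P.inc N6 SD6 (symmDiff σ τ) (P.phi N6 σ τ x y))) ∧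
      -- `𝔡₆` is a subalgebra of `𝔢₇`, and its model is the restriction of that of `𝔢₇`
      Function.Injective ψ ∧
      (∀ X Y, ψ (MagicAlg.bracket P.S4 P.S4 X Y) = MagicAlg.bracket P.S8 P.S4 (ψ X) (ψ Y)) ∧
      (∀ i (u : (V ⊗[F] V) ⊗[F] (V ⊗[F] V)), ψ (MagicAlg.iota P.S4 P.S4 i u) =
        MagicAlg.iota P.S8 P.S4 i
          (LinearMap.rTensor (V ⊗[F] V) (LinearMap.inl F (V ⊗[F] V) (V ⊗[F] V)) u)) ∧
      ∀ σ ∈ SD6, ∀ x : P.VMod N6 σ,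
        ψ (Φ₆ (P.inc N6 SD6 σ x)) = Φ₇ (P.inc N7 SE7 σ (P.extV N6 N7 σ x)) := by
  have hE : ∀ σ ∈ SE7, ∀ τ ∈ SE7, symmDiff σ τ ∈ SE7 := by decide
  have hD : ∀ σ ∈ SD6, ∀ τ ∈ SD6, symmDiff σ τ ∈ SD6 := by decide
  refine ⟨bijOn_chi3, ⟨injective_fanoPoint, range_fanoPoint, mem_SE7_iff_isFanoQuadrilateral⟩,
    epsE7_chi3, ⟨Octonion.linearIndependent_unit, Octonion.span_range_unit, fun x y => ?_⟩,
    bijOn_chi2, epsD6_chi2, MagicAlg.isLieAlgebra P.S8 P.S4, MagicAlg.isLieAlgebra P.S4 P.S4,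
    P.equivE7, P.equivD6, P.inclD6, P.isE7Identification_equivE7,
    fun σ hσ τ hτ => ⟨hE σ hσ τ hτ, P.bracket_equivE7 hσ hτ⟩, P.isD6Identification_equivD6,
    fun σ hσ τ hτ => ⟨hD σ hσ τ hτ, P.bracket_equivD6 hσ hτ⟩, P.inclD6_injective,
    P.inclD6_bracket, P.inclD6_iota, fun σ hσ x => ?_⟩
  · rw [epsE7_chi3]
    exact Octonion.unit_mul x y
  · rw [P.inclD6_equivD6, P.modelExt_inc hσ]
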